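/- Let $G=SL(2,\mathbb C)$, $\mathfrak g=\mathfrak{sl}(2,\mathbb C)$ with standard basis $\mathbf e,\mathbf h,\mathbf f$, let $N_+$ and $T$ be the upper triangular unipotent and the diagonal subgroups, $\mathbf w_0=\begin{pmatrix}0&-1\\1&0\end{pmatrix}$, and let $G_0=N_+\mathbf w_0TN_+$ be the big Bruhat cell. The algebra $\mathfrak R(G_0)$ of regular functions on $G_0$ is a $\mathfrak g\oplus\mathfrak g$-module under $$(\pi_l(x)\psi)(g)=\tfrac{d}{dt}\psi(e^{-tx}g)\big|_{t=0},\qquad (\pi_r(x)\psi)(g)=\tfrac{d}{dt}\psi(g\,e^{tx})\big|_{t=0}.$$ Let $\omega$ be the involution of $\mathfrak g$ with $\mathbf e\mapsto-\mathbf f$, $\mathbf h\mapsto-\mathbf h$, $\mathbf f\mapsto-\mathbf e$. Let $\mathcal U(\mathfrak g)'$ be the space of linear functionals on the universal enveloping algebra, with the $\mathfrak g\oplus\mathfrak g$-action $(\pi_l(x)\phi)(u)=\phi(ux)$, $(\pi_r(x)\phi)(u)=-\phi(\omega(x)u)$. For a $\mathfrak g$-module $V$ with weight space decomposition $V=\bigoplus_\mu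 V[\mu]$, let $V^\star$ be the restricted dual $\bigoplus_\mu V[\mu]'$ with $\langle xv',v\rangle=-\langle v',\omega(x)v\rangle$, and let $\mathbb M(V)\subset\mathcal U(\mathfrak g)'$ be the span of the matrix elements $\phi_{v,v'}(u)=\langle v',uv\rangle$, $v\in V$, $v'\in V^\star$. Let $\mathcal O$ be the Bernstein--Gelfand--Gelfand category of finitely generated, locally $\mathbf e$-nilpotent $\mathfrak g$-modules with weight space decomposition. For each $\lambda\in-\mathbf P^{++}=\{-1,-2,-3,\dots\}$ the irreducible module $V_\lambda$ of highest weight $\lambda$ has a projective cover in $\mathcal O$. Let $P_\lambda$ be such a projective cover (a big projective module), for each $\lambda\in-\mathbf P^{++}$. 1. The map $\vartheta:\mathfrak R(G_0)\to\mathcal U(\mathfrak g)'$, $\vartheta_\psi(u)=(\pi_l(u)\psi)(\mathbf w_0)$, is an injective homomorphism of $\mathfrak g\oplus\mathfrak g$-modules, the sum of the subspaces $\mathbb M(P_\lambda)$, $\lambda\in-\mathbf P^{++}$, is direct, and it is the image of $\vartheta$. Thus $$\mathfrak R(G_0)\cong\bigoplus_{\lambda\in-\mathbf P^{++}}\mathbb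 M(P_\lambda).$$ 2. As a $\mathfrak g\oplus\mathfrak g$-module, $$\mathfrak R(G_0)\cong\bigoplus_{\lambda\in-\mathbf P^{++}}(P_\lambda\otimes P_\lambda^\star)/I_\lambda,$$ where $I_\lambda$ is the kernel of the $\mathfrak g\oplus\mathfrak g$-homomorphism $P_\lambda\otimes P_\lambda^\star\to\mathcal U(\mathfrak g)'$, $v\otimes v'\mapsto\phi_{v,v'}$. The isomorphism can be chosen so that the function corresponding to the class of $v\otimes v'$ is mapped by $\vartheta$ to $\phi_{v,v'}$. -/

import Mathlib

namespace BigCell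

attribute [local instance 100] LieRing.ofAssociativeRing

open scoped Matrix MatrixGroups

/-- The Lie algebra `g = sl(2, ℂ)` of traceless matrices. -/
abbrev sl2 : LieSubalgebra ℂ (Matrix (Fin 2) (Fin 2) ℂ) :=
  LieAlgebra.SpecialLinear.sl (Fin 2) ℂ

theorem mem_sl2_iff (x : Matrix (Fin 2) (Fin 2) ℂ) : x ∈ sl2 ↔ x.trace = 0 := Iff.rfl

def sl2E : sl2 := ⟨!![0, 1; 0, 0], by simp [mem_sl2_iff, Matrix.trace_fin_two]⟩
def sl2H : sl2 := ⟨!![1, 0; 0, -1], by simp [mem_sl2_iff, Matrix.trace_fin_two]⟩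
def sl2F : sl2 := ⟨!![0, 0; 1, 0], by simp [mem_sl2_iff, Matrix.trace_fin_two]⟩

/-- The involution of `g` with `e ↦ -f`, `h ↦ -h`, `f ↦ -e`, that is `x ↦ -xᵀ`
(conjugation by the representative `w0` of the longest Weyl group element). -/
def omega : sl2 →ₗ⁅ℂ⁆ sl2 where
  toFun x := ⟨-(x : Matrix (Fin 2) (Fin 2) ℂ)ᵀ, by
    have := (mem_sl2_iff _).1 x.2
    simp [mem_sl2_iff, this]⟩
  map_add' x y := by ext1; simp [add_comm]
  map_smul' c x := by ext1; simp
  map_lie' := by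
    intro x y
    ext1
    simp [LieRing.of_associative_ring_bracket, Matrix.transpose_sub, Matrix.transpose_mul]

theorem omega_e : omega sl2E = -sl2F := by
  ext i j; fin_cases i <;> fin_cases j <;> simp [omega, sl2E, sl2F]
theorem omega_h : omega sl2H = -sl2H := by
  ext i j; fin_cases i <;> fin_cases j <;> simp [omega, sl2H]
theorem omega_f : omega sl2F = -sl2E := by
  ext i j; fin_cases i <;> fin_cases j <;> simp [omega, sl2E, sl2F]

theorem lie_h_e : ⁅sl2H, sl2E⁆ = (2 : ℂ) • sl2E := by
  ext i j; fin_cases i <;> fin_cases j <;> simp [sl2H, sl2E, LieRing.of_associative_ring_bracket]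
  norm_num
theorem lie_h_f : ⁅sl2H, sl2F⁆ = (-2 : ℂ) • sl2F := by
  ext i j; fin_cases i <;> fin_cases j <;> simp [sl2H, sl2F, LieRing.of_associative_ring_bracket]
  norm_num
theorem lie_e_f : ⁅sl2E, sl2F⁆ = sl2H := by
  ext i j; fin_cases i <;> fin_cases j <;> simp [sl2H, sl2E, sl2F, LieRing.of_associative_ring_bracket]

theorem det_exp_sl2 (x : sl2) :
    (NormedSpace.exp (x : Matrix (Fin 2) (Fin 2) ℂ)).det = 1 := by
  set A : Matrix (Fin 2) (Fin 2) ℂ := (x : Matrix (Fin 2) (Fin 2) ℂ)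
  set J : Matrix (Fin 2) (Fin 2) ℂ := !![0, -1; 1, 0] with hJ
  have hJd : J.det = 1 := by simp [hJ, Matrix.det_fin_two]
  have hJu : IsUnit J := by
    rw [Matrix.isUnit_iff_isUnit_det, hJd]; exact isUnit_one
  have hJi : J⁻¹ = !![0, 1; -1, 0] := by
    rw [Matrix.inv_def, hJd]; simp [hJ, Matrix.adjugate_fin_two]
  have key : ∀ M : Matrix (Fin 2) (Fin 2) ℂ, J * M * J⁻¹ = M.adjugateᵀ := by
    intro M
    rw [hJi, Matrix.eta_fin_two M, hJ, Matrix.mul_fin_two, Matrix.mul_fin_two]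
    ext i j
    fin_cases i <;> fin_cases j <;> simp [Matrix.adjugate_fin_two]
  have htr : A 0 0 + A 1 1 = 0 := by
    have := (mem_sl2_iff _).1 x.2
    simpa [Matrix.trace_fin_two] using this
  have hadj : A.adjugate = -A := by
    ext i j
    fin_cases i <;> fin_cases j <;> simp [Matrix.adjugate_fin_two]
    · linear_combination htr
    · linear_combination htr
  have h1 := Matrix.exp_conj J A hJu
  rw [key, key, hadj, Matrix.exp_transpose, Matrix.exp_neg] at h1
  have h2 : (NormedSpace.exp A)⁻¹ = (NormedSpace.exp A).adjugate := Matrix.transpose_injective h1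
  have hu := Matrix.isUnit_exp A
  have hd := (Matrix.isUnit_iff_isUnit_det _).1 hu
  have h3 := Matrix.mul_adjugate (NormedSpace.exp A)
  rw [← h2, Matrix.mul_nonsing_inv _ hd] at h3
  have h4 := congrFun (congrFun h3 0) 0
  simpa using h4.symm

/-- The exponential map `g → SL(2, ℂ)`. -/
noncomputable def expSL (x : sl2) : SL(2, ℂ) :=
  ⟨NormedSpace.exp (x : Matrix (Fin 2) (Fin 2) ℂ), det_exp_sl2 x⟩

theorem coe_expSL (x : sl2) : (expSL x : Matrix (Fin 2) (Fin 2) ℂ) =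
    NormedSpace.exp (x : Matrix (Fin 2) (Fin 2) ℂ) := rfl

theorem expSL_zero : expSL 0 = 1 := by
  ext1; simp [expSL]

/-- Upper triangular unipotent matrices. -/
def unip (x : ℂ) : SL(2, ℂ) := ⟨!![1, x; 0, 1], by simp [Matrix.det_fin_two]⟩
/-- The representative of the longest Weyl group element. -/
def w0 : SL(2, ℂ) := ⟨!![0, -1; 1, 0], by simp [Matrix.det_fin_two]⟩
/-- Diagonal matrices of determinant one. -/
noncomputable def torus (z : ℂˣ) : SL(2, ℂ) := ⟨!![(z : ℂ), 0; 0, (z : ℂ)⁻¹], by simp [Matrix.det_fin_two]⟩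

/-- The big Bruhat cell `G₀ = N₊ w₀ T N₊` of `SL(2, ℂ)`. -/
def bigCell : Set SL(2, ℂ) := {g | ∃ (x y : ℂ) (z : ℂˣ), g = unip x * w0 * torus z * unip y}

theorem coe_cell (x y : ℂ) (z : ℂˣ) :
    ((unip x * w0 * torus z * unip y : SL(2, ℂ)) : Matrix (Fin 2) (Fin 2) ℂ) =
      !![x * z, x * y * z - (z : ℂ)⁻¹; (z : ℂ), y * z] := by
  have h1 : ∀ u : ℂ, (unip u : Matrix (Fin 2) (Fin 2) ℂ) = !![1, u; 0, 1] := fun _ => rfl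
  have h2 : (w0 : Matrix (Fin 2) (Fin 2) ℂ) = !![0, -1; 1, 0] := rfl
  have h3 : (torus z : Matrix (Fin 2) (Fin 2) ℂ) = !![(z : ℂ), 0; 0, (z : ℂ)⁻¹] := rfl
  rw [Matrix.SpecialLinearGroup.coe_mul, Matrix.SpecialLinearGroup.coe_mul,
    Matrix.SpecialLinearGroup.coe_mul, h1, h1, h2, h3, Matrix.mul_fin_two, Matrix.mul_fin_two,
    Matrix.mul_fin_two]
  ext i j
  fin_cases i <;> fin_cases j <;> simp <;> ring

theorem mem_bigCell_iff (g : SL(2, ℂ)) : g ∈ bigCell ↔ g 1 0 ≠ 0 := by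
  constructor
  · rintro ⟨x, y, z, rfl⟩
    rw [coe_cell]
    simp
  · intro hg
    refine ⟨g 0 0 / g 1 0, g 1 1 / g 1 0, Units.mk0 _ hg, ?_⟩
    have hd : g 0 0 * g 1 1 - g 0 1 * g 1 0 = 1 := by
      have := g.det_coe; rwa [Matrix.det_fin_two] at this
    apply Subtype.ext
    rw [coe_cell]
    ext i j
    fin_cases i <;> fin_cases j <;> simp <;> field_simp
    linear_combination -hd

theorem w0_mem : w0 ∈ bigCell := by
  rw [mem_bigCell_iff]
  simp [w0]

/-- The value of a polynomial in the four matrix entries. -/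
noncomputable def evalAt (g : SL(2, ℂ)) : MvPolynomial (Fin 2 × Fin 2) ℂ →ₐ[ℂ] ℂ :=
  MvPolynomial.aeval fun ij => g ij.1 ij.2

/-- A function on `G₀` is regular if it is, Zariski locally, a quotient of polynomials in the
matrix entries. -/
def IsRegular (ψ : bigCell → ℂ) : Prop :=
  ∀ g : bigCell, ∃ p q : MvPolynomial (Fin 2 × Fin 2) ℂ, evalAt g q ≠ 0 ∧
    ∀ k : bigCell, evalAt k q ≠ 0 → ψ k = evalAt k p / evalAt k q

/-- The algebra `R(G₀)` of regular functions on `G₀`. -/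
def regularFunctions : Subalgebra ℂ (bigCell → ℂ) where
  carrier := {ψ | IsRegular ψ}
  mul_mem' := by
    intro φ ψ hφ hψ g
    obtain ⟨p, q, hq, hpq⟩ := hφ g
    obtain ⟨r, s, hs, hrs⟩ := hψ g
    refine ⟨p * r, q * s, by simp [hq, hs], fun k hk => ?_⟩
    rw [map_mul, mul_ne_zero_iff] at hk
    simp only [Pi.mul_apply, map_mul, hpq k hk.1, hrs k hk.2]
    exact div_mul_div_comm _ _ _ _
  add_mem' := by
    intro φ ψ hφ hψ g
    obtain ⟨p, q, hq, hpq⟩ := hφ g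
    obtain ⟨r, s, hs, hrs⟩ := hψ g
    refine ⟨p * s + q * r, q * s, by simp [hq, hs], fun k hk => ?_⟩
    rw [map_mul, mul_ne_zero_iff] at hk
    simp only [Pi.add_apply, map_mul, map_add, hpq k hk.1, hrs k hk.2]
    exact div_add_div _ _ hk.1 hk.2
  algebraMap_mem' := by
    intro c g
    exact ⟨MvPolynomial.C c, 1, by simp, fun k _ => by simp [evalAt]⟩

open Classical in
/-- Extension by zero from `bigCell` to the group. -/
noncomputable def extendByZero (ψ : bigCell → ℂ) (g : SL(2, ℂ)) : ℂ :=
  if hg : g ∈ bigCell then ψ ⟨g, hg⟩ else 0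

/-- `(π_l(x) ψ)(g) = d/dt ψ(exp(-t x) g)` at `t = 0`. The point `exp(-t x) g` lies in `G₀` for
all small `t`; for regular `ψ` the derivative exists, see `hasDerivAt_left`. -/
noncomputable def leftDeriv (x : sl2) (ψ : bigCell → ℂ) (g : bigCell) : ℂ :=
  deriv (fun t : ℂ => extendByZero ψ (expSL (-(t • x)) * g)) 0

/-- `(π_r(x) ψ)(g) = d/dt ψ(g exp(t x))` at `t = 0`; see `hasDerivAt_right`. -/
noncomputable def rightDeriv (x : sl2) (ψ : bigCell → ℂ) (g : bigCell) : ℂ :=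
  deriv (fun t : ℂ => extendByZero ψ (g * expSL (t • x))) 0

/-- The polynomial vector field of the infinitesimal action of a pair of matrices. -/
noncomputable def vf (a b : Matrix (Fin 2) (Fin 2) ℂ) :
    Derivation ℂ (MvPolynomial (Fin 2 × Fin 2) ℂ) (MvPolynomial (Fin 2 × Fin 2) ℂ) :=
  MvPolynomial.mkDerivation ℂ fun ij =>
    ∑ k, (-(a ij.1 k)) • MvPolynomial.X (k, ij.2) + ∑ k, b k ij.2 • MvPolynomial.X (ij.1, k)

theorem evalAt_vf_X (a b : Matrix (Fin 2) (Fin 2) ℂ) (g : SL(2, ℂ)) (ij : Fin 2 × Fin 2) :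
    evalAt g (vf a b (MvPolynomial.X ij)) =
      (-(a * (g : Matrix (Fin 2) (Fin 2) ℂ)) + (g : Matrix (Fin 2) (Fin 2) ℂ) * b) ij.1 ij.2 := by
  simp [vf, evalAt, Matrix.mul_apply, MvPolynomial.mkDerivation_X]
  ring

theorem vf_add (a b a' b' : Matrix (Fin 2) (Fin 2) ℂ) :
    vf (a + a') (b + b') = vf a b + vf a' b' := by
  apply MvPolynomial.derivation_ext
  intro i
  simp [vf, MvPolynomial.mkDerivation_X, add_smul]
  ring

theorem vf_smul (c : ℂ) (a b : Matrix (Fin 2) (Fin 2) ℂ) :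
    vf (c • a) (c • b) = c • vf a b := by
  apply MvPolynomial.derivation_ext
  intro i
  simp [vf, MvPolynomial.mkDerivation_X, mul_smul]

theorem vf_lie (a b a' b' : Matrix (Fin 2) (Fin 2) ℂ) (p : MvPolynomial (Fin 2 × Fin 2) ℂ) :
    vf (a * a' - a' * a) (b * b' - b' * b) p =
      vf a b (vf a' b' p) - vf a' b' (vf a b p) := by
  have : vf (a * a' - a' * a) (b * b' - b' * b) = ⁅vf a b, vf a' b'⁆ := by
    apply MvPolynomial.derivation_ext
    rintro ⟨i, j⟩
    rw [Derivation.commutator_apply]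
    simp only [vf, MvPolynomial.mkDerivation_X, map_add, Derivation.map_smul,
      Fin.sum_univ_two, Matrix.sub_apply, Matrix.mul_apply]
    simp only [MvPolynomial.smul_eq_C_mul, map_sub, map_add, map_mul, map_neg]
    ring
  rw [this, Derivation.commutator_apply]

theorem hasDerivAt_evalAt (γ : ℂ → SL(2, ℂ)) (a b : Matrix (Fin 2) (Fin 2) ℂ)
    (hγ : ∀ i j, HasDerivAt (fun t => γ t i j)
      ((-(a * (γ 0 : Matrix (Fin 2) (Fin 2) ℂ)) + (γ 0 : Matrix (Fin 2) (Fin 2) ℂ) * b) i j) 0)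
    (p : MvPolynomial (Fin 2 × Fin 2) ℂ) :
    HasDerivAt (fun t => evalAt (γ t) p) (evalAt (γ 0) (vf a b p)) 0 := by
  induction p using MvPolynomial.induction_on with
  | C c =>
    have : vf a b (MvPolynomial.C c) = 0 := MvPolynomial.derivation_C _ _
    rw [this]
    simpa [evalAt] using hasDerivAt_const (0 : ℂ) c
  | add p q hp hq => simpa using hp.fun_add hq
  | mul_X p ij hp =>
    have h1 := hp.fun_mul (hγ ij.1 ij.2)
    rw [← evalAt_vf_X] at h1
    have h2 : ∀ g : SL(2, ℂ), evalAt g (MvPolynomial.X ij) = g ij.1 ij.2 := by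
      intro g; simp [evalAt]
    simp only [map_mul, Derivation.leibniz, map_add, smul_eq_mul, h2]
    refine h1.congr_deriv ?_
    rw [← h2 (γ 0)]
    ring

theorem hasDerivAt_extendByZero {ψ : bigCell → ℂ} {p q : MvPolynomial (Fin 2 × Fin 2) ℂ}
    (hpq : ∀ k : bigCell, evalAt k q ≠ 0 → ψ k = evalAt k p / evalAt k q)
    (g : bigCell) (hg : evalAt g q ≠ 0) (γ : ℂ → SL(2, ℂ)) (hγ0 : γ 0 = g)
    (a b : Matrix (Fin 2) (Fin 2) ℂ)
    (hγ : ∀ i j, HasDerivAt (fun t => γ t i j)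
      ((-(a * (γ 0 : Matrix (Fin 2) (Fin 2) ℂ)) + (γ 0 : Matrix (Fin 2) (Fin 2) ℂ) * b) i j) 0) :
    HasDerivAt (fun t => extendByZero ψ (γ t))
      (evalAt g (vf a b p * q - p * vf a b q) / evalAt g (q ^ 2)) 0 := by
  have hp := hasDerivAt_evalAt γ a b hγ p
  have hq := hasDerivAt_evalAt γ a b hγ q
  have hd := hp.div hq (by rw [hγ0]; exact hg)
  rw [hγ0] at hd
  simp only [map_sub, map_mul, map_pow]
  refine hd.congr_of_eventuallyEq ?_
  have h1 : ∀ᶠ t in nhds (0 : ℂ), γ t 1 0 ≠ 0 :=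
    (hγ 1 0).continuousAt.eventually_ne (by rw [hγ0]; exact (mem_bigCell_iff _).1 g.2)
  have h2 : ∀ᶠ t in nhds (0 : ℂ), evalAt (γ t) q ≠ 0 :=
    hq.continuousAt.eventually_ne (by rw [hγ0]; exact hg)
  filter_upwards [h1, h2] with t ht1 ht2
  have hm : γ t ∈ bigCell := (mem_bigCell_iff _).2 ht1
  simp only [extendByZero, hm, dif_pos]
  exact hpq ⟨γ t, hm⟩ ht2

open scoped Matrix.Norms.Operator in
theorem hasDerivAt_exp_entry (x g : Matrix (Fin 2) (Fin 2) ℂ) (i j : Fin 2) :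
    HasDerivAt (fun t : ℂ => (NormedSpace.exp (t • x) * g) i j) ((x * g) i j) 0 ∧
    HasDerivAt (fun t : ℂ => (g * NormedSpace.exp (t • x)) i j) ((g * x) i j) 0 := by
  have h0 := hasDerivAt_exp_smul_const (𝕂 := ℂ) x 0
  rw [zero_smul, NormedSpace.exp_zero, one_mul] at h0
  let l1 : Matrix (Fin 2) (Fin 2) ℂ →ₗ[ℂ] ℂ :=
    { toFun := fun M => (M * g) i j
      map_add' := fun M N => by simp [add_mul]
      map_smul' := fun c M => by simp }
  let l2 : Matrix (Fin 2) (Fin 2) ℂ →ₗ[ℂ] ℂ :=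
    { toFun := fun M => (g * M) i j
      map_add' := fun M N => by simp [mul_add]
      map_smul' := fun c M => by simp }
  exact ⟨(LinearMap.toContinuousLinearMap l1).hasFDerivAt.comp_hasDerivAt (0 : ℂ) h0,
    (LinearMap.toContinuousLinearMap l2).hasFDerivAt.comp_hasDerivAt (0 : ℂ) h0⟩

theorem hasDerivAt_left (x : sl2) {ψ : bigCell → ℂ} {p q : MvPolynomial (Fin 2 × Fin 2) ℂ}
    (hpq : ∀ k : bigCell, evalAt k q ≠ 0 → ψ k = evalAt k p / evalAt k q)
    (g : bigCell) (hg : evalAt g q ≠ 0) :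
    HasDerivAt (fun t : ℂ => extendByZero ψ (expSL (-(t • x)) * g))
      (evalAt g (vf x 0 p * q - p * vf x 0 q) / evalAt g (q ^ 2)) 0 := by
  refine hasDerivAt_extendByZero hpq g hg _ (by simp [expSL_zero]) _ _ fun i j => ?_
  have := (hasDerivAt_exp_entry (-x) (g : SL(2, ℂ)) i j).1
  simpa [coe_expSL] using this

theorem hasDerivAt_right (x : sl2) {ψ : bigCell → ℂ} {p q : MvPolynomial (Fin 2 × Fin 2) ℂ}
    (hpq : ∀ k : bigCell, evalAt k q ≠ 0 → ψ k = evalAt k p / evalAt k q)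
    (g : bigCell) (hg : evalAt g q ≠ 0) :
    HasDerivAt (fun t : ℂ => extendByZero ψ (g * expSL (t • x)))
      (evalAt g (vf 0 x p * q - p * vf 0 x q) / evalAt g (q ^ 2)) 0 := by
  refine hasDerivAt_extendByZero hpq g hg _ (by simp [expSL_zero]) _ _ fun i j => ?_
  have := (hasDerivAt_exp_entry x (g : SL(2, ℂ)) i j).2
  simpa [coe_expSL] using this

/-- The pair `(x, y)` acts by `π_l(x) + π_r(y)`. -/
noncomputable def regAct (a : sl2 × sl2) (ψ : bigCell → ℂ) : bigCell → ℂ :=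
  fun g => leftDeriv a.1 ψ g + rightDeriv a.2 ψ g

theorem regAct_eq (a : sl2 × sl2) {ψ : bigCell → ℂ} {p q : MvPolynomial (Fin 2 × Fin 2) ℂ}
    (hpq : ∀ k : bigCell, evalAt k q ≠ 0 → ψ k = evalAt k p / evalAt k q)
    (g : bigCell) (hg : evalAt g q ≠ 0) :
    regAct a ψ g =
      evalAt g (vf a.1 a.2 p * q - p * vf a.1 a.2 q) / evalAt g (q ^ 2) := by
  have hv : ∀ r, vf a.1 a.2 r = vf a.1 0 r + vf 0 a.2 r := by
    intro r
    have := vf_add (a.1 : Matrix (Fin 2) (Fin 2) ℂ) 0 0 (a.2 : Matrix (Fin 2) (Fin 2) ℂ)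
    rw [add_zero, zero_add] at this
    rw [this]; rfl
  rw [regAct, leftDeriv, rightDeriv, (hasDerivAt_left a.1 hpq g hg).deriv,
    (hasDerivAt_right a.2 hpq g hg).deriv, ← add_div, ← map_add, hv, hv]
  congr 2
  ring

theorem regAct_mem (a : sl2 × sl2) {ψ : bigCell → ℂ} (hψ : IsRegular ψ) :
    IsRegular (regAct a ψ) := by
  intro g
  obtain ⟨p, q, hq, hpq⟩ := hψ g
  refine ⟨_, q ^ 2, by rw [map_pow]; exact pow_ne_zero 2 hq, fun k hk => regAct_eq a hpq k ?_⟩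
  intro h0
  rw [map_pow, h0] at hk
  simp at hk

/-- The infinitesimal regular action of `g ⊕ g` on `R(G₀)`. -/
noncomputable instance : LieRingModule (sl2 × sl2) regularFunctions where
  bracket a ψ := ⟨regAct a ψ, regAct_mem a ψ.2⟩
  add_lie a b ψ := by
    apply Subtype.ext
    funext g
    obtain ⟨p, q, hq, hpq⟩ := ψ.2 g
    have h1 : ∀ r, vf ((a + b).1 : sl2) ((a + b).2 : sl2) r = vf a.1 a.2 r + vf b.1 b.2 r := by
      intro r
      rw [← Derivation.add_apply, ← vf_add]; rfl
    change regAct (a + b) ψ g = regAct a ψ g + regAct b ψ g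
    rw [regAct_eq _ hpq g hq, regAct_eq _ hpq g hq, regAct_eq _ hpq g hq, ← add_div, ← map_add,
      h1, h1]
    congr 2
    ring
  lie_add a φ ψ := by
    apply Subtype.ext
    funext g
    obtain ⟨p, q, hq, hpq⟩ := φ.2 g
    obtain ⟨r, s, hs, hrs⟩ := ψ.2 g
    have hsum : ∀ k : bigCell, evalAt k (q * s) ≠ 0 →
        ((φ + ψ : regularFunctions) : bigCell → ℂ) k =
          evalAt k (p * s + q * r) / evalAt k (q * s) := by
      intro k hk
      rw [map_mul, mul_ne_zero_iff] at hk
      have : ((φ + ψ : regularFunctions) : bigCell → ℂ) k = φ.1 k + ψ.1 k := rfl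
      rw [this, hpq k hk.1, hrs k hk.2, div_add_div _ _ hk.1 hk.2]
      simp
    change regAct a (φ + ψ : regularFunctions) g = regAct a φ g + regAct a ψ g
    rw [regAct_eq _ hpq g hq, regAct_eq _ hrs g hs,
      regAct_eq _ hsum g (by simp [hq, hs])]
    simp only [Derivation.leibniz, map_add, map_mul, map_sub, map_pow, smul_eq_mul]
    field_simp
    ring
  leibniz_lie a b ψ := by
    apply Subtype.ext
    funext g
    obtain ⟨p, q, hq, hpq⟩ := ψ.2 g
    have hq2 : evalAt g (q ^ 2) ≠ 0 := by rw [map_pow]; exact pow_ne_zero 2 hq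
    have hder : ∀ c : sl2 × sl2, ∀ k : bigCell, evalAt k (q ^ 2) ≠ 0 →
        regAct c ψ k =
          evalAt k (vf c.1 c.2 p * q - p * vf c.1 c.2 q) / evalAt k (q ^ 2) := by
      intro c k hk
      refine regAct_eq c hpq k ?_
      intro h0
      rw [map_pow, h0] at hk
      simp at hk
    have hbr : ∀ r, vf (⁅a, b⁆.1 : sl2) (⁅a, b⁆.2 : sl2) r =
        vf a.1 a.2 (vf b.1 b.2 r) - vf b.1 b.2 (vf a.1 a.2 r) := fun r => vf_lie _ _ _ _ r
    change regAct a (regAct b ψ) g = regAct ⁅a, b⁆ ψ g + regAct b (regAct a ψ) g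
    rw [regAct_eq _ (hder b) g hq2, regAct_eq _ (hder a) g hq2, regAct_eq _ hpq g hq, hbr, hbr]
    simp only [Derivation.leibniz, Derivation.leibniz_pow, map_add, map_mul, map_sub, map_pow,
      smul_eq_mul, nsmul_eq_mul, Nat.cast_ofNat, map_ofNat, pow_one, Nat.add_one_sub_one]
    field_simp
    ring

instance : LieModule ℂ (sl2 × sl2) regularFunctions where
  smul_lie c a ψ := by
    apply Subtype.ext
    funext g
    obtain ⟨p, q, hq, hpq⟩ := ψ.2 g
    have h1 : ∀ r, vf ((c • a).1 : sl2) ((c • a).2 : sl2) r = c • vf a.1 a.2 r := by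
      intro r
      rw [← Derivation.smul_apply, ← vf_smul]; rfl
    change regAct (c • a) ψ g = c * regAct a ψ g
    rw [regAct_eq _ hpq g hq, regAct_eq _ hpq g hq, h1, h1, ← mul_div_assoc]
    congr 1
    simp [mul_sub]
  lie_smul c a ψ := by
    apply Subtype.ext
    funext g
    obtain ⟨p, q, hq, hpq⟩ := ψ.2 g
    have hc : ∀ k : bigCell, evalAt k q ≠ 0 →
        ((c • ψ : regularFunctions) : bigCell → ℂ) k = evalAt k (c • p) / evalAt k q := by
      intro k hk
      have : ((c • ψ : regularFunctions) : bigCell → ℂ) k = c * ψ.1 k := rfl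
      rw [this, hpq k hk, map_smul, smul_eq_mul, mul_div_assoc]
    change regAct a (c • ψ : regularFunctions) g = c * regAct a ψ g
    rw [regAct_eq _ hpq g hq, regAct_eq _ hc g hq, ← mul_div_assoc]
    congr 1
    simp [mul_sub]


open scoped TensorProduct

/-- The universal enveloping algebra of `g`. -/
abbrev Env : Type := UniversalEnvelopingAlgebra ℂ sl2

/-- The action of the enveloping algebra on a `g`-module. -/
noncomputable def enveloping (V : Type) [AddCommGroup V] [Module ℂ V] [LieRingModule sl2 V]
    [LieModule ℂ sl2 V] : Env →ₐ[ℂ] Module.End ℂ V :=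
  UniversalEnvelopingAlgebra.lift ℂ (LieModule.toEnd ℂ sl2 V)

/-- The canonical map from `g` to its enveloping algebra. -/
noncomputable def envι : sl2 →ₗ⁅ℂ⁆ Env := UniversalEnvelopingAlgebra.ι ℂ

theorem envι_lie (x y : sl2) : envι ⁅x, y⁆ = envι x * envι y - envι y * envι x := by
  rw [LieHom.map_lie, LieRing.of_associative_ring_bracket]

/-- The action of `g ⊕ g` on functionals on the enveloping algebra:
`(π_l(x) φ)(u) = φ(u x)` and `(π_r(y) φ)(u) = -φ(ω(y) u)`. -/
noncomputable def dualAct (a : sl2 × sl2) (φ : Module.Dual ℂ Env) : Module.Dual ℂ Env :=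
  φ ∘ₗ LinearMap.mulRight ℂ (envι a.1) - φ ∘ₗ LinearMap.mulLeft ℂ (envι (omega a.2))

theorem dualAct_apply (a : sl2 × sl2) (φ : Module.Dual ℂ Env) (u : Env) :
    dualAct a φ u = φ (u * envι a.1) - φ (envι (omega a.2) * u) := rfl

noncomputable instance : LieRingModule (sl2 × sl2) (Module.Dual ℂ Env) where
  bracket := dualAct
  add_lie a b φ := by
    ext u
    change dualAct (a + b) φ u = dualAct a φ u + dualAct b φ u
    simp only [dualAct_apply, Prod.fst_add, Prod.snd_add, map_add, mul_add, add_mul]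
    ring
  lie_add a φ χ := by
    ext u
    change dualAct a (φ + χ) u = dualAct a φ u + dualAct a χ u
    simp only [dualAct_apply, LinearMap.add_apply]
    ring
  leibniz_lie a b φ := by
    ext u
    change dualAct a (dualAct b φ) u = dualAct ⁅a, b⁆ φ u + dualAct b (dualAct a φ) u
    have h1 : ⁅a, b⁆.1 = ⁅a.1, b.1⁆ := rfl
    have h2 : ⁅a, b⁆.2 = ⁅a.2, b.2⁆ := rfl
    simp only [dualAct_apply, h1, h2, LieHom.map_lie omega, envι_lie, mul_sub, sub_mul, map_sub,
      mul_assoc]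
    ring

instance : LieModule ℂ (sl2 × sl2) (Module.Dual ℂ Env) where
  smul_lie c a φ := by
    ext u
    change dualAct (c • a) φ u = c * dualAct a φ u
    simp only [dualAct_apply, Prod.smul_fst, Prod.smul_snd, map_smul, mul_smul_comm,
      smul_mul_assoc, smul_eq_mul]
    ring
  lie_smul c a φ := by
    ext u
    change dualAct a (c • φ) u = c * dualAct a φ u
    simp only [dualAct_apply, LinearMap.smul_apply, smul_eq_mul]
    ring

section Modules

variable (V : Type) [AddCommGroup V] [Module ℂ V] [LieRingModule sl2 V] [LieModule ℂ sl2 V]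

/-- The weight space `V[μ]`: eigenvectors of `h`. -/
def hWeightSpace (μ : ℂ) : Submodule ℂ V where
  carrier := {v | ⁅sl2H, v⁆ = μ • v}
  add_mem' := by
    intro v w hv hw
    simp only [Set.mem_ofPred_eq] at *
    rw [lie_add, hv, hw, smul_add]
  zero_mem' := by simp
  smul_mem' := by
    intro c v hv
    simp only [Set.mem_ofPred_eq] at *
    rw [lie_smul, hv, smul_comm]

/-- The Bernstein-Gelfand-Gelfand category `O`: finitely generated modules with a weight space
decomposition that are locally `n₊`-nilpotent. (Such modules have countable dimension, so `Type`
contains all of them up to isomorphism.) -/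
structure InCategoryO : Prop where
  finitelyGenerated : ∃ s : Finset V, LieSubmodule.lieSpan ℂ sl2 (s : Set V) = ⊤
  weightDecomposition : DirectSum.IsInternal (hWeightSpace V)
  locallyNilpotent : ∀ v : V, ∃ n : ℕ, ((LieModule.toEnd ℂ sl2 V sl2E) ^ n) v = 0

/-- `V` is (isomorphic to) the irreducible module `V_lam` of highest weight `lam`. -/
def IsSimpleOfHighestWeight (lam : ℂ) : Prop :=
  LieModule.IsIrreducible ℂ sl2 V ∧ ∃ v : V, v ≠ 0 ∧ ⁅sl2E, v⁆ = 0 ∧ ⁅sl2H, v⁆ = lam • v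

/-- `V` is a projective object of category `O`. -/
def IsProjectiveInO : Prop :=
  InCategoryO V ∧
  ∀ (M N : Type) [AddCommGroup M] [Module ℂ M] [LieRingModule sl2 M] [LieModule ℂ sl2 M]
    [AddCommGroup N] [Module ℂ N] [LieRingModule sl2 N] [LieModule ℂ sl2 N],
    InCategoryO M → InCategoryO N →
    ∀ (p : M →ₗ⁅ℂ,sl2⁆ N) (k : V →ₗ⁅ℂ,sl2⁆ N), Function.Surjective p →
      ∃ k' : V →ₗ⁅ℂ,sl2⁆ M, p.comp k' = k

/-- `V` is (isomorphic to) the projective cover `P_lam` in category `O` of the irreducible module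
`V_lam`: it is projective and maps onto `V_lam` with superfluous kernel. -/
def IsProjectiveCover (lam : ℂ) : Prop :=
  IsProjectiveInO V ∧
  ∃ (S : Type) (_ : AddCommGroup S) (_ : Module ℂ S) (_ : LieRingModule sl2 S)
    (_ : LieModule ℂ sl2 S) (p : V →ₗ⁅ℂ,sl2⁆ S),
    IsSimpleOfHighestWeight S lam ∧ Function.Surjective p ∧
      ∀ N : LieSubmodule ℂ sl2 V, N ⊔ p.ker = ⊤ → N = ⊤

theorem hWeightSpace_e {μ : ℂ} {v : V} (hv : v ∈ hWeightSpace V μ) :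
    ⁅sl2E, v⁆ ∈ hWeightSpace V (μ + 2) := by
  change ⁅sl2H, v⁆ = μ • v at hv
  change ⁅sl2H, ⁅sl2E, v⁆⁆ = (μ + 2) • ⁅sl2E, v⁆
  rw [leibniz_lie, lie_h_e, hv, smul_lie, lie_smul, add_smul, add_comm]

theorem hWeightSpace_f {μ : ℂ} {v : V} (hv : v ∈ hWeightSpace V μ) :
    ⁅sl2F, v⁆ ∈ hWeightSpace V (μ - 2) := by
  change ⁅sl2H, v⁆ = μ • v at hv
  change ⁅sl2H, ⁅sl2F, v⁆⁆ = (μ - 2) • ⁅sl2F, v⁆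
  rw [leibniz_lie, lie_h_f, hv, smul_lie, lie_smul, sub_smul, neg_smul]
  abel

theorem eq_combination (x : sl2) : x = x.1 0 1 • sl2E + x.1 0 0 • sl2H + x.1 1 0 • sl2F := by
  have htr : x.1 0 0 + x.1 1 1 = 0 := by
    have := (mem_sl2_iff _).1 x.2
    simpa [Matrix.trace_fin_two] using this
  ext i j
  fin_cases i <;> fin_cases j <;> simp [sl2E, sl2H, sl2F]
  linear_combination htr

/-- The weights `μ` such that `k` does not vanish on `V[μ]`. -/
def hSupport (k : Module.Dual ℂ V) : Set ℂ := {μ | ∃ v ∈ hWeightSpace V μ, k v ≠ 0}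

/-- The restricted dual: functionals that vanish on all but finitely many weight spaces. For a
module with weight space decomposition this is `⨁_μ V[μ]'`. -/
def restrictedDualSubmodule : Submodule ℂ (Module.Dual ℂ V) where
  carrier := {k | (hSupport V k).Finite}
  add_mem' := by
    intro k l hk hl
    refine (hk.union hl).subset ?_
    rintro μ ⟨v, hv, hne⟩
    by_cases h1 : k v = 0
    · refine Or.inr ⟨v, hv, fun h2 => hne ?_⟩
      rw [LinearMap.add_apply, h1, h2, add_zero]
    · exact Or.inl ⟨v, hv, h1⟩
  zero_mem' := by
    refine Set.finite_empty.subset ?_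
    rintro μ ⟨v, -, hne⟩
    exact (hne rfl).elim
  smul_mem' := by
    intro c k hk
    refine hk.subset ?_
    rintro μ ⟨v, hv, hne⟩
    refine ⟨v, hv, fun h1 => hne ?_⟩
    rw [LinearMap.smul_apply, h1, smul_zero]

/-- The `g`-action `⟨x k, v⟩ = -⟨k, ω(x) v⟩` on functionals. -/
def starAct (x : sl2) (k : Module.Dual ℂ V) : Module.Dual ℂ V :=
  -(k ∘ₗ (LieModule.toEnd ℂ sl2 V (omega x)))

theorem starAct_apply (x : sl2) (k : Module.Dual ℂ V) (v : V) :
    starAct V x k v = -k ⁅omega x, v⁆ := rfl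

theorem starAct_mem (x : sl2) {k : Module.Dual ℂ V} (hk : k ∈ restrictedDualSubmodule V) :
    starAct V x k ∈ restrictedDualSubmodule V := by
  have hk' : (hSupport V k).Finite := hk
  refine ((hk'.union (hk'.image (fun μ => μ - 2))).union (hk'.image (fun μ => μ + 2))).subset ?_
  rintro μ ⟨v, hv, hne⟩
  by_contra hcon
  simp only [Set.mem_union, Set.mem_image, not_or, not_exists, not_and] at hcon
  obtain ⟨⟨h0, h1⟩, h2⟩ := hcon
  apply hne
  have z1 : k ⁅sl2E, v⁆ = 0 := by
    by_contra h3
    exact h1 _ ⟨_, hWeightSpace_e V hv, h3⟩ (by ring)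
  have z2 : k ⁅sl2F, v⁆ = 0 := by
    by_contra h3
    exact h2 _ ⟨_, hWeightSpace_f V hv, h3⟩ (by ring)
  have z3 : k ⁅sl2H, v⁆ = 0 := by
    by_contra h3
    refine h0 ⟨v, hv, fun h4 => h3 ?_⟩
    have : ⁅sl2H, v⁆ = μ • v := hv
    rw [this, map_smul, h4, smul_zero]
  rw [starAct_apply, eq_combination (omega x)]
  simp only [add_lie, smul_lie, map_add, map_smul, z1, z2, z3]
  simp

/-- The dual module `V^⋆`: the restricted dual with the action `⟨x k, v⟩ = -⟨k, ω(x) v⟩`. -/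
def RestrictedDual : Type := restrictedDualSubmodule V

instance : AddCommGroup (RestrictedDual V) :=
  inferInstanceAs (AddCommGroup (restrictedDualSubmodule V))

instance : Module ℂ (RestrictedDual V) :=
  inferInstanceAs (Module ℂ (restrictedDualSubmodule V))

/-- The underlying functional of an element of the restricted dual. -/
def RestrictedDual.toDual : RestrictedDual V →ₗ[ℂ] Module.Dual ℂ V :=
  (restrictedDualSubmodule V).subtype

theorem RestrictedDual.ext {k l : RestrictedDual V}
    (hkl : ∀ v, RestrictedDual.toDual V k v = RestrictedDual.toDual V l v) : k = l :=
  Subtype.ext (LinearMap.ext hkl)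

instance : Bracket sl2 (RestrictedDual V) where
  bracket x k := ⟨starAct V x k.1, starAct_mem V x k.2⟩

theorem RestrictedDual.lie_apply (x : sl2) (k : RestrictedDual V) (v : V) :
    RestrictedDual.toDual V ⁅x, k⁆ v = -RestrictedDual.toDual V k ⁅omega x, v⁆ := rfl

instance : LieRingModule sl2 (RestrictedDual V) where
  add_lie x y k := by
    apply RestrictedDual.ext
    intro v
    simp only [RestrictedDual.lie_apply, map_add, LinearMap.add_apply, add_lie]
    ring
  lie_add x k l := by
    apply RestrictedDual.ext
    intro v
    simp only [RestrictedDual.lie_apply, map_add, LinearMap.add_apply]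
    ring
  leibniz_lie x y k := by
    apply RestrictedDual.ext
    intro v
    simp only [RestrictedDual.lie_apply, map_add, LinearMap.add_apply, LieHom.map_lie, lie_lie,
      map_sub]
    ring

instance : LieModule ℂ sl2 (RestrictedDual V) where
  smul_lie c x k := by
    apply RestrictedDual.ext
    intro v
    simp only [RestrictedDual.lie_apply, map_smul, LinearMap.smul_apply, smul_lie, smul_eq_mul]
    ring
  lie_smul c x k := by
    apply RestrictedDual.ext
    intro v
    simp only [RestrictedDual.lie_apply, map_smul, LinearMap.smul_apply, smul_eq_mul]
    ring

/-- The matrix element `φ_{v,k}(u) = ⟨k, u v⟩` on the enveloping algebra. -/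
noncomputable def matrixElement (v : V) (k : RestrictedDual V) : Module.Dual ℂ Env :=
  (RestrictedDual.toDual V k) ∘ₗ (LinearMap.applyₗ v) ∘ₗ (enveloping V).toLinearMap

theorem matrixElement_apply (v : V) (k : RestrictedDual V) (u : Env) :
    matrixElement V v k u = RestrictedDual.toDual V k (enveloping V u v) := rfl

/-- The space `M(V)` spanned by all matrix elements of `V`. -/
noncomputable def matrixElements : Submodule ℂ (Module.Dual ℂ Env) :=
  Submodule.span ℂ {φ | ∃ (v : V) (k : RestrictedDual V), φ = matrixElement V v k}

theorem enveloping_envι (x : sl2) (v : V) : enveloping V (envι x) v = ⁅x, v⁆ := by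
  unfold enveloping envι
  rw [UniversalEnvelopingAlgebra.lift_ι_apply]
  rfl

end Modules

section Outer

variable (V W : Type) [AddCommGroup V] [Module ℂ V] [LieRingModule sl2 V] [LieModule ℂ sl2 V]
  [AddCommGroup W] [Module ℂ W] [LieRingModule sl2 W] [LieModule ℂ sl2 W]

/-- The outer tensor product of two `g`-modules, a `g ⊕ g`-module. -/
def OuterTensor : Type := V ⊗[ℂ] W

noncomputable instance : AddCommGroup (OuterTensor V W) :=
  inferInstanceAs (AddCommGroup (V ⊗[ℂ] W))

noncomputable instance : Module ℂ (OuterTensor V W) :=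
  inferInstanceAs (Module ℂ (V ⊗[ℂ] W))

variable {V W} in
def OuterTensor.tmul (v : V) (w : W) : OuterTensor V W := v ⊗ₜ[ℂ] w

noncomputable def outerAct (a : sl2 × sl2) : V ⊗[ℂ] W →ₗ[ℂ] V ⊗[ℂ] W :=
  (LieModule.toEnd ℂ sl2 V a.1).rTensor W + (LieModule.toEnd ℂ sl2 W a.2).lTensor V

theorem outerAct_tmul (a : sl2 × sl2) (v : V) (w : W) :
    outerAct V W a (v ⊗ₜ w) = ⁅a.1, v⁆ ⊗ₜ w + v ⊗ₜ ⁅a.2, w⁆ := rfl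

theorem outerAct_add (a b : sl2 × sl2) : outerAct V W (a + b) = outerAct V W a + outerAct V W b := by
  apply TensorProduct.ext'
  intro v w
  simp only [LinearMap.add_apply, outerAct_tmul, Prod.fst_add, Prod.snd_add, add_lie,
    TensorProduct.add_tmul, TensorProduct.tmul_add]
  abel

theorem outerAct_smul (c : ℂ) (a : sl2 × sl2) : outerAct V W (c • a) = c • outerAct V W a := by
  apply TensorProduct.ext'
  intro v w
  simp only [LinearMap.smul_apply, outerAct_tmul, Prod.smul_fst, Prod.smul_snd, smul_lie,
    TensorProduct.smul_tmul', TensorProduct.tmul_smul, smul_add]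

theorem outerAct_lie (a b : sl2 × sl2) : outerAct V W a ∘ₗ outerAct V W b =
    outerAct V W ⁅a, b⁆ + outerAct V W b ∘ₗ outerAct V W a := by
  apply TensorProduct.ext'
  intro v w
  have h1 : ⁅a, b⁆.1 = ⁅a.1, b.1⁆ := rfl
  have h2 : ⁅a, b⁆.2 = ⁅a.2, b.2⁆ := rfl
  simp only [LinearMap.comp_apply, LinearMap.add_apply, outerAct_tmul, map_add, h1, h2,
    lie_lie, TensorProduct.sub_tmul, TensorProduct.tmul_sub]
  abel

/-- `g ⊕ g` acts on the outer tensor product by `(x, y)(v ⊗ w) = xv ⊗ w + v ⊗ yw`. -/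
noncomputable instance : LieRingModule (sl2 × sl2) (OuterTensor V W) where
  bracket a t := outerAct V W a t
  add_lie a b t := LinearMap.congr_fun (outerAct_add V W a b) t
  lie_add a s t := (outerAct V W a).map_add s t
  leibniz_lie a b t := LinearMap.congr_fun (outerAct_lie V W a b) t

instance : LieModule ℂ (sl2 × sl2) (OuterTensor V W) where
  smul_lie c a t := LinearMap.congr_fun (outerAct_smul V W c a) t
  lie_smul c a t := (outerAct V W a).map_smul c t

noncomputable def matrixElementBilin : V →ₗ[ℂ] RestrictedDual V →ₗ[ℂ] Module.Dual ℂ Env :=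
  LinearMap.mk₂ ℂ (matrixElement V)
    (fun v w k => by ext u; simp [matrixElement_apply])
    (fun c v k => by ext u; simp [matrixElement_apply])
    (fun v k l => by ext u; simp [matrixElement_apply])
    (fun c v k => by ext u; simp [matrixElement_apply])

/-- The `g ⊕ g`-homomorphism `V ⊗ V^⋆ → U(g)'` with `v ⊗ k ↦ φ_{v,k}`. -/
noncomputable def matrixElementMap :
    OuterTensor V (RestrictedDual V) →ₗ⁅ℂ,sl2 × sl2⁆ Module.Dual ℂ Env where
  toLinearMap := TensorProduct.lift (matrixElementBilin V)
  map_lie' := by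
    intro a t
    change TensorProduct.lift (matrixElementBilin V) (outerAct V (RestrictedDual V) a t) =
      dualAct a (TensorProduct.lift (matrixElementBilin V) t)
    induction t using TensorProduct.induction_on with
    | zero => ext u; simp [dualAct_apply]
    | add s t hs ht =>
      rw [map_add, map_add, hs, ht, map_add]
      ext u
      simp only [dualAct_apply, LinearMap.add_apply]
      ring
    | tmul v k =>
      rw [outerAct_tmul, map_add, TensorProduct.lift.tmul, TensorProduct.lift.tmul,
        TensorProduct.lift.tmul]
      ext u
      change matrixElement V ⁅a.1, v⁆ k u + matrixElement V v ⁅a.2, k⁆ u =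
        dualAct a (matrixElement V v k) u
      simp only [dualAct_apply, matrixElement_apply, map_mul, Module.End.mul_apply,
        enveloping_envι, RestrictedDual.lie_apply]
      ring

theorem matrixElementMap_tmul (v : V) (k : RestrictedDual V) :
    matrixElementMap V (OuterTensor.tmul v k) = matrixElement V v k := rfl

/-- The sub-bimodule of `V ⊗ V^⋆` of identically vanishing matrix elements. -/
noncomputable def vanishing : LieSubmodule ℂ (sl2 × sl2) (OuterTensor V (RestrictedDual V)) :=
  (matrixElementMap V).ker

end Outer

/-- The extension of the left infinitesimal action on `R(G₀)` to the enveloping algebra. -/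
noncomputable def leftRegular : Env →ₐ[ℂ] Module.End ℂ regularFunctions :=
  UniversalEnvelopingAlgebra.lift ℂ
    ((LieModule.toEnd ℂ (sl2 × sl2) regularFunctions).comp (LieHom.inl ℂ sl2 sl2))

/-- A regular function as a functional on the enveloping algebra: `u ↦ (π_l(u) ψ)(w₀)`. -/
noncomputable def vartheta : regularFunctions →ₗ[ℂ] Module.Dual ℂ Env where
  toFun ψ :=
    { toFun := fun u => (leftRegular u ψ : bigCell → ℂ) ⟨w0, w0_mem⟩
      map_add' := fun u u' => by simp
      map_smul' := fun c u => by simp }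
  map_add' ψ χ := by ext u; simp
  map_smul' c ψ := by ext u; simp

/-- The strictly anti-dominant integral weights `-(P⁺ + ρ) = {-1, -2, …}`. -/
def strictlyAntidominant : Set ℤ := {l | ∃ n : ℕ, l = -((n : ℤ) + 1)}

end BigCell

namespace BigCell

attribute [local instance 100] LieRing.ofAssociativeRing

open scoped Matrix MatrixGroups TensorProduct

open Polynomial (aeval X C)

/-! ### Generalized eigenspaces without finiteness assumptions -/

section LinearAlgebra

variable {V W : Type*} [AddCommGroup V] [Module ℂ V] [AddCommGroup W] [Module ℂ W]

/-! Write `g = (a, b; c, d)`. On the big cell `c` is invertible and `b = (ad - 1)/c`, so the regular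
functions are spanned by the monomials `a^i d^j c^n` with `i, j` natural and `n` an integer. Up to
scalars, left and right `e` send such a monomial to `a^(i-1) d^j c^(n+1)` and `a^i d^(j-1) c^(n+1)`,
with factors `-i` and `j`; its left and right weights are `n+j-i` and `n+i-j`. Thus both copies of
`e` are locally nilpotent and surjective, and their common kernel is spanned by the powers of `c`.
Under `vartheta` these powers become functionals with distinct left weights and value `1` at `1`,
which gives injectivity (`theta_injective`).

The image is characterized intrinsically by `mem_range_theta`: it contains every functional of
integral left weight that is nilpotent under `e` on both sides. Surjectivity of the two operators
`e` on functions reduces this to functionals `φ` that are highest weight vectors on both sides. Such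
a `φ` is determined by `φ 1` (`eq_zero_of_highestWeight`), so it is a multiple of the image of a
power of `c`.

The module side rests on the Casimir operator `4fe + (h+1)²`. On `e`-nilpotent vectors of weight
`-m-1` in its generalized eigenspace for `m²`, the relations `e^(m+1) = 0` and `(Casimir - m²)² = 0`
are automatic. Hence the cyclic module `BigProjective m` with these relations represents, on
category `O`, the exact functor taking a module to that part of its weight space, and is projective.
Since `Casimir - m²` is nilpotent on its generator, it is also a projective cover, and every
projective cover of the irreducible module of highest weight `-m-1` is isomorphic to it
(`exists_equiv_bigProjective`). A nonzero highest weight module of weight `-m-1` is found inside the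
functionals themselves, generated by the image of `c^(-m-1)`.

Matrix elements of the cover lie in the left Casimir block `m²`, and distinct `m` give distinct
blocks; this makes the sum direct. They lie in the image of `vartheta` by the characterization
above, because an element of the restricted dual kills `f^N V` for some `N`. Conversely, a
functional `φ` satisfies `φ(u) = (uφ)(1)`. If it has left weight `-m-1`, lies in the block `m²` and
is a right weight vector, it is the image of the generator under a homomorphism `p`, and `φ` is the
matrix element given by the functional "evaluate `p` at `1`". Lower weights `-m-1-2t` follow because
`fe` is invertible there on the block. Every monomial is obtained, up to a nonzero scalar, by
applying powers of left `e` to monomials of sufficiently low weight, which belong to this case; so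
the matrix elements exhaust the image. -/

theorem mem_span_inter_of_iSupIndep {ι : Type*} {A : ι → Submodule ℂ V} (hA : iSupIndep A)
    {S : Set V} (hS : ∀ x ∈ S, ∃ i, x ∈ A i) {i : ι} {x : V} (hx : x ∈ Submodule.span ℂ S)
    (hxi : x ∈ A i) : x ∈ Submodule.span ℂ (S ∩ A i) := by
  have hle : Submodule.span ℂ S ≤ Submodule.span ℂ (S ∩ A i) ⊔ ⨆ (j) (_ : j ≠ i), A j := by
    refine Submodule.span_le.2 fun y hy => ?_
    obtain ⟨j, hj⟩ := hS y hy
    by_cases hji : j = i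
    · subst hji
      exact Submodule.mem_sup_left (Submodule.subset_span ⟨hy, hj⟩)
    · exact Submodule.mem_sup_right (Submodule.mem_iSup_of_mem j (Submodule.mem_iSup_of_mem hji hj))
  obtain ⟨y, hy, z, hz, rfl⟩ := Submodule.mem_sup.1 (hle hx)
  have hyi : y ∈ A i := (Submodule.span_le.2 Set.inter_subset_right : _ ≤ A i) hy
  have hzi : z ∈ A i := by simpa using sub_mem hxi hyi
  have hz0 : z = 0 := by
    have h := (hA i).le_bot ⟨hzi, hz⟩
    simpa using h
  rw [hz0, add_zero]
  exact hy

theorem aeval_mem_of_mapsTo {f : Module.End ℂ V} {Y : Submodule ℂ V} (hY : ∀ y ∈ Y, f y ∈ Y)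
    (q : Polynomial ℂ) : ∀ y ∈ Y, aeval f q y ∈ Y := by
  induction q using Polynomial.induction_on' with
  | add p q hp hq =>
    intro y hy
    rw [map_add]
    exact add_mem (hp y hy) (hq y hy)
  | monomial n a =>
    intro y hy
    rw [Polynomial.aeval_monomial, Module.End.mul_apply, Module.algebraMap_end_apply]
    refine Y.smul_mem a ?_
    induction n with
    | zero => exact hy
    | succ n ih =>
      rw [pow_succ', Module.End.mul_apply]
      exact hY _ ih

theorem aeval_apply_of_comm {f : Module.End ℂ V} {g : Module.End ℂ W} (p : V →ₗ[ℂ] W)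
    (h : ∀ x, p (f x) = g (p x)) (q : Polynomial ℂ) (x : V) :
    p (aeval f q x) = aeval g q (p x) := by
  induction q using Polynomial.induction_on' with
  | add q r hq hr => simp [hq, hr]
  | monomial n a =>
    rw [Polynomial.aeval_monomial, Polynomial.aeval_monomial, Module.End.mul_apply,
      Module.End.mul_apply, Module.algebraMap_end_apply, Module.algebraMap_end_apply, map_smul]
    congr 1
    induction n with
    | zero => rfl
    | succ n ih => rw [pow_succ', pow_succ', Module.End.mul_apply, Module.End.mul_apply, h, ih]

/-- Bézout for the coprime polynomials `(X - s)^k` and `p`: on a generalized eigenvector for `s`,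
`p(f)` has an inverse that is itself a polynomial in `f`, and hence preserves every `f`-stable
subspace. -/
theorem exists_aeval_mul_apply_eq {f : Module.End ℂ V} {s : ℂ} {y : V}
    (hy : y ∈ f.maxGenEigenspace s) {p : Polynomial ℂ} (hp : p.eval s ≠ 0) :
    ∃ q : Polynomial ℂ, aeval f (p * q) y = y := by
  obtain ⟨k, hk⟩ := (Module.End.mem_maxGenEigenspace f s y).1 hy
  have hirr : Irreducible (X - C s) := Polynomial.irreducible_X_sub_C s
  have hcop : IsCoprime (X - C s) p := by
    refine (hirr.coprime_iff_not_dvd).2 fun h => hp ?_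
    exact Polynomial.dvd_iff_isRoot.1 h
  obtain ⟨a, b, hab⟩ := hcop.pow_left (m := k)
  refine ⟨b, ?_⟩
  have h1 := congrArg (fun q => aeval f q y) hab
  have h2 : aeval f ((X - C s) ^ k) y = 0 := by
    simpa [Module.algebraMap_end_eq_smul_id, Module.End.one_eq_id] using hk
  simp only [map_add, LinearMap.add_apply, map_one, Module.End.one_apply] at h1
  rw [map_mul, Module.End.mul_apply, h2, map_zero, zero_add, mul_comm] at h1
  exact h1

/-- The sum of the generalized eigenspaces of `f` in a submodule `Y`. -/
def genEigenSum (f : Module.End ℂ V) (Y : Submodule ℂ V) : Submodule ℂ V :=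
  ⨆ r, Y ⊓ f.maxGenEigenspace r

theorem mem_maxGenEigenspace_of_sub_smul {f : Module.End ℂ V} {r : ℂ} {x : V}
    (hx : f x - r • x ∈ f.maxGenEigenspace r) : x ∈ f.maxGenEigenspace r := by
  obtain ⟨k, hk⟩ := (Module.End.mem_maxGenEigenspace f r _).1 hx
  refine (Module.End.mem_maxGenEigenspace f r x).2 ⟨k + 1, ?_⟩
  rw [pow_succ, Module.End.mul_apply]
  simpa using hk

theorem map_mem_maxGenEigenspace_of_comm {f : Module.End ℂ V} {g : Module.End ℂ W}
    (p : V →ₗ[ℂ] W) (h : ∀ x, p (f x) = g (p x)) {r : ℂ} {x : V}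
    (hx : x ∈ f.maxGenEigenspace r) : p x ∈ g.maxGenEigenspace r := by
  obtain ⟨k, hk⟩ := (Module.End.mem_maxGenEigenspace f r _).1 hx
  refine (Module.End.mem_maxGenEigenspace g r _).2 ⟨k, ?_⟩
  have h1 := aeval_apply_of_comm p h ((X - C r) ^ k) x
  have h2 : aeval f ((X - C r) ^ k) = (f - r • (1 : Module.End ℂ V)) ^ k := by
    simp [Module.algebraMap_end_eq_smul_id, Module.End.one_eq_id]
  have h3 : aeval g ((X - C r) ^ k) = (g - r • (1 : Module.End ℂ W)) ^ k := by
    simp [Module.algebraMap_end_eq_smul_id, Module.End.one_eq_id]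
  rw [h2, hk, map_zero, h3] at h1
  exact h1.symm

/-- The part of `f x - r x` outside the eigenvalue `r` can be divided by `f - r` inside `Y`.
Subtracting the quotient from `x` leaves a generalized eigenvector for `r`. This is the inductive
step for splitting a vector without assuming finite dimension. -/
theorem mem_genEigenSum_of_sub_smul {f : Module.End ℂ V} {Y : Submodule ℂ V}
    (hY : ∀ y ∈ Y, f y ∈ Y) {r : ℂ} {x : V} (hx : x ∈ Y)
    (hfx : f x - r • x ∈ genEigenSum f Y) : x ∈ genEigenSum f Y := by
  have hG : ∀ s, ∀ y ∈ Y ⊓ f.maxGenEigenspace s, f y ∈ Y ⊓ f.maxGenEigenspace s := fun s y hy =>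
    ⟨hY y hy.1, f.mapsTo_maxGenEigenspace_of_comm (Commute.refl f) s hy.2⟩
  -- For `s ≠ r` the operator `f - r` is invertible on the `s`-part by a polynomial in `f`, so that
  -- part lies in the image of `f - r`.
  have hle : genEigenSum f Y ≤
      (Y ⊓ f.maxGenEigenspace r) ⊔ (genEigenSum f Y).map (f - r • (1 : Module.End ℂ V)) := by
    refine iSup_le fun s => ?_
    by_cases hsr : s = r
    · subst hsr
      exact le_sup_left
    · refine le_sup_of_le_right fun y hy => ?_
      have hp : (X - C r : Polynomial ℂ).eval s ≠ 0 := by simpa [sub_eq_zero] using hsr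
      obtain ⟨q, hq⟩ := exists_aeval_mul_apply_eq hy.2 hp
      refine ⟨aeval f q y, Submodule.mem_iSup_of_mem s (aeval_mem_of_mapsTo (hG s) q y hy), ?_⟩
      rw [map_mul, Module.End.mul_apply] at hq
      simpa [Module.algebraMap_end_eq_smul_id] using hq
  obtain ⟨y, hy, z, ⟨w, hw, rfl⟩, hyz⟩ := Submodule.mem_sup.1 (hle hfx)
  have hwY : w ∈ Y := (iSup_le fun _ => inf_le_left : genEigenSum f Y ≤ Y) hw
  have h1 : x - w ∈ Y ⊓ f.maxGenEigenspace r := by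
    refine ⟨sub_mem hx hwY, mem_maxGenEigenspace_of_sub_smul ?_⟩
    have : f (x - w) - r • (x - w) = y := by
      rw [map_sub, smul_sub, sub_sub_sub_comm, ← hyz]
      simp
    rw [this]
    exact hy.2
  have h2 : x - w ∈ genEigenSum f Y := Submodule.mem_iSup_of_mem r h1
  simpa using add_mem h2 hw

/-- Components of `x` may be chosen in any `f`-stable subspace containing `x`. A power of `f - a`
removes the component for `a`; induction on the set of eigenvalues treats the result, and the
previous lemma undoes the power. -/
theorem mem_genEigenSum_of_mem_iSup {f : Module.End ℂ V} {Y : Submodule ℂ V}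
    (hY : ∀ y ∈ Y, f y ∈ Y) {x : V} (hx : x ∈ Y) (hx' : x ∈ ⨆ r, f.maxGenEigenspace r) :
    x ∈ genEigenSum f Y := by
  classical
  have hpow : ∀ (r : ℂ) (k : ℕ), ∀ y ∈ Y, ((f - r • (1 : Module.End ℂ V)) ^ k) y ∈ genEigenSum f Y →
      y ∈ genEigenSum f Y := by
    intro r k
    induction k with
    | zero => exact fun y _ h => h
    | succ k ih =>
      intro y hy h
      rw [pow_succ, Module.End.mul_apply] at h
      have hfy : (f - r • (1 : Module.End ℂ V)) y = f y - r • y := by simp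
      rw [hfy] at h
      exact mem_genEigenSum_of_sub_smul hY hy
        (ih _ (sub_mem (hY y hy) (Y.smul_mem r hy)) h)
  obtain ⟨s, hs⟩ := Submodule.exists_finset_of_mem_iSup _ hx'
  clear hx'
  induction s using Finset.induction_on generalizing x with
  | empty =>
    have : x = 0 := by simpa using hs
    rw [this]
    exact zero_mem _
  | insert a s ha ih =>
    rw [Finset.iSup_insert] at hs
    obtain ⟨y, hy, z, hz, rfl⟩ := Submodule.mem_sup.1 hs
    obtain ⟨k, hk⟩ := (Module.End.mem_maxGenEigenspace f a y).1 hy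
    refine hpow a k _ hx ?_
    have hstab : ∀ T : Submodule ℂ V, (∀ t ∈ T, f t ∈ T) →
        ∀ t ∈ T, ((f - a • (1 : Module.End ℂ V)) ^ k) t ∈ T := by
      intro T hT t ht
      have := aeval_mem_of_mapsTo hT ((X - C a) ^ k) t ht
      simpa [Module.algebraMap_end_eq_smul_id, Module.End.one_eq_id] using this
    refine ih (hstab Y hY _ hx) ?_
    rw [map_add, hk, zero_add]
    refine hstab _ (fun t ht => ?_) z hz
    have : (⨆ i ∈ s, f.maxGenEigenspace i) ≤ (⨆ i ∈ s, f.maxGenEigenspace i).comap f :=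
      iSup₂_le fun i hi u hu => Submodule.mem_iSup_of_mem i (Submodule.mem_iSup_of_mem hi
        (f.mapsTo_maxGenEigenspace_of_comm (Commute.refl f) i hu))
    exact this ht

theorem mem_iSup_inf_eigenspace {f : Module.End ℂ V} (hf : ⨆ r, f.eigenspace r = ⊤)
    {Y : Submodule ℂ V} (hY : ∀ y ∈ Y, f y ∈ Y) {x : V} (hx : x ∈ Y) :
    x ∈ ⨆ r, Y ⊓ f.eigenspace r := by
  have htop : ∀ y, y ∈ ⨆ r, f.maxGenEigenspace r := fun y =>
    (iSup_mono fun r => Module.End.eigenspace_le_maxGenEigenspace : _ ≤ ⨆ r, f.maxGenEigenspace r)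
      (hf ▸ Submodule.mem_top)
  -- For a diagonalizable operator the generalized eigenspaces are no larger than the eigenspaces,
  -- by their independence.
  have hle : ∀ r, f.maxGenEigenspace r ≤ f.eigenspace r := by
    intro r y hy
    have h1 : y ∈ Submodule.span ℂ (⋃ s, (f.eigenspace s : Set V)) := by
      rw [← Submodule.iSup_eq_span, hf]; trivial
    have h2 := mem_span_inter_of_iSupIndep f.independent_maxGenEigenspace (i := r) (fun z hz => by
      obtain ⟨s, hs⟩ := Set.mem_iUnion.1 hz
      exact ⟨s, Module.End.eigenspace_le_maxGenEigenspace hs⟩) h1 hy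
    refine (Submodule.span_le.2 ?_) h2
    rintro z ⟨hz, hzr⟩
    obtain ⟨s, hs⟩ := Set.mem_iUnion.1 hz
    by_cases hsr : s = r
    · exact hsr ▸ hs
    · have h0 : z = 0 := by
        have := (f.independent_maxGenEigenspace.pairwiseDisjoint hsr).le_bot
          ⟨Module.End.eigenspace_le_maxGenEigenspace hs, hzr⟩
        simpa using this
      rw [h0]
      exact zero_mem _
  exact (iSup_mono fun r => inf_le_inf_left Y (hle r) : genEigenSum f Y ≤ _)
    (mem_genEigenSum_of_mem_iSup hY hx (htop x))

end LinearAlgebra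

/-! ### The Casimir operator, its blocks, and cyclic weight modules -/

section Sl2Modules

theorem e_f_lie {V : Type} [AddCommGroup V] [LieRingModule sl2 V] (x : V) :
    ⁅sl2E, ⁅sl2F, x⁆⁆ = ⁅sl2H, x⁆ + ⁅sl2F, ⁅sl2E, x⁆⁆ := by
  rw [leibniz_lie, lie_e_f]

variable (V : Type) [AddCommGroup V] [Module ℂ V] [LieRingModule sl2 V] [LieModule ℂ sl2 V]

/-- The Casimir operator `4fe + (h+1)²`, which acts by `(μ+1)²` on highest weight vectors of
weight `μ`. -/
def casimir : Module.End ℂ V :=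
  (4 : ℂ) • (LieModule.toEnd ℂ sl2 V sl2F * LieModule.toEnd ℂ sl2 V sl2E) +
    (LieModule.toEnd ℂ sl2 V sl2H + 1) ^ 2

variable {V}

theorem casimir_apply (x : V) :
    casimir V x = (4 : ℂ) • ⁅sl2F, ⁅sl2E, x⁆⁆ + ⁅sl2H, ⁅sl2H, x⁆⁆ + (2 : ℂ) • ⁅sl2H, x⁆ + x := by
  simp only [casimir, sq, LinearMap.add_apply, LinearMap.smul_apply, Module.End.mul_apply,
    LieModule.toEnd_apply_apply, Module.End.one_apply, lie_add]
  module

theorem e_h_lie (x : V) : ⁅sl2E, ⁅sl2H, x⁆⁆ = ⁅sl2H, ⁅sl2E, x⁆⁆ - (2 : ℂ) • ⁅sl2E, x⁆ := by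
  rw [leibniz_lie, ← lie_skew, lie_h_e, neg_lie, smul_lie]; abel

theorem h_f_lie (x : V) : ⁅sl2H, ⁅sl2F, x⁆⁆ = ⁅sl2F, ⁅sl2H, x⁆⁆ - (2 : ℂ) • ⁅sl2F, x⁆ := by
  rw [leibniz_lie, lie_h_f, smul_lie, neg_smul]; abel

theorem lie_eq_combination (y : sl2) (x : V) :
    ⁅y, x⁆ = y.1 0 1 • ⁅sl2E, x⁆ + y.1 0 0 • ⁅sl2H, x⁆ + y.1 1 0 • ⁅sl2F, x⁆ := by
  conv_lhs => rw [eq_combination y]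
  simp only [add_lie, smul_lie]

theorem lie_mem_of_e_h_f {Y : Submodule ℂ V} {x : V} (he : ⁅sl2E, x⁆ ∈ Y) (hh : ⁅sl2H, x⁆ ∈ Y)
    (hf : ⁅sl2F, x⁆ ∈ Y) (y : sl2) : ⁅y, x⁆ ∈ Y := by
  rw [lie_eq_combination]
  exact add_mem (add_mem (Y.smul_mem _ he) (Y.smul_mem _ hh)) (Y.smul_mem _ hf)

/-- Centrality of the Casimir operator, checked on `e`, `h`, `f`. It makes the Casimir blocks
submodules. -/
theorem casimir_lie (y : sl2) (x : V) : casimir V ⁅y, x⁆ = ⁅y, casimir V x⁆ := by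
  rw [lie_eq_combination y x, lie_eq_combination y (casimir V x)]
  simp only [map_add, map_smul]
  congr 2
  · congr 2
    simp only [casimir_apply, e_f_lie, e_h_lie, lie_add, lie_sub, lie_smul]
    module
  · simp only [casimir_apply, e_h_lie, h_f_lie, lie_add, lie_sub, lie_smul]
  · simp only [casimir_apply, e_f_lie, h_f_lie, lie_add, lie_sub, lie_smul]
    module

theorem aeval_casimir_lie (q : Polynomial ℂ) (y : sl2) (x : V) :
    aeval (casimir V) q ⁅y, x⁆ = ⁅y, aeval (casimir V) q x⁆ :=
  (aeval_apply_of_comm (LieModule.toEnd ℂ sl2 V y) (fun x => (casimir_lie y x).symm) q x).symm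

theorem map_casimir {W : Type} [AddCommGroup W] [Module ℂ W] [LieRingModule sl2 W]
    [LieModule ℂ sl2 W] (p : V →ₗ⁅ℂ,sl2⁆ W) (x : V) : p (casimir V x) = casimir W (p x) := by
  simp only [casimir_apply, map_add, map_smul, LieModuleHom.map_lie]

theorem map_aeval_casimir {W : Type} [AddCommGroup W] [Module ℂ W] [LieRingModule sl2 W]
    [LieModule ℂ sl2 W] (p : V →ₗ⁅ℂ,sl2⁆ W) (q : Polynomial ℂ) (x : V) :
    p (aeval (casimir V) q x) = aeval (casimir W) q (p x) :=
  aeval_apply_of_comm (p : V →ₗ[ℂ] W) (map_casimir p) q x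

theorem aeval_casimir_X_sub_C (r : ℂ) (x : V) :
    aeval (casimir V) (X - C r) x = casimir V x - r • x := by
  simp [Module.algebraMap_end_eq_smul_id]

theorem map_mem_casimirBlock {W : Type} [AddCommGroup W] [Module ℂ W] [LieRingModule sl2 W]
    [LieModule ℂ sl2 W] (p : V →ₗ⁅ℂ,sl2⁆ W) {c : ℂ} {x : V}
    (hx : x ∈ (casimir V).maxGenEigenspace c) : p x ∈ (casimir W).maxGenEigenspace c :=
  map_mem_maxGenEigenspace_of_comm (p : V →ₗ[ℂ] W) (map_casimir p) hx

theorem lie_mem_casimirBlock (y : sl2) {c : ℂ} {x : V}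
    (hx : x ∈ (casimir V).maxGenEigenspace c) : ⁅y, x⁆ ∈ (casimir V).maxGenEigenspace c :=
  map_mem_maxGenEigenspace_of_comm (LieModule.toEnd ℂ sl2 V y)
    (fun x => (casimir_lie y x).symm) hx

theorem casimir_of_mem_hWeightSpace {μ : ℂ} {x : V} (hx : x ∈ hWeightSpace V μ) :
    casimir V x = (4 : ℂ) • ⁅sl2F, ⁅sl2E, x⁆⁆ + (μ + 1) ^ 2 • x := by
  have hx' : ⁅sl2H, x⁆ = μ • x := hx
  simp only [casimir_apply, hx', lie_smul]
  module

theorem casimir_mem_hWeightSpace {μ : ℂ} {x : V} (hx : x ∈ hWeightSpace V μ) :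
    casimir V x ∈ hWeightSpace V μ := by
  have hx' : ⁅sl2H, x⁆ = μ • x := hx
  change ⁅sl2H, casimir V x⁆ = μ • casimir V x
  rw [← casimir_lie, hx', map_smul]

theorem hWeightSpace_eq_eigenspace (μ : ℂ) :
    hWeightSpace V μ = (LieModule.toEnd ℂ sl2 V sl2H).eigenspace μ := by
  ext x
  rw [Module.End.mem_eigenspace_iff]
  rfl

theorem iSupIndep_hWeightSpace : iSupIndep (hWeightSpace V) := by
  have : hWeightSpace V = (LieModule.toEnd ℂ sl2 V sl2H).eigenspace :=
    funext hWeightSpace_eq_eigenspace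
  rw [this]
  exact Module.End.eigenspaces_iSupIndep _

theorem map_mem_hWeightSpace {W : Type} [AddCommGroup W] [Module ℂ W] [LieRingModule sl2 W]
    [LieModule ℂ sl2 W] (p : V →ₗ⁅ℂ,sl2⁆ W) {μ : ℂ} {x : V} (hx : x ∈ hWeightSpace V μ) :
    p x ∈ hWeightSpace W μ := by
  have hx' : ⁅sl2H, x⁆ = μ • x := hx
  change ⁅sl2H, p x⁆ = μ • p x
  rw [← LieModuleHom.map_lie, hx', map_smul]

theorem e_pow_succ_apply (n : ℕ) (x : V) : ((LieModule.toEnd ℂ sl2 V sl2E) ^ (n + 1)) x =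
    ((LieModule.toEnd ℂ sl2 V sl2E) ^ n) ⁅sl2E, x⁆ := by
  rw [pow_succ, Module.End.mul_apply]; rfl

theorem e_pow_succ_apply' (n : ℕ) (x : V) : ((LieModule.toEnd ℂ sl2 V sl2E) ^ (n + 1)) x =
    ⁅sl2E, ((LieModule.toEnd ℂ sl2 V sl2E) ^ n) x⁆ := by
  rw [pow_succ', Module.End.mul_apply]; rfl

theorem e_pow_mem_hWeightSpace {μ : ℂ} {x : V} (hx : x ∈ hWeightSpace V μ) (n : ℕ) :
    ((LieModule.toEnd ℂ sl2 V sl2E) ^ n) x ∈ hWeightSpace V (μ + 2 * n) := by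
  induction n with
  | zero => simpa using hx
  | succ n ih =>
    rw [e_pow_succ_apply']
    have h := hWeightSpace_e V ih
    rw [show μ + 2 * ((n + 1 : ℕ) : ℂ) = μ + 2 * n + 2 by push_cast; ring]
    exact h

theorem f_pow_mem_hWeightSpace {μ : ℂ} {x : V} (hx : x ∈ hWeightSpace V μ) (n : ℕ) :
    ((LieModule.toEnd ℂ sl2 V sl2F) ^ n) x ∈ hWeightSpace V (μ - 2 * n) := by
  induction n with
  | zero => simpa using hx
  | succ n ih =>
    rw [pow_succ', Module.End.mul_apply]
    have h := hWeightSpace_f V ih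
    rw [show μ - 2 * ((n + 1 : ℕ) : ℂ) = μ - 2 * n - 2 by push_cast; ring]
    exact h

theorem map_e_pow {W : Type} [AddCommGroup W] [Module ℂ W] [LieRingModule sl2 W]
    [LieModule ℂ sl2 W] (p : V →ₗ⁅ℂ,sl2⁆ W) (n : ℕ) (x : V) :
    p (((LieModule.toEnd ℂ sl2 V sl2E) ^ n) x) = ((LieModule.toEnd ℂ sl2 W sl2E) ^ n) (p x) := by
  induction n with
  | zero => rfl
  | succ n ih => rw [e_pow_succ_apply', e_pow_succ_apply', LieModuleHom.map_lie, ih]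

theorem aeval_casimir_e_pow (q : Polynomial ℂ) (n : ℕ) (x : V) :
    ((LieModule.toEnd ℂ sl2 V sl2E) ^ n) (aeval (casimir V) q x) =
      aeval (casimir V) q (((LieModule.toEnd ℂ sl2 V sl2E) ^ n) x) := by
  induction n with
  | zero => rfl
  | succ n ih => rw [e_pow_succ_apply', e_pow_succ_apply', ih, aeval_casimir_lie]

theorem casimir_e_pow (n : ℕ) (x : V) :
    ((LieModule.toEnd ℂ sl2 V sl2E) ^ n) (casimir V x) =
      casimir V (((LieModule.toEnd ℂ sl2 V sl2E) ^ n) x) := by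
  simpa using aeval_casimir_e_pow X n x

theorem e_pow_mem_casimirBlock {c : ℂ} {x : V} (hx : x ∈ (casimir V).maxGenEigenspace c) (n : ℕ) :
    ((LieModule.toEnd ℂ sl2 V sl2E) ^ n) x ∈ (casimir V).maxGenEigenspace c :=
  map_mem_maxGenEigenspace_of_comm _ (casimir_e_pow n) hx

theorem e_pow_f_lie {n : ℕ} {x : V} (hx : ((LieModule.toEnd ℂ sl2 V sl2E) ^ n) x = 0) :
    ((LieModule.toEnd ℂ sl2 V sl2E) ^ n) ⁅sl2H, x⁆ = 0 ∧
      ((LieModule.toEnd ℂ sl2 V sl2E) ^ (n + 1)) ⁅sl2F, x⁆ = 0 := by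
  induction n generalizing x with
  | zero =>
    have : x = 0 := hx
    simp [this]
  | succ n ih =>
    have hx0 := hx
    rw [e_pow_succ_apply] at hx
    obtain ⟨h1, h2⟩ := ih hx
    have h3 : ((LieModule.toEnd ℂ sl2 V sl2E) ^ (n + 1)) ⁅sl2H, x⁆ = 0 := by
      rw [e_pow_succ_apply, e_h_lie, map_sub, map_smul, h1, hx, smul_zero, sub_zero]
    refine ⟨h3, ?_⟩
    rw [e_pow_succ_apply, e_f_lie, map_add, h3, h2, add_zero]

/-- Over a generalized Casimir eigenvalue, the weight of an `e`-nilpotent weight vector is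
constrained by the highest weight vectors above it. -/
theorem exists_eq_sq_of_mem_casimirBlock {μ c : ℂ} {n : ℕ} {x : V} (hx0 : x ≠ 0)
    (hx : x ∈ hWeightSpace V μ) (hn : ((LieModule.toEnd ℂ sl2 V sl2E) ^ n) x = 0)
    (hc : x ∈ (casimir V).maxGenEigenspace c) : ∃ j < n, c = (μ + 1 + 2 * (j : ℂ)) ^ 2 := by
  induction n generalizing x μ with
  | zero => exact absurd hn hx0
  | succ n ih =>
    by_cases he : ⁅sl2E, x⁆ = 0
    · refine ⟨0, Nat.succ_pos n, ?_⟩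
      have h1 : casimir V x = (μ + 1) ^ 2 • x := by
        rw [casimir_of_mem_hWeightSpace hx, he, lie_zero, smul_zero, zero_add]
      have h2 : x ∈ (casimir V).maxGenEigenspace ((μ + 1) ^ 2) :=
        Module.End.eigenspace_le_maxGenEigenspace (Module.End.mem_eigenspace_iff.2 h1)
      by_contra hne
      have hne' : c ≠ (μ + 1) ^ 2 := by simpa using hne
      have := ((casimir V).independent_maxGenEigenspace.pairwiseDisjoint hne').le_bot ⟨hc, h2⟩
      exact hx0 (by simpa using this)
    · rw [e_pow_succ_apply] at hn
      obtain ⟨j, hj, h⟩ := ih he (hWeightSpace_e V hx) hn (lie_mem_casimirBlock _ hc)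
      refine ⟨j + 1, Nat.succ_lt_succ hj, ?_⟩
      rw [h]; push_cast; ring

/-- Every nonzero `e`-nilpotent vector has a highest weight vector among its images under powers of
`e`. In the block `m²` a highest weight is `m-1` or `-m-1`, while `e^(m+1) x` already has weight
`m+1`. -/
theorem e_pow_eq_zero_of_mem_casimirBlock {m n : ℕ} {x : V}
    (hx : x ∈ hWeightSpace V (-(m : ℂ) - 1)) (hn : ((LieModule.toEnd ℂ sl2 V sl2E) ^ n) x = 0)
    (hc : x ∈ (casimir V).maxGenEigenspace ((m : ℂ) ^ 2)) :
    ((LieModule.toEnd ℂ sl2 V sl2E) ^ (m + 1)) x = 0 := by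
  by_contra h0
  have h1 : ((LieModule.toEnd ℂ sl2 V sl2E) ^ n)
      (((LieModule.toEnd ℂ sl2 V sl2E) ^ (m + 1)) x) = 0 := by
    rw [← Module.End.mul_apply, ← pow_add, add_comm, pow_add, Module.End.mul_apply, hn, map_zero]
  obtain ⟨j, -, hj⟩ := exists_eq_sq_of_mem_casimirBlock h0 (e_pow_mem_hWeightSpace hx _) h1
    (e_pow_mem_casimirBlock hc _)
  have h2 : ((m : ℂ)) ^ 2 = ((m + 2 + 2 * j : ℕ) : ℂ) ^ 2 := by
    rw [hj]; push_cast; ring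
  have h3 : m ^ 2 = (m + 2 + 2 * j) ^ 2 := by exact_mod_cast h2
  have h4 := Nat.pow_left_injective (n := 2) (by norm_num) h3
  omega

/-- The operator `Casimir - m²` kills highest weight vectors of weight `-m-1` or `m-1`. As `e^m x`
is of the second kind, `x' = (Casimir - m²) x` satisfies `e^m x' = 0`. No highest weight of the
block lies strictly between `-m-1` and `m-1`, so `x'` is of the first kind, and a second application
kills it. -/
theorem casimir_sub_sq_eq_zero {m n : ℕ} {x : V}
    (hx : x ∈ hWeightSpace V (-(m : ℂ) - 1)) (hn : ((LieModule.toEnd ℂ sl2 V sl2E) ^ n) x = 0)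
    (hc : x ∈ (casimir V).maxGenEigenspace ((m : ℂ) ^ 2)) :
    aeval (casimir V) ((X - C ((m : ℂ) ^ 2)) ^ 2) x = 0 := by
  have hm1 := e_pow_eq_zero_of_mem_casimirBlock hx hn hc
  have happ : ∀ y : V, aeval (casimir V) (X - C ((m : ℂ) ^ 2)) y =
      casimir V y - (m : ℂ) ^ 2 • y := aeval_casimir_X_sub_C _
  have hY : ∀ y ∈ hWeightSpace V (-(m : ℂ) - 1), casimir V y ∈ hWeightSpace V (-(m : ℂ) - 1) :=
    fun y hy => casimir_mem_hWeightSpace hy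
  have hkill : ∀ y ∈ hWeightSpace V (-(m : ℂ) - 1), ⁅sl2E, y⁆ = 0 →
      aeval (casimir V) (X - C ((m : ℂ) ^ 2)) y = 0 := by
    intro y hy hey
    rw [happ, casimir_of_mem_hWeightSpace hy, hey]
    simp
  rw [sq, map_mul, Module.End.mul_apply]
  set x' := aeval (casimir V) (X - C ((m : ℂ) ^ 2)) x with hx'
  have hx'w : x' ∈ hWeightSpace V (-(m : ℂ) - 1) := aeval_mem_of_mapsTo hY _ x hx
  have hx'c : x' ∈ (casimir V).maxGenEigenspace ((m : ℂ) ^ 2) := aeval_mem_of_mapsTo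
    (fun y hy => (casimir V).mapsTo_maxGenEigenspace_of_comm (Commute.refl _) _ hy) _ x hc
  have hx'e : ((LieModule.toEnd ℂ sl2 V sl2E) ^ m) x' = 0 := by
    have h1 : ((LieModule.toEnd ℂ sl2 V sl2E) ^ m) x ∈ hWeightSpace V ((m : ℂ) - 1) := by
      have h := e_pow_mem_hWeightSpace hx m
      rwa [show -(m : ℂ) - 1 + 2 * m = m - 1 by ring] at h
    rw [hx', aeval_casimir_e_pow, happ, casimir_of_mem_hWeightSpace h1, ← e_pow_succ_apply', hm1]
    simp
  refine hkill x' hx'w ?_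
  by_contra hz
  cases m with
  | zero => exact hz (by rw [show x' = 0 from hx'e, lie_zero])
  | succ m =>
    rw [e_pow_succ_apply] at hx'e
    -- With `m+1` in place of `m`, a nonzero `e x'` has weight `-m` and is killed by `e^m`. The
    -- bound `j < m` makes `|-m+1+2j|` less than `m+1`, a contradiction.
    obtain ⟨j, hjm, hj⟩ := exists_eq_sq_of_mem_casimirBlock hz (hWeightSpace_e V hx'w) hx'e
      (lie_mem_casimirBlock _ hx'c)
    have h2 : ((((m + 1 : ℕ) : ℤ) ^ 2 : ℤ) : ℂ) = ((-(m : ℤ) + 1 + 2 * j) ^ 2 : ℤ) := by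
      push_cast at hj ⊢
      rw [hj]; ring
    have h3 : ((m + 1 : ℕ) : ℤ) ^ 2 = (-(m : ℤ) + 1 + 2 * j) ^ 2 := by exact_mod_cast h2
    rcases sq_eq_sq_iff_eq_or_eq_neg.1 h3 with h | h <;> push_cast at h <;> omega

/-- An `e`-nilpotent weight vector is a sum of generalized eigenvectors of the Casimir operator,
which may be taken in any subspace stable under the latter. -/
theorem mem_genEigenSum_casimir {μ : ℂ} {n : ℕ} {x : V} (hx : x ∈ hWeightSpace V μ)
    (hn : ((LieModule.toEnd ℂ sl2 V sl2E) ^ n) x = 0) {Y : Submodule ℂ V}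
    (hY : ∀ y ∈ Y, casimir V y ∈ Y) (hxY : x ∈ Y) : x ∈ genEigenSum (casimir V) Y := by
  refine mem_genEigenSum_of_mem_iSup hY hxY ?_
  clear hxY hY
  induction n generalizing x μ with
  | zero =>
    have : x = 0 := hn
    rw [this]; exact zero_mem _
  | succ n ih =>
    rw [e_pow_succ_apply] at hn
    have h1 := ih (hWeightSpace_e V hx) hn
    have h2 : (⨆ r, (casimir V).maxGenEigenspace r) ≤
        (⨆ r, (casimir V).maxGenEigenspace r).comap (LieModule.toEnd ℂ sl2 V sl2F) :=
      iSup_le fun r y hy => Submodule.mem_iSup_of_mem r (lie_mem_casimirBlock sl2F hy)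
    -- The difference is `4 f e x`, and `e x` is covered by the induction hypothesis.
    have h3 : casimir V x - (μ + 1) ^ 2 • x ∈ genEigenSum (casimir V) ⊤ := by
      rw [casimir_of_mem_hWeightSpace hx, add_sub_cancel_right]
      simp only [genEigenSum, top_inf_eq]
      exact Submodule.smul_mem _ _ (h2 h1)
    have h4 := mem_genEigenSum_of_sub_smul (fun _ _ => Submodule.mem_top) Submodule.mem_top h3
    simpa only [genEigenSum, top_inf_eq] using h4

/-- A cyclic module generated by an `e`-nilpotent weight vector lies in category `O`. -/
theorem inCategoryO_of_generator {μ : ℂ} {n : ℕ} {v : V} (hv : v ∈ hWeightSpace V μ)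
    (hn : ((LieModule.toEnd ℂ sl2 V sl2E) ^ n) v = 0)
    (hgen : LieSubmodule.lieSpan ℂ sl2 {v} = ⊤) : InCategoryO V := by
  refine ⟨⟨{v}, by simpa using hgen⟩, ?_, ?_⟩
  · refine DirectSum.isInternal_submodule_of_iSupIndep_of_iSup_eq_top iSupIndep_hWeightSpace ?_
    let N : LieSubmodule ℂ sl2 V :=
      { (⨆ μ, hWeightSpace V μ : Submodule ℂ V) with
        lie_mem := by
          intro y x hx
          refine lie_mem_of_e_h_f (Y := ⨆ μ, hWeightSpace V μ) ?_ ?_ ?_ y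
          · exact (iSup_le fun r z hz => Submodule.mem_iSup_of_mem (r + 2) (hWeightSpace_e V hz) :
              _ ≤ (⨆ μ, hWeightSpace V μ).comap (LieModule.toEnd ℂ sl2 V sl2E)) hx
          · refine (iSup_le fun r z hz => ?_ :
              _ ≤ (⨆ μ, hWeightSpace V μ).comap (LieModule.toEnd ℂ sl2 V sl2H)) hx
            have hz' : ⁅sl2H, z⁆ = r • z := hz
            refine Submodule.mem_iSup_of_mem r ?_
            rw [LieModule.toEnd_apply_apply, hz']
            exact Submodule.smul_mem _ _ hz
          · exact (iSup_le fun r z hz => Submodule.mem_iSup_of_mem (r - 2) (hWeightSpace_f V hz) :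
              _ ≤ (⨆ μ, hWeightSpace V μ).comap (LieModule.toEnd ℂ sl2 V sl2F)) hx }
    have hN : N = ⊤ := by
      refine eq_top_iff.2 (hgen ▸ LieSubmodule.lieSpan_le.2 ?_)
      rintro x rfl
      exact Submodule.mem_iSup_of_mem μ hv
    exact eq_top_iff.2 fun x _ => (hN ▸ LieSubmodule.mem_top x : x ∈ N)
  · have hmono : ∀ {a b : ℕ} {x : V}, a ≤ b → ((LieModule.toEnd ℂ sl2 V sl2E) ^ a) x = 0 →
        ((LieModule.toEnd ℂ sl2 V sl2E) ^ b) x = 0 := by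
      intro a b x hab hx
      rw [← Nat.sub_add_cancel hab, pow_add, Module.End.mul_apply, hx, map_zero]
    let N : Submodule ℂ V :=
      { carrier := {x | ∃ n : ℕ, ((LieModule.toEnd ℂ sl2 V sl2E) ^ n) x = 0}
        add_mem' := by
          rintro x y ⟨a, ha⟩ ⟨b, hb⟩
          exact ⟨a + b, by rw [map_add, hmono (Nat.le_add_right a b) ha,
            hmono (Nat.le_add_left b a) hb, add_zero]⟩
        zero_mem' := ⟨0, rfl⟩
        smul_mem' := by
          rintro c x ⟨a, ha⟩
          exact ⟨a, by rw [map_smul, ha, smul_zero]⟩ }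
    let N' : LieSubmodule ℂ sl2 V :=
      { N with
        lie_mem := by
          rintro y x ⟨a, ha⟩
          refine lie_mem_of_e_h_f (Y := N) ⟨a, ?_⟩ ⟨a, (e_pow_f_lie ha).1⟩
            ⟨a + 1, (e_pow_f_lie ha).2⟩ y
          rw [← e_pow_succ_apply]
          exact hmono (Nat.le_succ a) ha }
    have hN : N' = ⊤ := by
      refine eq_top_iff.2 (hgen ▸ LieSubmodule.lieSpan_le.2 ?_)
      rintro x rfl
      exact ⟨n, hn⟩
    exact fun x => (hN ▸ LieSubmodule.mem_top x : x ∈ N')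

/-- The cyclic module generated by a weight vector. -/
theorem lieSpan_le_span_of_mem_hWeightSpace {lam : ℂ} {v x : V} (hv : v ∈ hWeightSpace V lam)
    (hx : x ∈ LieSubmodule.lieSpan ℂ sl2 {v}) : x ∈ Submodule.span ℂ {y : V | ∃ (i : ℕ) (q : Polynomial ℂ),
      y = ((LieModule.toEnd ℂ sl2 V sl2F) ^ i) (aeval (casimir V) q v) ∨
      y = ((LieModule.toEnd ℂ sl2 V sl2E) ^ i) (aeval (casimir V) q v)} := by
  let S : Set V := {y : V | ∃ (i : ℕ) (q : Polynomial ℂ),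
      y = ((LieModule.toEnd ℂ sl2 V sl2F) ^ i) (aeval (casimir V) q v) ∨
      y = ((LieModule.toEnd ℂ sl2 V sl2E) ^ i) (aeval (casimir V) q v)}
  have hq : ∀ q : Polynomial ℂ, aeval (casimir V) q v ∈ hWeightSpace V lam := fun q =>
    aeval_mem_of_mapsTo (fun y hy => casimir_mem_hWeightSpace hy) q v hv
  have hF : ∀ (i : ℕ) (q : Polynomial ℂ), ((LieModule.toEnd ℂ sl2 V sl2F) ^ i)
      (aeval (casimir V) q v) ∈ hWeightSpace V (lam - 2 * i) :=
    fun i q => f_pow_mem_hWeightSpace (hq q) i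
  have hE : ∀ (i : ℕ) (q : Polynomial ℂ), ((LieModule.toEnd ℂ sl2 V sl2E) ^ i)
      (aeval (casimir V) q v) ∈ hWeightSpace V (lam + 2 * i) :=
    fun i q => e_pow_mem_hWeightSpace (hq q) i
  have hcasF : ∀ (i : ℕ) (y : V), ((LieModule.toEnd ℂ sl2 V sl2F) ^ i) (casimir V y) =
      casimir V (((LieModule.toEnd ℂ sl2 V sl2F) ^ i) y) := by
    intro i y
    induction i with
    | zero => rfl
    | succ i ih =>
      rw [pow_succ', Module.End.mul_apply, ih, Module.End.mul_apply]
      exact (casimir_lie sl2F _).symm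
  have hXq : ∀ q : Polynomial ℂ, aeval (casimir V) (X * q) v = casimir V (aeval (casimir V) q v) := by
    intro q; rw [map_mul, Module.End.mul_apply, Polynomial.aeval_X]
  have hw : ∀ y ∈ S, ∃ r, y ∈ hWeightSpace V r := by
    rintro y ⟨i, q, rfl | rfl⟩
    · exact ⟨_, hF i q⟩
    · exact ⟨_, hE i q⟩
  -- The Casimir operator eliminates mixed products: on weight vectors `fe` is a polynomial in it.
  -- Hence pure powers of `e` and of `f`, applied to Casimir polynomials of `v`, already span a
  -- submodule.
  have hfe : ∀ {r : ℂ} {y : V}, y ∈ hWeightSpace V r →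
      ⁅sl2F, ⁅sl2E, y⁆⁆ = (4 : ℂ)⁻¹ • casimir V y - ((4 : ℂ)⁻¹ * (r + 1) ^ 2) • y := by
    intro r y hy
    rw [casimir_of_mem_hWeightSpace hy]
    module
  have hcasS : ∀ y ∈ S, casimir V y ∈ S := by
    rintro y ⟨i, q, rfl | rfl⟩
    · exact ⟨i, X * q, Or.inl (by rw [hXq, hcasF])⟩
    · exact ⟨i, X * q, Or.inr (by rw [hXq, casimir_e_pow])⟩
  have hfeS : ∀ y ∈ S, ⁅sl2F, ⁅sl2E, y⁆⁆ ∈ Submodule.span ℂ S := by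
    intro y hy
    obtain ⟨r, hr⟩ := hw y hy
    rw [hfe hr]
    exact sub_mem (Submodule.smul_mem _ _ (Submodule.subset_span (hcasS y hy)))
      (Submodule.smul_mem _ _ (Submodule.subset_span hy))
  have hhS : ∀ y ∈ S, ⁅sl2H, y⁆ ∈ Submodule.span ℂ S := by
    intro y hy
    obtain ⟨r, hr⟩ := hw y hy
    have hr' : ⁅sl2H, y⁆ = r • y := hr
    rw [hr']
    exact Submodule.smul_mem _ _ (Submodule.subset_span hy)
  have hstab : ∀ (y : sl2), Submodule.span ℂ S ≤
      (Submodule.span ℂ S).comap (LieModule.toEnd ℂ sl2 V y) := by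
    intro y
    refine Submodule.span_le.2 fun z hz => lie_mem_of_e_h_f ?_ (hhS z hz) ?_ y
    · obtain ⟨i, q, rfl | rfl⟩ := hz
      · cases i with
        | zero => exact Submodule.subset_span ⟨1, q, Or.inr (by simp)⟩
        | succ i =>
          rw [pow_succ', Module.End.mul_apply, LieModule.toEnd_apply_apply, e_f_lie]
          exact add_mem (hhS _ ⟨i, q, Or.inl rfl⟩) (hfeS _ ⟨i, q, Or.inl rfl⟩)
      · exact Submodule.subset_span ⟨i + 1, q, Or.inr (e_pow_succ_apply' i _).symm⟩
    · obtain ⟨i, q, rfl | rfl⟩ := hz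
      · refine Submodule.subset_span ⟨i + 1, q, Or.inl ?_⟩
        rw [pow_succ', Module.End.mul_apply]; rfl
      · cases i with
        | zero => exact Submodule.subset_span ⟨1, q, Or.inl (by simp)⟩
        | succ i =>
          rw [e_pow_succ_apply']
          exact hfeS _ ⟨i, q, Or.inr rfl⟩
  let N : LieSubmodule ℂ sl2 V :=
    { Submodule.span ℂ S with lie_mem := fun {y x} hx => hstab y hx }
  have hN : LieSubmodule.lieSpan ℂ sl2 {v} ≤ N := by
    refine LieSubmodule.lieSpan_le.2 ?_
    rintro x rfl
    exact Submodule.subset_span ⟨0, 1, Or.inl (by simp)⟩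
  exact hN hx

/-- The weight spaces of a cyclic module generated by a weight vector `v`. -/
theorem mem_span_of_generator {lam μ : ℂ} {v x : V} (hv : v ∈ hWeightSpace V lam)
    (hgen : LieSubmodule.lieSpan ℂ sl2 {v} = ⊤) (hx : x ∈ hWeightSpace V μ) :
    x ∈ Submodule.span ℂ {y : V | ∃ (i : ℕ) (q : Polynomial ℂ),
      (μ = lam - 2 * i ∧ y = ((LieModule.toEnd ℂ sl2 V sl2F) ^ i) (aeval (casimir V) q v)) ∨
      (μ = lam + 2 * i ∧ y = ((LieModule.toEnd ℂ sl2 V sl2E) ^ i) (aeval (casimir V) q v))} := by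
  let S : Set V := {y : V | ∃ (i : ℕ) (q : Polynomial ℂ),
      y = ((LieModule.toEnd ℂ sl2 V sl2F) ^ i) (aeval (casimir V) q v) ∨
      y = ((LieModule.toEnd ℂ sl2 V sl2E) ^ i) (aeval (casimir V) q v)}
  have hq : ∀ q : Polynomial ℂ, aeval (casimir V) q v ∈ hWeightSpace V lam := fun q =>
    aeval_mem_of_mapsTo (fun y hy => casimir_mem_hWeightSpace hy) q v hv
  have hF : ∀ (i : ℕ) (q : Polynomial ℂ), ((LieModule.toEnd ℂ sl2 V sl2F) ^ i)
      (aeval (casimir V) q v) ∈ hWeightSpace V (lam - 2 * i) :=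
    fun i q => f_pow_mem_hWeightSpace (hq q) i
  have hE : ∀ (i : ℕ) (q : Polynomial ℂ), ((LieModule.toEnd ℂ sl2 V sl2E) ^ i)
      (aeval (casimir V) q v) ∈ hWeightSpace V (lam + 2 * i) :=
    fun i q => e_pow_mem_hWeightSpace (hq q) i
  have hw : ∀ y ∈ S, ∃ r, y ∈ hWeightSpace V r := by
    rintro y ⟨i, q, rfl | rfl⟩
    · exact ⟨_, hF i q⟩
    · exact ⟨_, hE i q⟩
  have hxS : x ∈ Submodule.span ℂ S :=
    lieSpan_le_span_of_mem_hWeightSpace hv (hgen ▸ LieSubmodule.mem_top x)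
  have h1 := mem_span_inter_of_iSupIndep iSupIndep_hWeightSpace hw hxS hx
  have huniq : ∀ {r : ℂ} {y : V}, y ∈ hWeightSpace V r → y ∈ hWeightSpace V μ → y ≠ 0 →
      μ = r := by
    intro r y hr hm h0
    by_contra hne
    exact h0 (by simpa using (iSupIndep_hWeightSpace.pairwiseDisjoint hne).le_bot ⟨hm, hr⟩)
  refine (Submodule.span_le.2 ?_) h1
  rintro y ⟨⟨i, q, h⟩, hy⟩
  by_cases h0 : y = 0
  · rw [h0]; exact zero_mem _
  rcases h with rfl | rfl
  · exact Submodule.subset_span ⟨i, q, Or.inl ⟨huniq (hF i q) hy h0, rfl⟩⟩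
  · exact Submodule.subset_span ⟨i, q, Or.inr ⟨huniq (hE i q) hy h0, rfl⟩⟩

/-- The weight space of the generator of a cyclic module. -/
theorem exists_aeval_casimir_of_generator {lam : ℂ} {v x : V} (hv : v ∈ hWeightSpace V lam)
    (hgen : LieSubmodule.lieSpan ℂ sl2 {v} = ⊤) (hx : x ∈ hWeightSpace V lam) :
    ∃ q : Polynomial ℂ, x = aeval (casimir V) q v := by
  have h := mem_span_of_generator hv hgen hx
  let R : Submodule ℂ V :=
    LinearMap.range ((LinearMap.applyₗ v).comp (aeval (casimir V)).toLinearMap)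
  have hle : x ∈ R := by
    refine (Submodule.span_le.2 ?_) h
    rintro y ⟨i, q, ⟨h1, rfl⟩ | ⟨h1, rfl⟩⟩
    · have : i = 0 := by simpa [sub_eq_self] using h1.symm
      subst this
      exact ⟨q, rfl⟩
    · have : i = 0 := by simpa using h1
      subst this
      exact ⟨q, rfl⟩
  obtain ⟨q, hq⟩ := hle
  exact ⟨q, hq.symm⟩

end Sl2Modules

/-! ### The enveloping algebra and its action -/

section Enveloping

/-- The elements satisfying `p` form a subalgebra `A` containing the image of `g`. The universal
property gives a map into `A` whose composite with the inclusion is the identity. -/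
theorem env_induction {p : Env → Prop} (hc : ∀ c : ℂ, p (algebraMap ℂ Env c))
    (hι : ∀ x, p (envι x)) (hmul : ∀ u w, p u → p w → p (u * w))
    (hadd : ∀ u w, p u → p w → p (u + w)) (u : Env) : p u := by
  let A : Subalgebra ℂ Env :=
    { carrier := {u | p u}
      mul_mem' := fun {u w} hu hw => hmul u w hu hw
      add_mem' := fun {u w} hu hw => hadd u w hu hw
      algebraMap_mem' := hc }
  let g : sl2 →ₗ⁅ℂ⁆ A :=
    { toFun := fun x => ⟨envι x, hι x⟩
      map_add' := fun x y => Subtype.ext (map_add envι x y)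
      map_smul' := fun c x => Subtype.ext (map_smul envι c x)
      map_lie' := fun {x y} => Subtype.ext (envι_lie x y) }
  have h : A.val.comp (UniversalEnvelopingAlgebra.lift ℂ g) = AlgHom.id ℂ Env := by
    apply UniversalEnvelopingAlgebra.hom_ext
    ext x
    change A.val (UniversalEnvelopingAlgebra.lift ℂ g (UniversalEnvelopingAlgebra.ι ℂ x)) = _
    rw [UniversalEnvelopingAlgebra.lift_ι_apply]
    rfl
  have h2 := AlgHom.congr_fun h u
  have h3 : (UniversalEnvelopingAlgebra.lift ℂ g u : Env) = u := h2
  rw [← h3]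
  exact (UniversalEnvelopingAlgebra.lift ℂ g u).2

variable {V : Type} [AddCommGroup V] [Module ℂ V] [LieRingModule sl2 V] [LieModule ℂ sl2 V]

theorem enveloping_mem (N : LieSubmodule ℂ sl2 V) (u : Env) : ∀ v ∈ N, enveloping V u v ∈ N := by
  induction u using env_induction with
  | hc c =>
    intro v hv
    rw [AlgHom.commutes, Module.algebraMap_end_apply]
    exact N.smul_mem c hv
  | hι x =>
    intro v hv
    rw [enveloping_envι]
    exact N.lie_mem hv
  | hmul u w hu hw =>
    intro v hv
    rw [map_mul]
    exact hu _ (hw v hv)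
  | hadd u w hu hw =>
    intro v hv
    rw [map_add]
    exact N.add_mem (hu v hv) (hw v hv)

theorem map_enveloping {W : Type} [AddCommGroup W] [Module ℂ W] [LieRingModule sl2 W]
    [LieModule ℂ sl2 W] (p : V →ₗ⁅ℂ,sl2⁆ W) (u : Env) :
    ∀ v, p (enveloping V u v) = enveloping W u (p v) := by
  induction u using env_induction with
  | hc c =>
    intro v
    simp
  | hι x =>
    intro v
    rw [enveloping_envι, enveloping_envι, LieModuleHom.map_lie]
  | hmul u w hu hw =>
    intro v
    rw [map_mul, map_mul, Module.End.mul_apply, Module.End.mul_apply, hu, hw]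
  | hadd u w hu hw =>
    intro v
    rw [map_add, map_add, LinearMap.add_apply, LinearMap.add_apply, map_add, hu, hw]

theorem enveloping_envι_eq (x : sl2) : enveloping V (envι x) = LieModule.toEnd ℂ sl2 V x :=
  LinearMap.ext fun v => enveloping_envι V x v

/-- The Casimir element `4fe + (h+1)²`. -/
noncomputable def casimirElement : Env :=
  (4 : ℂ) • (envι sl2F * envι sl2E) + (envι sl2H + 1) ^ 2

theorem enveloping_casimirElement : enveloping V casimirElement = casimir V := by
  simp [casimirElement, casimir, enveloping_envι_eq]

theorem aeval_casimir_mem (N : LieSubmodule ℂ sl2 V) (q : Polynomial ℂ) {v : V} (hv : v ∈ N) :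
    aeval (casimir V) q v ∈ N := by
  rw [← enveloping_casimirElement, Polynomial.aeval_algHom_apply]
  exact enveloping_mem N _ v hv

end Enveloping

/-! ### The big projective module by generators and relations -/

section BigProjective

/-- The left regular `g`-module structure of the enveloping algebra. -/
@[reducible] noncomputable def envLieRingModule : LieRingModule sl2 Env where
  bracket x u := envι x * u
  add_lie x y u := by rw [map_add, add_mul]
  lie_add x u w := mul_add _ _ _
  leibniz_lie x y u := by
    change envι x * (envι y * u) = envι ⁅x, y⁆ * u + envι y * (envι x * u)
    rw [envι_lie, sub_mul, mul_assoc, mul_assoc]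
    abel

attribute [local instance] envLieRingModule

theorem envLieModule : LieModule ℂ sl2 Env where
  smul_lie c x u := by
    change envι (c • x) * u = c • (envι x * u)
    rw [map_smul, smul_mul_assoc]
  lie_smul c x u := mul_smul_comm _ _ _

attribute [local instance] envLieModule

/-- The left ideal of relations of the generator of a big projective module. -/
noncomputable def bigLeftIdeal (m : ℕ) : LieSubmodule ℂ sl2 Env :=
  { (Submodule.span Env {envι sl2E ^ (m + 1), envι sl2H - algebraMap ℂ Env (-(m : ℂ) - 1),
      aeval casimirElement ((X - C ((m : ℂ) ^ 2)) ^ 2)}).restrictScalars ℂ with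
    lie_mem := fun {x _} hu => Submodule.smul_mem _ (envι x) hu }

/-- The big projective module of highest weight `-m-1`. -/
def BigProjective (m : ℕ) : Type := Env ⧸ bigLeftIdeal m

noncomputable instance (m : ℕ) : AddCommGroup (BigProjective m) :=
  inferInstanceAs (AddCommGroup (Env ⧸ bigLeftIdeal m))

noncomputable instance (m : ℕ) : Module ℂ (BigProjective m) :=
  inferInstanceAs (Module ℂ (Env ⧸ bigLeftIdeal m))

noncomputable instance (m : ℕ) : LieRingModule sl2 (BigProjective m) :=
  inferInstanceAs (LieRingModule sl2 (Env ⧸ bigLeftIdeal m))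

noncomputable instance (m : ℕ) : LieModule ℂ sl2 (BigProjective m) :=
  inferInstanceAs (LieModule ℂ sl2 (Env ⧸ bigLeftIdeal m))

/-- The generator of the big projective module. -/
noncomputable def bigGenerator (m : ℕ) : BigProjective m :=
  LieSubmodule.Quotient.mk' (bigLeftIdeal m) (1 : Env)

theorem enveloping_bigGenerator (m : ℕ) (u : Env) :
    enveloping (BigProjective m) u (bigGenerator m) =
      LieSubmodule.Quotient.mk' (bigLeftIdeal m) u := by
  have h2 : ∀ w : Env, enveloping Env u w = u * w := by
    induction u using env_induction with
    | hc c =>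
      intro w
      rw [AlgHom.commutes, Module.algebraMap_end_apply, Algebra.smul_def]
    | hι x =>
      intro w
      exact enveloping_envι Env x w
    | hmul a b ha hb =>
      intro w
      rw [map_mul, Module.End.mul_apply, hb, ha, mul_assoc]
    | hadd a b ha hb =>
      intro w
      rw [map_add, LinearMap.add_apply, hb, ha, add_mul]
  have h1 := map_enveloping (LieSubmodule.Quotient.mk' (bigLeftIdeal m)) u (1 : Env)
  rw [h2, mul_one] at h1
  exact h1.symm

theorem lieSpan_bigGenerator (m : ℕ) :
    LieSubmodule.lieSpan ℂ sl2 {bigGenerator m} = ⊤ := by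
  refine eq_top_iff.2 fun x _ => ?_
  obtain ⟨u, rfl⟩ := LieSubmodule.Quotient.surjective_mk' (bigLeftIdeal m) x
  rw [← enveloping_bigGenerator]
  exact enveloping_mem _ u _ (LieSubmodule.subset_lieSpan rfl)

theorem enveloping_bigGenerator_eq_zero {m : ℕ} {u : Env}
    (hu : u ∈ ({envι sl2E ^ (m + 1), envι sl2H - algebraMap ℂ Env (-(m : ℂ) - 1),
      aeval casimirElement ((X - C ((m : ℂ) ^ 2)) ^ 2)} : Set Env)) :
    enveloping (BigProjective m) u (bigGenerator m) = 0 := by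
  rw [enveloping_bigGenerator]
  exact (LieSubmodule.Quotient.mk_eq_zero (N := bigLeftIdeal m)).2 (Submodule.subset_span hu)

theorem bigGenerator_mem_hWeightSpace (m : ℕ) :
    bigGenerator m ∈ hWeightSpace (BigProjective m) (-(m : ℂ) - 1) := by
  have h := enveloping_bigGenerator_eq_zero (m := m)
    (u := envι sl2H - algebraMap ℂ Env (-(m : ℂ) - 1)) (by simp)
  rw [map_sub, LinearMap.sub_apply, AlgHom.commutes, enveloping_envι,
    Module.algebraMap_end_apply, sub_eq_zero] at h
  exact h

theorem e_pow_bigGenerator (m : ℕ) :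
    ((LieModule.toEnd ℂ sl2 (BigProjective m) sl2E) ^ (m + 1)) (bigGenerator m) = 0 := by
  have h := enveloping_bigGenerator_eq_zero (m := m) (u := envι sl2E ^ (m + 1)) (by simp)
  rwa [map_pow, enveloping_envι_eq] at h

theorem aeval_casimir_bigGenerator (m : ℕ) :
    aeval (casimir (BigProjective m)) ((X - C ((m : ℂ) ^ 2)) ^ 2) (bigGenerator m) = 0 := by
  have h := enveloping_bigGenerator_eq_zero (m := m)
    (u := aeval casimirElement ((X - C ((m : ℂ) ^ 2)) ^ 2)) (by simp)
  rwa [← Polynomial.aeval_algHom_apply, enveloping_casimirElement] at h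

variable {V : Type} [AddCommGroup V] [Module ℂ V] [LieRingModule sl2 V] [LieModule ℂ sl2 V]

/-- The universal property of the big projective module. -/
theorem exists_hom_bigProjective {m : ℕ} {x : V} (hx : x ∈ hWeightSpace V (-(m : ℂ) - 1))
    (he : ((LieModule.toEnd ℂ sl2 V sl2E) ^ (m + 1)) x = 0)
    (hc : aeval (casimir V) ((X - C ((m : ℂ) ^ 2)) ^ 2) x = 0) :
    ∃ p : BigProjective m →ₗ⁅ℂ,sl2⁆ V, p (bigGenerator m) = x := by
  let l : Env →ₗ[ℂ] V := (LinearMap.applyₗ x).comp (enveloping V).toLinearMap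
  have hl : ∀ u, l u = enveloping V u x := fun _ => rfl
  have hker : (bigLeftIdeal m).toSubmodule ≤ LinearMap.ker l := by
    intro u hu
    have hu' : u ∈ Submodule.span Env {envι sl2E ^ (m + 1),
      envι sl2H - algebraMap ℂ Env (-(m : ℂ) - 1),
      aeval casimirElement ((X - C ((m : ℂ) ^ 2)) ^ 2)} := hu
    rw [LinearMap.mem_ker, hl]
    induction hu' using Submodule.span_induction with
    | mem w hw =>
      rcases hw with rfl | rfl | rfl
      · rw [map_pow, enveloping_envι_eq, he]
      · have hx' : ⁅sl2H, x⁆ = (-(m : ℂ) - 1) • x := hx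
        rw [map_sub, LinearMap.sub_apply, AlgHom.commutes, enveloping_envι,
          Module.algebraMap_end_apply, hx', sub_self]
      · rw [← Polynomial.aeval_algHom_apply, enveloping_casimirElement, hc]
    | zero => simp
    | add a b _ _ ha hb => rw [map_add, LinearMap.add_apply, ha ‹_›, hb ‹_›, add_zero]
    | smul a b _ hb => rw [smul_eq_mul, map_mul, Module.End.mul_apply, hb ‹_›, map_zero]
  let g : (Env ⧸ bigLeftIdeal m) →ₗ[ℂ] V := (bigLeftIdeal m).toSubmodule.liftQ l hker
  have hg : ∀ u, g (LieSubmodule.Quotient.mk' (bigLeftIdeal m) u) = enveloping V u x :=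
    fun _ => rfl
  let p : (Env ⧸ bigLeftIdeal m) →ₗ⁅ℂ,sl2⁆ V :=
    { g with
      map_lie' := by
        intro y z
        obtain ⟨u, rfl⟩ := LieSubmodule.Quotient.surjective_mk' (bigLeftIdeal m) z
        change g _ = ⁅y, g _⁆
        rw [← LieModuleHom.map_lie, hg, hg]
        change enveloping V (envι y * u) x = _
        rw [map_mul, Module.End.mul_apply, enveloping_envι] }
  refine ⟨p, ?_⟩
  change enveloping V 1 x = x
  rw [map_one, Module.End.one_apply]

end BigProjective

/-! ### Projectivity and uniqueness of projective covers -/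

section Covers

/-- A map respecting two decompositions sends components to components, so a homogeneous element of
the image has a homogeneous preimage. It is used for weights and then for Casimir blocks. -/
theorem mem_map_of_mem_iSup {V W : Type*} [AddCommGroup V] [Module ℂ V] [AddCommGroup W]
    [Module ℂ W] {ι : Type*} {A : ι → Submodule ℂ V} {B : ι → Submodule ℂ W} (hB : iSupIndep B)
    (p : V →ₗ[ℂ] W) (hp : ∀ i, ∀ x ∈ A i, p x ∈ B i) {x : V} (hx : x ∈ ⨆ i, A i) {j : ι}
    (hxj : p x ∈ B j) : p x ∈ (A j).map p := by
  have h1 : p x ∈ Submodule.span ℂ (p '' ⋃ i, (A i : Set V)) := by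
    rw [← Submodule.map_span, ← Submodule.iSup_eq_span]
    exact Submodule.mem_map_of_mem hx
  have hS : ∀ y ∈ p '' ⋃ i, (A i : Set V), ∃ i, ∃ z ∈ A i, p z = y := by
    rintro y ⟨z, hz, rfl⟩
    obtain ⟨i, hi⟩ := Set.mem_iUnion.1 hz
    exact ⟨i, z, hi, rfl⟩
  have h2 := mem_span_inter_of_iSupIndep hB (fun y hy => by
    obtain ⟨i, z, hz, rfl⟩ := hS y hy
    exact ⟨i, hp i z hz⟩) h1 hxj
  refine (Submodule.span_le.2 ?_) h2
  rintro y ⟨hy, hyj⟩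
  obtain ⟨i, z, hz, rfl⟩ := hS y hy
  by_cases hij : i = j
  · subst hij
    exact Submodule.mem_map_of_mem hz
  · have h0 : p z = 0 := by
      simpa using (hB.pairwiseDisjoint hij).le_bot ⟨hp i z hz, hyj⟩
    rw [h0]
    exact zero_mem _

theorem bigProjective_hom_ext {W : Type} [AddCommGroup W] [Module ℂ W] [LieRingModule sl2 W]
    {m : ℕ} {p q : BigProjective m →ₗ⁅ℂ,sl2⁆ W}
    (h : p (bigGenerator m) = q (bigGenerator m)) : p = q := by
  have hle : LieSubmodule.lieSpan ℂ sl2 {bigGenerator m} ≤ (p - q).ker := by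
    refine LieSubmodule.lieSpan_le.2 ?_
    rintro x rfl
    change (p - q) (bigGenerator m) = 0
    rw [LieModuleHom.sub_apply, h, sub_self]
  ext x
  have hx : x ∈ (p - q).ker := hle (lieSpan_bigGenerator m ▸ LieSubmodule.mem_top x)
  rw [LieModuleHom.mem_ker, LieModuleHom.sub_apply, sub_eq_zero] at hx
  exact hx

variable {V : Type} [AddCommGroup V] [Module ℂ V] [LieRingModule sl2 V] [LieModule ℂ sl2 V]

theorem InCategoryO.iSup_hWeightSpace (h : InCategoryO V) : ⨆ μ, hWeightSpace V μ = ⊤ :=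
  h.weightDecomposition.submodule_iSup_eq_top

theorem bigProjective_inCategoryO (m : ℕ) : InCategoryO (BigProjective m) :=
  inCategoryO_of_generator (bigGenerator_mem_hWeightSpace m) (e_pow_bigGenerator m)
    (lieSpan_bigGenerator m)

theorem mem_casimirBlock_of_aeval {c : ℂ} {x : V}
    (hx : aeval (casimir V) ((X - C c) ^ 2) x = 0) : x ∈ (casimir V).maxGenEigenspace c := by
  refine (Module.End.mem_maxGenEigenspace _ _ _).2 ⟨2, ?_⟩
  simpa [Module.algebraMap_end_eq_smul_id, Module.End.one_eq_id] using hx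

/-- The vectors of weight `-m-1` in the block of `m²` are the images of the generator of the big
projective module. -/
theorem exists_hom_bigProjective_of_mem_casimirBlock {m n : ℕ} {x : V}
    (hx : x ∈ hWeightSpace V (-(m : ℂ) - 1)) (hn : ((LieModule.toEnd ℂ sl2 V sl2E) ^ n) x = 0)
    (hc : x ∈ (casimir V).maxGenEigenspace ((m : ℂ) ^ 2)) :
    ∃ p : BigProjective m →ₗ⁅ℂ,sl2⁆ V, p (bigGenerator m) = x :=
  exists_hom_bigProjective hx (e_pow_eq_zero_of_mem_casimirBlock hx hn hc)
    (casimir_sub_sq_eq_zero hx hn hc)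

/-- Homomorphisms out of the module correspond to vectors of weight `-m-1` in the block `m²`. Such
vectors lift through surjections in `O`: a preimage is replaced by its weight component, then by its
block component, without changing its image. -/
theorem bigProjective_isProjectiveInO (m : ℕ) : IsProjectiveInO (BigProjective m) := by
  refine ⟨bigProjective_inCategoryO m, ?_⟩
  intro M N _ _ _ _ _ _ _ _ hM hN p k hp
  have hw := map_mem_hWeightSpace k (bigGenerator_mem_hWeightSpace m)
  have hc := map_mem_casimirBlock k (mem_casimirBlock_of_aeval (aeval_casimir_bigGenerator m))
  obtain ⟨x₁, hx₁⟩ := hp (k (bigGenerator m))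
  have h1 : (p : M →ₗ[ℂ] N) x₁ ∈ (hWeightSpace M (-(m : ℂ) - 1)).map (p : M →ₗ[ℂ] N) :=
    mem_map_of_mem_iSup iSupIndep_hWeightSpace (p : M →ₗ[ℂ] N)
      (fun i x hx => map_mem_hWeightSpace p hx)
      (hM.iSup_hWeightSpace ▸ Submodule.mem_top : x₁ ∈ ⨆ i, hWeightSpace M i)
      (by rw [LieModuleHom.coe_toLinearMap, hx₁]; exact hw)
  obtain ⟨x₂, hx₂, h2⟩ := h1
  obtain ⟨n, hn⟩ := hM.locallyNilpotent x₂
  have h3 := mem_genEigenSum_casimir hx₂ hn (fun y hy => casimir_mem_hWeightSpace hy) hx₂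
  have h4 : (p : M →ₗ[ℂ] N) x₂ ∈ (hWeightSpace M (-(m : ℂ) - 1) ⊓
      (casimir M).maxGenEigenspace ((m : ℂ) ^ 2)).map (p : M →ₗ[ℂ] N) :=
    mem_map_of_mem_iSup
      (A := fun r => hWeightSpace M (-(m : ℂ) - 1) ⊓ (casimir M).maxGenEigenspace r)
      (casimir N).independent_maxGenEigenspace (p : M →ₗ[ℂ] N)
      (fun i x hx => map_mem_casimirBlock p hx.2) h3
      (by rw [h2, LieModuleHom.coe_toLinearMap, hx₁]; exact hc)
  obtain ⟨x₃, ⟨hx₃, hx₃c⟩, h5⟩ := h4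
  obtain ⟨n, hn⟩ := hM.locallyNilpotent x₃
  obtain ⟨k', hk'⟩ := exists_hom_bigProjective_of_mem_casimirBlock hx₃ hn hx₃c
  refine ⟨k', bigProjective_hom_ext ?_⟩
  rw [LieModuleHom.comp_apply, hk', ← hx₁]
  exact h5.trans h2

/-- Submodules of a weight module are themselves sums of weight spaces, so a decomposition of `v`
can be cut down to the weight of `v`. -/
theorem exists_add_of_mem_sup (hV : ⨆ μ, hWeightSpace V μ = ⊤) {N K : LieSubmodule ℂ sl2 V}
    {lam : ℂ} {v : V} (hv : v ∈ hWeightSpace V lam) (hvs : v ∈ N ⊔ K) :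
    ∃ n k, n ∈ N ∧ k ∈ K ∧ n ∈ hWeightSpace V lam ∧ v = n + k := by
  have hN : ∀ (N : LieSubmodule ℂ sl2 V), N.toSubmodule ≤
      Submodule.span ℂ {y | ∃ μ, y ∈ hWeightSpace V μ ∧ y ∈ N} := by
    intro N y hy
    have h1 : y ∈ ⨆ r, N.toSubmodule ⊓ (LieModule.toEnd ℂ sl2 V sl2H).eigenspace r := by
      refine mem_iSup_inf_eigenspace ?_ (fun z hz => N.lie_mem hz) hy
      rw [← hV]
      exact iSup_congr fun μ => (hWeightSpace_eq_eigenspace μ).symm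
    refine (iSup_le fun r z hz => ?_ : _ ≤ Submodule.span ℂ _) h1
    refine Submodule.subset_span ⟨r, ?_, hz.1⟩
    rw [hWeightSpace_eq_eigenspace]
    exact hz.2
  let S : Set V := {y | ∃ μ, y ∈ hWeightSpace V μ ∧ (y ∈ N ∨ y ∈ K)}
  have hS : v ∈ Submodule.span ℂ S := by
    rw [← LieSubmodule.mem_toSubmodule, LieSubmodule.sup_toSubmodule] at hvs
    refine (sup_le ((hN N).trans (Submodule.span_mono ?_))
      ((hN K).trans (Submodule.span_mono ?_)) : _ ≤ Submodule.span ℂ S) hvs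
    · rintro y ⟨μ, h1, h2⟩
      exact ⟨μ, h1, Or.inl h2⟩
    · rintro y ⟨μ, h1, h2⟩
      exact ⟨μ, h1, Or.inr h2⟩
  have h1 := mem_span_inter_of_iSupIndep iSupIndep_hWeightSpace
    (fun y (hy : y ∈ S) => hy.imp fun _ h => h.1) hS hv
  have h2 : v ∈ (N.toSubmodule ⊓ hWeightSpace V lam) ⊔ K.toSubmodule := by
    refine (Submodule.span_le.2 ?_) h1
    rintro y ⟨⟨μ, -, h | h⟩, hy⟩
    · exact Submodule.mem_sup_left ⟨h, hy⟩
    · exact Submodule.mem_sup_right h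
  obtain ⟨n, hn, k, hk, rfl⟩ := Submodule.mem_sup.1 h2
  exact ⟨n, k, hn.1, hk, hn.2, rfl⟩

/-- The weight space of the generator consists of Casimir polynomials `r` applied to it. If `N` and
the kernel span everything, applying `q` to such a component in `N` forces `r(m²) ≠ 0`; nilpotency
of `Casimir - m²` then makes `r` invertible on the generator, which therefore lies in `N`. -/
theorem bigProjective_superfluous {m : ℕ} (q : BigProjective m →ₗ⁅ℂ,sl2⁆ V)
    (hne : q (bigGenerator m) ≠ 0) (he : ⁅sl2E, q (bigGenerator m)⁆ = 0)
    (N : LieSubmodule ℂ sl2 (BigProjective m)) (hN : N ⊔ q.ker = ⊤) : N = ⊤ := by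
  have hv := bigGenerator_mem_hWeightSpace m
  obtain ⟨n, k, hn, hk, hnw, hnk⟩ := exists_add_of_mem_sup
    (bigProjective_inCategoryO m).iSup_hWeightSpace hv
    (hN ▸ LieSubmodule.mem_top (bigGenerator m) : bigGenerator m ∈ N ⊔ q.ker)
  obtain ⟨r, rfl⟩ := exists_aeval_casimir_of_generator hv (lieSpan_bigGenerator m) hnw
  have hcas : casimir V (q (bigGenerator m)) = (m : ℂ) ^ 2 • q (bigGenerator m) := by
    rw [casimir_of_mem_hWeightSpace (map_mem_hWeightSpace q hv), he, lie_zero]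
    module
  have h1 : q (bigGenerator m) = r.eval ((m : ℂ) ^ 2) • q (bigGenerator m) := by
    have hk0 : q k = 0 := hk
    conv_lhs => rw [hnk, map_add, hk0, add_zero, map_aeval_casimir]
    exact Module.End.aeval_apply_of_hasEigenvector
      ⟨Module.End.mem_eigenspace_iff.2 hcas, hne⟩
  have h2 : r.eval ((m : ℂ) ^ 2) ≠ 0 := by
    intro h0
    rw [h0, zero_smul] at h1
    exact hne h1
  obtain ⟨s, hs⟩ := exists_aeval_mul_apply_eq
    (mem_casimirBlock_of_aeval (aeval_casimir_bigGenerator m)) h2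
  rw [mul_comm, map_mul, Module.End.mul_apply] at hs
  have hmem : bigGenerator m ∈ N := hs ▸ aeval_casimir_mem N s hn
  refine eq_top_iff.2 (lieSpan_bigGenerator m ▸ LieSubmodule.lieSpan_le.2 ?_)
  rintro x rfl
  exact hmem

/-- Any projective cover is isomorphic to the explicit big projective module. -/
theorem exists_equiv_bigProjective {m : ℕ} (hV : IsProjectiveCover V (-(m : ℂ) - 1)) :
    ∃ (g : BigProjective m →ₗ⁅ℂ,sl2⁆ V) (s : V →ₗ⁅ℂ,sl2⁆ BigProjective m),
      (∀ x, g (s x) = x) ∧ ∀ x, s (g x) = x := by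
  obtain ⟨hproj, S, _, _, _, _, p, ⟨hirr, z, hz, hez, hhz⟩, hp, hsup⟩ := hV
  have hzw : z ∈ hWeightSpace S (-(m : ℂ) - 1) := hhz
  have hzc : casimir S z = (m : ℂ) ^ 2 • z := by
    rw [casimir_of_mem_hWeightSpace hzw, hez, lie_zero]
    module
  obtain ⟨q, hq⟩ := exists_hom_bigProjective_of_mem_casimirBlock (n := 1) hzw
    (by rw [pow_one]; exact hez)
    (Module.End.eigenspace_le_maxGenEigenspace (Module.End.mem_eigenspace_iff.2 hzc))
  have htop : ∀ N : LieSubmodule ℂ sl2 S, z ∈ N → N = ⊤ := by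
    intro N hN
    refine (IsSimpleOrder.eq_bot_or_eq_top N).resolve_left ?_
    rintro rfl
    exact hz (by simpa using hN)
  have hS : InCategoryO S := by
    refine inCategoryO_of_generator (n := 1) hzw (by rw [pow_one]; exact hez) (htop _ ?_)
    exact LieSubmodule.subset_lieSpan rfl
  -- Both modules are projective over `S` with superfluous kernels. The lift `g` of `q` is onto
  -- because the kernel of `p` is superfluous, and its splitting `s` is onto because the kernel of
  -- `q` is.
  obtain ⟨g, hg⟩ := (bigProjective_isProjectiveInO m).2 V S hproj.1 hS p q hp
  have hpg : ∀ x, p (g x) = q x := fun x => by rw [← hg]; rfl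
  have hqs : ∀ y, ∃ x, q x = y := by
    intro y
    have h1 : q.range = ⊤ := htop _ ⟨bigGenerator m, hq⟩
    have h2 : y ∈ q.range := h1 ▸ LieSubmodule.mem_top y
    exact (LieModuleHom.mem_range q y).1 h2
  have hgr : g.range = ⊤ := by
    refine hsup _ (eq_top_iff.2 fun x _ => ?_)
    obtain ⟨y, hy⟩ := hqs (p x)
    have h1 : x - g y ∈ p.ker := by
      rw [LieModuleHom.mem_ker, map_sub, hpg, hy, sub_self]
    have h2 : g y ∈ g.range := (LieModuleHom.mem_range g _).2 ⟨y, rfl⟩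
    have := add_mem ((le_sup_left : g.range ≤ g.range ⊔ p.ker) h2)
      ((le_sup_right : p.ker ≤ g.range ⊔ p.ker) h1)
    simpa using this
  have hgs : Function.Surjective g := fun x =>
    (LieModuleHom.mem_range g x).1 (hgr ▸ LieSubmodule.mem_top x)
  obtain ⟨s, hs⟩ := hproj.2 (BigProjective m) V (bigProjective_inCategoryO m) hproj.1 g
    LieModuleHom.id hgs
  have hgs' : ∀ x, g (s x) = x := fun x => LieModuleHom.congr_fun hs x
  have hsr : s.range = ⊤ := by
    refine bigProjective_superfluous q (by rwa [hq]) (by rwa [hq]) _ (eq_top_iff.2 fun x _ => ?_)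
    have h1 : x - s (g x) ∈ q.ker := by
      rw [LieModuleHom.mem_ker, ← hpg, map_sub, hgs', sub_self, map_zero]
    have h2 : s (g x) ∈ s.range := (LieModuleHom.mem_range s _).2 ⟨g x, rfl⟩
    have := add_mem ((le_sup_left : s.range ≤ s.range ⊔ q.ker) h2)
      ((le_sup_right : q.ker ≤ s.range ⊔ q.ker) h1)
    simpa using this
  refine ⟨g, s, hgs', fun x => ?_⟩
  obtain ⟨y, rfl⟩ := (LieModuleHom.mem_range s x).1 (hsr ▸ LieSubmodule.mem_top x)
  rw [hgs']

/-- Antidominant highest weight modules are irreducible. -/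
theorem isIrreducible_of_highestWeight {m : ℕ} {v : V} (hv0 : v ≠ 0)
    (hv : v ∈ hWeightSpace V (-(m : ℂ) - 1)) (hev : ⁅sl2E, v⁆ = 0)
    (hgen : LieSubmodule.lieSpan ℂ sl2 {v} = ⊤) : LieModule.IsIrreducible ℂ sl2 V := by
  have hO := inCategoryO_of_generator (n := 1) hv (by rw [pow_one]; exact hev) hgen
  have : Nontrivial V := ⟨v, 0, hv0⟩
  have hcasv : casimir V v = (m : ℂ) ^ 2 • v := by
    rw [casimir_of_mem_hWeightSpace hv, hev, lie_zero]
    module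
  have hcv : ∀ q : Polynomial ℂ, aeval (casimir V) q v = q.eval ((m : ℂ) ^ 2) • v := fun q =>
    Module.End.aeval_apply_of_hasEigenvector ⟨Module.End.mem_eigenspace_iff.2 hcasv, hv0⟩
  have hcas : ∀ x, x ∈ (casimir V).maxGenEigenspace ((m : ℂ) ^ 2) := by
    let N : LieSubmodule ℂ sl2 V :=
      { (casimir V).maxGenEigenspace ((m : ℂ) ^ 2) with
        lie_mem := fun {y _} hx => lie_mem_casimirBlock y hx }
    have hN : N = ⊤ := by
      refine eq_top_iff.2 (hgen ▸ LieSubmodule.lieSpan_le.2 ?_)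
      rintro x rfl
      exact Module.End.eigenspace_le_maxGenEigenspace (Module.End.mem_eigenspace_iff.2 hcasv)
    exact fun x => (hN ▸ LieSubmodule.mem_top x : x ∈ N)
  refine LieModule.IsIrreducible.mk fun N hN => ?_
  suffices hvN : v ∈ N by
    refine eq_top_iff.2 (hgen ▸ LieSubmodule.lieSpan_le.2 ?_)
    rintro x rfl
    exact hvN
  obtain ⟨x, hxN, μ, hxμ, hx0⟩ : ∃ x ∈ N, ∃ μ, x ∈ hWeightSpace V μ ∧ x ≠ 0 := by
    by_contra hcon
    push Not at hcon
    refine hN ((LieSubmodule.eq_bot_iff N).2 fun y hy => ?_)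
    have h1 : y ∈ ⨆ r, N.toSubmodule ⊓ (LieModule.toEnd ℂ sl2 V sl2H).eigenspace r := by
      refine mem_iSup_inf_eigenspace ?_ (fun z hz => N.lie_mem hz) hy
      rw [← hO.iSup_hWeightSpace]
      exact iSup_congr fun μ => (hWeightSpace_eq_eigenspace μ).symm
    have h2 : (⨆ r, N.toSubmodule ⊓ (LieModule.toEnd ℂ sl2 V sl2H).eigenspace r) ≤ ⊥ := by
      refine iSup_le fun r z hz => ?_
      rw [← hWeightSpace_eq_eigenspace] at hz
      exact (Submodule.mem_bot ℂ).2 (hcon z hz.1 r hz.2)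
    exact (Submodule.mem_bot ℂ).1 (h2 h1)
  obtain ⟨n, hn⟩ := hO.locallyNilpotent x
  -- Raising a nonzero weight vector of `N` by `e` until the last nonzero stage gives a highest
  -- weight vector in `N`.
  obtain ⟨y, hyN, σ, hyσ, hy0, hey⟩ : ∃ y ∈ N, ∃ σ, y ∈ hWeightSpace V σ ∧ y ≠ 0 ∧
      ⁅sl2E, y⁆ = 0 := by
    clear hcas
    induction n generalizing x μ with
    | zero => exact absurd hn hx0
    | succ n ih =>
      by_cases he : ⁅sl2E, x⁆ = 0
      · exact ⟨x, hxN, μ, hxμ, hx0, he⟩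
      · exact ih _ (N.lie_mem hxN) _ (hWeightSpace_e V hxμ) he (by rwa [e_pow_succ_apply] at hn)
  obtain ⟨j, hj, hj2⟩ := exists_eq_sq_of_mem_casimirBlock (n := 1) hy0 hyσ
    (by rw [pow_one]; exact hey) (hcas y)
  obtain rfl : j = 0 := by omega
  -- The Casimir eigenvalue leaves only `σ = -m-1` or `σ = m-1`. If these differ, the second lies
  -- above the highest weight of the cyclic module, where the weight space is zero.
  have hσ : σ = -(m : ℂ) - 1 := by
    have hspan := mem_span_of_generator hv hgen hyσ
    by_contra hne
    have hpos : 0 < m := by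
      rcases Nat.eq_zero_or_pos m with rfl | h
      · exfalso
        apply hne
        have h0 : (σ + 1) ^ 2 = 0 := by simpa using hj2.symm
        linear_combination pow_eq_zero_iff (two_ne_zero) |>.1 h0
      · exact h
    have hσ' : σ = (m : ℂ) - 1 := by
      have h0 : (m : ℂ) ^ 2 = (σ + 1) ^ 2 := by simpa using hj2
      rcases sq_eq_sq_iff_eq_or_eq_neg.1 h0 with h | h
      · linear_combination -h
      · exact absurd (by linear_combination h) hne
    refine hy0 ((Submodule.mem_bot ℂ).1 ((Submodule.span_le.2 ?_ : _ ≤ ⊥) hspan))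
    rintro w ⟨i, q, ⟨h1, rfl⟩ | ⟨h1, rfl⟩⟩
    · exfalso
      have h2 : ((m + i : ℕ) : ℂ) = (0 : ℕ) := by
        rw [hσ'] at h1
        push_cast
        linear_combination h1 / 2
      have := Nat.cast_injective h2
      omega
    · have hi : i ≠ 0 := by
        rintro rfl
        exact hne (by simpa using h1)
      obtain ⟨i, rfl⟩ := Nat.exists_eq_succ_of_ne_zero hi
      rw [hcv, map_smul, e_pow_succ_apply, hev, map_zero, smul_zero]
      exact zero_mem _
  subst hσ
  obtain ⟨q, rfl⟩ := exists_aeval_casimir_of_generator hv hgen hyσ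
  rw [hcv] at hyN hy0
  have h0 : q.eval ((m : ℂ) ^ 2) ≠ 0 := fun h => hy0 (by rw [h, zero_smul])
  have h1 := N.smul_mem (q.eval ((m : ℂ) ^ 2))⁻¹ hyN
  rwa [smul_smul, inv_mul_cancel₀ h0, one_smul] at h1

/-- The big projective module covers the irreducible antidominant highest weight modules. -/
theorem isProjectiveCover_bigProjective {m : ℕ} {v : V} (hv0 : v ≠ 0)
    (hv : v ∈ hWeightSpace V (-(m : ℂ) - 1)) (hev : ⁅sl2E, v⁆ = 0)
    (hgen : LieSubmodule.lieSpan ℂ sl2 {v} = ⊤) :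
    IsProjectiveCover (BigProjective m) (-(m : ℂ) - 1) := by
  have hcasv : casimir V v = (m : ℂ) ^ 2 • v := by
    rw [casimir_of_mem_hWeightSpace hv, hev, lie_zero]
    module
  obtain ⟨q, hq⟩ := exists_hom_bigProjective_of_mem_casimirBlock (n := 1) hv
    (by rw [pow_one]; exact hev)
    (Module.End.eigenspace_le_maxGenEigenspace (Module.End.mem_eigenspace_iff.2 hcasv))
  refine ⟨bigProjective_isProjectiveInO m, V, _, _, _, inferInstance, q,
    ⟨isIrreducible_of_highestWeight hv0 hv hev hgen, v, hv0, hev, hv⟩, fun y => ?_,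
    bigProjective_superfluous q (by rwa [hq]) (by rwa [hq])⟩
  refine (LieModuleHom.mem_range q y).1 ?_
  have h1 : LieSubmodule.lieSpan ℂ sl2 {v} ≤ q.range := by
    refine LieSubmodule.lieSpan_le.2 ?_
    rintro x rfl
    exact (LieModuleHom.mem_range q x).2 ⟨_, hq⟩
  exact h1 (hgen ▸ LieSubmodule.mem_top y)

end Covers

/-! ### Regular functions on the cell as polynomials in `a`, `d` and `c^(±1)` -/

section RegularFunctions

theorem evalAt_X (g : SL(2, ℂ)) (ij : Fin 2 × Fin 2) :
    evalAt g (MvPolynomial.X ij) = g ij.1 ij.2 := by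
  simp [evalAt]

theorem coord_ne_zero (g : bigCell) : (g : SL(2, ℂ)) 1 0 ≠ 0 := (mem_bigCell_iff _).1 g.2

theorem isRegular_of_div {ψ : bigCell → ℂ} {p q : MvPolynomial (Fin 2 × Fin 2) ℂ}
    (hq : ∀ k : bigCell, evalAt k q ≠ 0)
    (hpq : ∀ k : bigCell, ψ k = evalAt k p / evalAt k q) : IsRegular ψ :=
  fun g => ⟨p, q, hq g, fun k _ => hpq k⟩

/-- The function `a^i d^j c^n` of the entries of `g = (a, b; c, d)`. -/
noncomputable def monomialFun (i j : ℕ) (n : ℤ) (g : bigCell) : ℂ :=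
  (g : SL(2, ℂ)) 0 0 ^ i * (g : SL(2, ℂ)) 1 1 ^ j * (g : SL(2, ℂ)) 1 0 ^ n

theorem monomialFun_eq_div (i j k N : ℕ) (g : bigCell) :
    monomialFun i j ((k : ℤ) - N) g =
      evalAt g (MvPolynomial.X (0, 0) ^ i * MvPolynomial.X (1, 1) ^ j *
        MvPolynomial.X (1, 0) ^ k) / evalAt g (MvPolynomial.X (1, 0) ^ N) := by
  simp only [monomialFun, map_mul, map_pow, evalAt_X]
  rw [zpow_sub₀ (coord_ne_zero g), zpow_natCast, zpow_natCast]
  ring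

theorem exists_natCast_sub (n : ℤ) : ∃ k N : ℕ, n = (k : ℤ) - N :=
  ⟨n.toNat, (-n).toNat, by omega⟩

theorem evalAt_coord_pow_ne_zero (N : ℕ) (g : bigCell) :
    evalAt g (MvPolynomial.X (1, 0) ^ N) ≠ 0 := by
  rw [map_pow, evalAt_X]
  exact pow_ne_zero N (coord_ne_zero g)

/-- The regular function `a^i d^j c^n`. -/
noncomputable def monomialReg (i j : ℕ) (n : ℤ) : regularFunctions :=
  ⟨monomialFun i j n, by
    obtain ⟨k, N, rfl⟩ := exists_natCast_sub n
    exact isRegular_of_div (evalAt_coord_pow_ne_zero N) (monomialFun_eq_div i j k N)⟩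

/-- The product rule for `a^i d^j c^n`. The truncated exponents `i - 1` and `j - 1` at zero are
harmless, since their coefficients `i` and `j` vanish there. -/
theorem regAct_monomialFun (x : sl2 × sl2) (i j : ℕ) (n : ℤ) (g : bigCell) :
    regAct x (monomialFun i j n) g =
      (i : ℂ) * (-((x.1 : Matrix (Fin 2) (Fin 2) ℂ) * (g : SL(2, ℂ)).1) +
        (g : SL(2, ℂ)).1 * (x.2 : Matrix (Fin 2) (Fin 2) ℂ)) 0 0 * monomialFun (i - 1) j n g +
      (j : ℂ) * (-((x.1 : Matrix (Fin 2) (Fin 2) ℂ) * (g : SL(2, ℂ)).1) +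
        (g : SL(2, ℂ)).1 * (x.2 : Matrix (Fin 2) (Fin 2) ℂ)) 1 1 * monomialFun i (j - 1) n g +
      (n : ℂ) * (-((x.1 : Matrix (Fin 2) (Fin 2) ℂ) * (g : SL(2, ℂ)).1) +
        (g : SL(2, ℂ)).1 * (x.2 : Matrix (Fin 2) (Fin 2) ℂ)) 1 0 * monomialFun i j (n - 1) g := by
  obtain ⟨k, N, rfl⟩ := exists_natCast_sub n
  rw [regAct_eq x (fun g _ => monomialFun_eq_div i j k N g) g (evalAt_coord_pow_ne_zero N g)]
  simp only [Derivation.leibniz, Derivation.leibniz_pow, smul_eq_mul, nsmul_eq_mul, map_add,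
    map_mul, map_sub, map_pow, map_natCast, evalAt_vf_X, evalAt_X, monomialFun]
  have hc := coord_ne_zero g
  rw [zpow_sub_one₀ hc, zpow_sub₀ hc, zpow_natCast, zpow_natCast]
  generalize (-((x.1 : Matrix (Fin 2) (Fin 2) ℂ) * (g : SL(2, ℂ)).1) +
        (g : SL(2, ℂ)).1 * (x.2 : Matrix (Fin 2) (Fin 2) ℂ)) = D
  generalize (g : SL(2, ℂ)) 1 0 = c at *
  generalize (g : SL(2, ℂ)) 0 0 = a
  generalize (g : SL(2, ℂ)) 1 1 = d
  push_cast
  rcases k with _ | k <;> rcases N with _ | N <;>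
    simp only [Nat.add_sub_cancel, Nat.zero_sub, Nat.cast_zero, Nat.cast_add, Nat.cast_one,
      pow_zero] <;> field_simp <;> ring

theorem lie_e_monomialReg (i j : ℕ) (n : ℤ) :
    ⁅((sl2E, 0) : sl2 × sl2), monomialReg i j n⁆ = (-(i : ℂ)) • monomialReg (i - 1) j (n + 1) := by
  apply Subtype.ext
  funext g
  change regAct (sl2E, 0) (monomialFun i j n) g = -(i : ℂ) * monomialFun (i - 1) j (n + 1) g
  rw [regAct_monomialFun]
  have hc := coord_ne_zero g
  simp only [monomialFun, zpow_add_one₀ hc]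
  simp only [Matrix.add_apply, Matrix.neg_apply, Matrix.mul_apply, Fin.sum_univ_two]
  simp [sl2E]
  ring

theorem lie_h_monomialReg (i j : ℕ) (n : ℤ) :
    ⁅((sl2H, 0) : sl2 × sl2), monomialReg i j n⁆ = ((n : ℂ) + j - i) • monomialReg i j n := by
  apply Subtype.ext
  funext g
  change regAct (sl2H, 0) (monomialFun i j n) g = ((n : ℂ) + j - i) * monomialFun i j n g
  rw [regAct_monomialFun]
  have hc := coord_ne_zero g
  simp only [monomialFun, zpow_sub_one₀ hc]
  simp only [Matrix.add_apply, Matrix.neg_apply, Matrix.mul_apply, Fin.sum_univ_two]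
  simp [sl2H]
  rcases i with _ | i <;> rcases j with _ | j <;> simp <;> field_simp <;> ring

theorem lie_e_monomialReg_right (i j : ℕ) (n : ℤ) :
    ⁅((0, sl2E) : sl2 × sl2), monomialReg i j n⁆ = (j : ℂ) • monomialReg i (j - 1) (n + 1) := by
  apply Subtype.ext
  funext g
  change regAct (0, sl2E) (monomialFun i j n) g = (j : ℂ) * monomialFun i (j - 1) (n + 1) g
  rw [regAct_monomialFun]
  have hc := coord_ne_zero g
  simp only [monomialFun, zpow_add_one₀ hc]
  simp only [Matrix.add_apply, Matrix.neg_apply, Matrix.mul_apply, Fin.sum_univ_two]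
  simp [sl2E]
  ring

theorem lie_h_monomialReg_right (i j : ℕ) (n : ℤ) :
    ⁅((0, sl2H) : sl2 × sl2), monomialReg i j n⁆ = ((n : ℂ) + i - j) • monomialReg i j n := by
  apply Subtype.ext
  funext g
  change regAct (0, sl2H) (monomialFun i j n) g = ((n : ℂ) + i - j) * monomialFun i j n g
  rw [regAct_monomialFun]
  have hc := coord_ne_zero g
  simp only [monomialFun, zpow_sub_one₀ hc]
  simp only [Matrix.add_apply, Matrix.neg_apply, Matrix.mul_apply, Fin.sum_univ_two]
  simp [sl2H]
  rcases i with _ | i <;> rcases j with _ | j <;> simp <;> field_simp <;> ring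

/-- A regular function on the big cell is a polynomial in the entries divided by a power of `c`. -/
theorem exists_mul_pow_eq_evalAt {ψ : bigCell → ℂ} (hψ : IsRegular ψ) :
    ∃ (p : MvPolynomial (Fin 2 × Fin 2) ℂ) (N : ℕ),
      ∀ g : bigCell, (g : SL(2, ℂ)) 1 0 ^ N * ψ g = evalAt g p := by
  -- The ideal of global denominators of `ψ`. By the Nullstellensatz a power of `c` belongs to it
  -- once `c` vanishes on its zero locus.
  let I : Ideal (MvPolynomial (Fin 2 × Fin 2) ℂ) :=
    { carrier := {s | ∃ p, ∀ g : bigCell, evalAt g s * ψ g = evalAt g p}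
      add_mem' := by
        rintro s t ⟨p, hp⟩ ⟨q, hq⟩
        exact ⟨p + q, fun g => by rw [map_add, map_add, add_mul, hp, hq]⟩
      zero_mem' := ⟨0, fun g => by simp⟩
      smul_mem' := by
        rintro r s ⟨p, hp⟩
        exact ⟨r * p, fun g => by rw [smul_eq_mul, map_mul, map_mul, mul_assoc, hp]⟩ }
  have hI : MvPolynomial.X (1, 0) ∈ I.radical := by
    rw [← MvPolynomial.vanishingIdeal_zeroLocus_eq_radical (K := ℂ) I,
      MvPolynomial.mem_vanishingIdeal_iff]
    intro x hx
    rw [MvPolynomial.mem_zeroLocus_iff] at hx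
    rw [MvPolynomial.aeval_X]
    by_contra hne
    -- The polynomial `det - 1` is a denominator, with numerator `0`, so a common zero is a matrix
    -- of determinant one.
    have hdet : x (0, 0) * x (1, 1) - x (0, 1) * x (1, 0) = 1 := by
      have h1 := hx (MvPolynomial.X (0, 0) * MvPolynomial.X (1, 1) -
        MvPolynomial.X (0, 1) * MvPolynomial.X (1, 0) - 1) ⟨0, fun g => by
          have hd := (g : SL(2, ℂ)).det_coe
          rw [Matrix.det_fin_two] at hd
          simp only [map_sub, map_mul, evalAt_X, map_one, map_zero]
          rw [hd, sub_self, zero_mul]⟩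
      simp only [map_sub, map_mul, MvPolynomial.aeval_X, map_one] at h1
      linear_combination h1
    let g : SL(2, ℂ) := ⟨Matrix.of fun i j => x (i, j), by
      rw [Matrix.det_fin_two]; exact hdet⟩
    have hg : g ∈ bigCell := (mem_bigCell_iff g).2 hne
    have hev : ∀ p, evalAt g p = MvPolynomial.aeval x p := fun p => rfl
    obtain ⟨p, q, hq, hpq⟩ := hψ ⟨g, hg⟩
    -- The identity `q ψ = p` is only known where `q ≠ 0`, but `q² ψ = p q` holds on the whole cell,
    -- both sides vanishing with `q`.
    have h2 := hx (q ^ 2) ⟨p * q, fun k => by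
      rw [map_pow, map_mul]
      by_cases hk : evalAt k q = 0
      · rw [hk]; ring
      · rw [hpq k hk]; field_simp⟩
    rw [map_pow, ← hev] at h2
    exact hq (pow_eq_zero_iff two_ne_zero |>.1 h2)
  obtain ⟨N, p, hp⟩ := hI
  exact ⟨p, N, fun g => by rw [← hp g, map_pow, evalAt_X]⟩

/-- The coordinate space of the regular functions, with basis the monomials `a^i d^j c^n`. -/
abbrev Coords : Type := (ℕ × ℕ × ℤ) →₀ ℂ

/-- The regular function with given coordinates. -/
noncomputable def ofCoords : Coords →ₗ[ℂ] regularFunctions :=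
  Finsupp.linearCombination ℂ fun t => monomialReg t.1 t.2.1 t.2.2

theorem ofCoords_surjective : Function.Surjective ofCoords := by
  let S : Submodule ℂ (bigCell → ℂ) :=
    (LinearMap.range ofCoords).map regularFunctions.val.toLinearMap
  have hmono : ∀ i j n, monomialFun i j n ∈ S := fun i j n =>
    ⟨monomialReg i j n, ⟨Finsupp.single (i, j, n) 1, by simp [ofCoords]⟩, rfl⟩
  have hS : S = Submodule.span ℂ (Set.range fun t : ℕ × ℕ × ℤ => monomialFun t.1 t.2.1 t.2.2) := by
    simp only [S, ofCoords, Finsupp.range_linearCombination, Submodule.map_span, ← Set.range_comp]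
    rfl
  have hmul : ∀ (a : bigCell → ℂ), (∀ i j n, a * monomialFun i j n ∈ S) → ∀ φ ∈ S, a * φ ∈ S := by
    intro a ha φ hφ
    have hle : S ≤ S.comap (LinearMap.mulLeft ℂ a) := by
      conv_lhs => rw [hS]
      refine Submodule.span_le.2 ?_
      rintro _ ⟨t, rfl⟩
      exact ha _ _ _
    exact hle hφ
  have hA : ∀ φ ∈ S, (fun g : bigCell => (g : SL(2, ℂ)) 0 0) * φ ∈ S := hmul _ fun i j n => by
    convert hmono (i + 1) j n using 1
    funext g; simp only [monomialFun, Pi.mul_apply]; ring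
  have hD : ∀ φ ∈ S, (fun g : bigCell => (g : SL(2, ℂ)) 1 1) * φ ∈ S := hmul _ fun i j n => by
    convert hmono i (j + 1) n using 1
    funext g; simp only [monomialFun, Pi.mul_apply]; ring
  have hC : ∀ φ ∈ S, (fun g : bigCell => (g : SL(2, ℂ)) 1 0) * φ ∈ S := hmul _ fun i j n => by
    convert hmono i j (n + 1) using 1
    funext g; simp only [monomialFun, Pi.mul_apply, zpow_add_one₀ (coord_ne_zero g)]; ring
  -- The determinant relation eliminates `b = (ad - 1)/c`.
  have hB : ∀ φ ∈ S, (fun g : bigCell => (g : SL(2, ℂ)) 0 1) * φ ∈ S := hmul _ fun i j n => by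
    convert sub_mem (hmono (i + 1) (j + 1) (n - 1)) (hmono i j (n - 1)) using 1
    funext g
    have hd := (g : SL(2, ℂ)).det_coe
    rw [Matrix.det_fin_two] at hd
    have hc := coord_ne_zero g
    simp only [monomialFun, Pi.mul_apply, Pi.sub_apply, zpow_sub_one₀ hc]
    field_simp
    linear_combination (-((g : SL(2, ℂ)) 0 0 ^ i * (g : SL(2, ℂ)) 1 1 ^ j)) * hd
  have hpoly : ∀ (p : MvPolynomial (Fin 2 × Fin 2) ℂ) (N : ℕ),
      (fun g : bigCell => evalAt g p * (g : SL(2, ℂ)) 1 0 ^ (-(N : ℤ))) ∈ S := by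
    intro p N
    induction p using MvPolynomial.induction_on with
    | C a =>
      convert S.smul_mem a (hmono 0 0 (-(N : ℤ))) using 1
      funext g
      simp [monomialFun, evalAt]
    | add p q hp hq =>
      convert add_mem hp hq using 1
      funext g
      simp [add_mul]
    | mul_X p ij hp =>
      have h : (fun g : bigCell => (g : SL(2, ℂ)) ij.1 ij.2) *
          (fun g : bigCell => evalAt g p * (g : SL(2, ℂ)) 1 0 ^ (-(N : ℤ))) ∈ S := by
        obtain ⟨i, j⟩ := ij
        fin_cases i <;> fin_cases j
        · exact hA _ hp
        · exact hB _ hp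
        · exact hC _ hp
        · exact hD _ hp
      convert h using 1
      funext g
      simp only [map_mul, evalAt_X, Pi.mul_apply]
      ring
  intro ψ
  obtain ⟨p, N, hp⟩ := exists_mul_pow_eq_evalAt ψ.2
  obtain ⟨φ, ⟨ξ, rfl⟩, hξ⟩ := hpoly p N
  refine ⟨ξ, Subtype.ext (hξ.trans (funext fun g => ?_))⟩
  have hc := coord_ne_zero g
  simp only [zpow_neg, zpow_natCast]
  rw [← hp g]
  field_simp

end RegularFunctions

/-! ### The map `vartheta` intertwines the two actions -/

section Vartheta

/-- The left action of `g` on functionals on the enveloping algebra. -/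
noncomputable instance dualLieRingModule : LieRingModule sl2 (Module.Dual ℂ Env) :=
  LieRingModule.compLieHom _ (LieHom.inl ℂ sl2 sl2)

instance dualLieModule : LieModule ℂ sl2 (Module.Dual ℂ Env) :=
  LieModule.compLieHom _ (LieHom.inl ℂ sl2 sl2)

theorem lie_left_eq (x : sl2) (φ : Module.Dual ℂ Env) : ⁅((x, 0) : sl2 × sl2), φ⁆ = ⁅x, φ⁆ := rfl

theorem lie_left_apply (x : sl2) (φ : Module.Dual ℂ Env) (u : Env) :
    ⁅x, φ⁆ u = φ (u * envι x) := by
  change dualAct (x, 0) φ u = _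
  rw [dualAct_apply]
  simp

theorem lie_right_apply (y : sl2) (φ : Module.Dual ℂ Env) (u : Env) :
    ⁅((0, y) : sl2 × sl2), φ⁆ u = -φ (envι (omega y) * u) := by
  change dualAct (0, y) φ u = _
  rw [dualAct_apply]
  simp

theorem lie_right_lie_left (x y : sl2) (φ : Module.Dual ℂ Env) :
    ⁅((0, y) : sl2 × sl2), ⁅x, φ⁆⁆ = ⁅x, ⁅((0, y) : sl2 × sl2), φ⁆⁆ := by
  ext u
  rw [lie_right_apply, lie_left_apply, lie_left_apply, lie_right_apply, mul_assoc]

/-- At `w = 1` this recovers `φ(u)` as `(uφ)(1)`, the source of all later presentations of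
functionals as matrix elements. -/
theorem enveloping_dual_apply (u w : Env) (φ : Module.Dual ℂ Env) :
    enveloping (Module.Dual ℂ Env) u φ w = φ (w * u) := by
  induction u using env_induction generalizing φ w with
  | hc c =>
    rw [AlgHom.commutes, Module.algebraMap_end_apply, LinearMap.smul_apply, ← map_smul,
      Algebra.smul_def, Algebra.commutes]
  | hι x => rw [enveloping_envι, lie_left_apply]
  | hmul a b ha hb => rw [map_mul, Module.End.mul_apply, ha, hb, mul_assoc]
  | hadd a b ha hb => rw [map_add, LinearMap.add_apply, LinearMap.add_apply, ha, hb, mul_add, map_add]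

theorem vartheta_apply (ψ : regularFunctions) (u : Env) :
    vartheta ψ u = (leftRegular u ψ : bigCell → ℂ) ⟨w0, w0_mem⟩ := rfl

theorem leftRegular_envι (x : sl2) (ψ : regularFunctions) :
    leftRegular (envι x) ψ = ⁅((x, 0) : sl2 × sl2), ψ⁆ := by
  unfold leftRegular envι
  rw [UniversalEnvelopingAlgebra.lift_ι_apply]
  rfl

theorem leftRegular_lie_right (u : Env) (y : sl2) (ψ : regularFunctions) :
    leftRegular u ⁅((0, y) : sl2 × sl2), ψ⁆ = ⁅((0, y) : sl2 × sl2), leftRegular u ψ⁆ := by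
  induction u using env_induction generalizing ψ with
  | hc c => rw [AlgHom.commutes, Module.algebraMap_end_apply, Module.algebraMap_end_apply, lie_smul]
  | hι x =>
    rw [leftRegular_envι, leftRegular_envι, leibniz_lie]
    have : ⁅((x, 0) : sl2 × sl2), ((0, y) : sl2 × sl2)⁆ = 0 := by
      apply Prod.ext
      · exact lie_zero x
      · exact zero_lie y
    rw [this, zero_lie, zero_add]
  | hmul a b ha hb => rw [map_mul, Module.End.mul_apply, Module.End.mul_apply, hb, ha]
  | hadd a b ha hb => rw [map_add, LinearMap.add_apply, LinearMap.add_apply, ha, hb, lie_add]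

/-- Infinitesimal form of `w0 exp(ty) = exp(t ω(y)) w0`, which holds since conjugation by `w0` is
`ω`; the sign comes from the inverse in the left action. -/
theorem evalAt_w0_vf (y : sl2) (p : MvPolynomial (Fin 2 × Fin 2) ℂ) :
    evalAt w0 (vf 0 y p) = -evalAt w0 (vf (omega y) 0 p) := by
  induction p using MvPolynomial.induction_on with
  | C c => simp [MvPolynomial.derivation_C]
  | add p q hp hq =>
    simp only [map_add, hp, hq]
    ring
  | mul_X p ij hp =>
    have hX : evalAt w0 (vf 0 y (MvPolynomial.X ij)) =
        -evalAt w0 (vf (omega y) 0 (MvPolynomial.X ij)) := by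
      rw [evalAt_vf_X, evalAt_vf_X]
      obtain ⟨i, j⟩ := ij
      have htr : y.1 0 0 + y.1 1 1 = 0 := by
        have := (mem_sl2_iff _).1 y.2
        simpa [Matrix.trace_fin_two] using this
      have ho : ∀ k l, (omega y).1 k l = -y.1 l k := fun _ _ => rfl
      have h00 : w0 0 0 = 0 := rfl
      have h01 : w0 0 1 = -1 := rfl
      have h10 : w0 1 0 = 1 := rfl
      have h11 : w0 1 1 = 0 := rfl
      simp only [Matrix.add_apply, Matrix.neg_apply, Matrix.mul_apply, Fin.sum_univ_two, ho,
        Matrix.zero_apply]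
      fin_cases i <;> fin_cases j <;>
        simp only [Fin.zero_eta, Fin.mk_one, h00, h01, h10, h11]
      · ring
      · linear_combination -htr
      · linear_combination htr
      · ring
    simp only [Derivation.leibniz, smul_eq_mul, map_add, map_mul, hX, hp]
    ring

theorem regAct_w0 (y : sl2) (ψ : regularFunctions) :
    (⁅((0, y) : sl2 × sl2), ψ⁆ : regularFunctions).1 ⟨w0, w0_mem⟩ =
      -(⁅((omega y, 0) : sl2 × sl2), ψ⁆ : regularFunctions).1 ⟨w0, w0_mem⟩ := by
  obtain ⟨p, q, hq, hpq⟩ := ψ.2 ⟨w0, w0_mem⟩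
  change regAct (0, y) ψ.1 _ = -regAct (omega y, 0) ψ.1 _
  rw [regAct_eq _ hpq _ hq, regAct_eq _ hpq _ hq, ← neg_div]
  congr 1
  simp only [map_sub, map_mul, ZeroMemClass.coe_zero, evalAt_w0_vf]
  ring

/-- `vartheta` is a homomorphism of `g ⊕ g`-modules. -/
theorem vartheta_lie (a : sl2 × sl2) (ψ : regularFunctions) :
    vartheta ⁅a, ψ⁆ = ⁅a, vartheta ψ⁆ := by
  have hl : ∀ x : sl2, vartheta ⁅((x, 0) : sl2 × sl2), ψ⁆ = ⁅((x, 0) : sl2 × sl2), vartheta ψ⁆ := by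
    intro x
    ext u
    rw [lie_left_eq, lie_left_apply, vartheta_apply, vartheta_apply, map_mul,
      Module.End.mul_apply, leftRegular_envι]
  have hr : ∀ y : sl2, vartheta ⁅((0, y) : sl2 × sl2), ψ⁆ = ⁅((0, y) : sl2 × sl2), vartheta ψ⁆ := by
    intro y
    ext u
    rw [lie_right_apply, vartheta_apply, vartheta_apply, leftRegular_lie_right, regAct_w0,
      map_mul, Module.End.mul_apply, leftRegular_envι]
  have ha : a = (a.1, 0) + (0, a.2) := by simp
  rw [ha, add_lie, add_lie, map_add, hl, hr]

end Vartheta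

/-! ### Monomial coordinates and injectivity -/

section Coordinates

/-- The functional attached to the regular function with given coordinates. -/
noncomputable def theta : Coords →ₗ[ℂ] Module.Dual ℂ Env :=
  Finsupp.linearCombination ℂ fun t => vartheta (monomialReg t.1 t.2.1 t.2.2)

theorem theta_eq (ξ : Coords) : theta ξ = vartheta (ofCoords ξ) := by
  rw [theta, ofCoords, Finsupp.apply_linearCombination]
  rfl

theorem range_theta : LinearMap.range theta = LinearMap.range vartheta := by
  have : theta = vartheta ∘ₗ ofCoords := LinearMap.ext theta_eq
  rw [this, LinearMap.range_comp_of_range_eq_top _ (LinearMap.range_eq_top.2 ofCoords_surjective)]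

theorem theta_single (t : ℕ × ℕ × ℤ) :
    theta (Finsupp.single t 1) = vartheta (monomialReg t.1 t.2.1 t.2.2) := by
  rw [theta, Finsupp.linearCombination_single, one_smul]

/-- The left action of `e` in coordinates. -/
noncomputable def coordE : Coords →ₗ[ℂ] Coords :=
  Finsupp.linearCombination ℂ fun t =>
    (-(t.1 : ℂ)) • Finsupp.single (t.1 - 1, t.2.1, t.2.2 + 1) (1 : ℂ)

/-- The right action of `e` in coordinates. -/
noncomputable def coordR : Coords →ₗ[ℂ] Coords :=
  Finsupp.linearCombination ℂ fun t =>
    (t.2.1 : ℂ) • Finsupp.single (t.1, t.2.1 - 1, t.2.2 + 1) (1 : ℂ)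

/-- The left action of `h` in coordinates. -/
noncomputable def coordH : Coords →ₗ[ℂ] Coords :=
  Finsupp.linearCombination ℂ fun t =>
    ((t.2.2 : ℂ) + t.2.1 - t.1) • Finsupp.single t (1 : ℂ)

/-- A right inverse of `coordE`. -/
noncomputable def coordEInv : Coords →ₗ[ℂ] Coords :=
  Finsupp.linearCombination ℂ fun t =>
    (-((t.1 : ℂ) + 1)⁻¹) • Finsupp.single (t.1 + 1, t.2.1, t.2.2 - 1) (1 : ℂ)

/-- A right inverse of `coordR`. -/
noncomputable def coordRInv : Coords →ₗ[ℂ] Coords :=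
  Finsupp.linearCombination ℂ fun t =>
    ((t.2.1 : ℂ) + 1)⁻¹ • Finsupp.single (t.1, t.2.1 + 1, t.2.2 - 1) (1 : ℂ)

theorem coordE_single (i j : ℕ) (n : ℤ) : coordE (Finsupp.single (i, j, n) 1) =
    (-(i : ℂ)) • Finsupp.single (i - 1, j, n + 1) (1 : ℂ) := by
  rw [coordE, Finsupp.linearCombination_single, one_smul]

theorem coordR_single (i j : ℕ) (n : ℤ) : coordR (Finsupp.single (i, j, n) 1) =
    (j : ℂ) • Finsupp.single (i, j - 1, n + 1) (1 : ℂ) := by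
  rw [coordR, Finsupp.linearCombination_single, one_smul]

theorem coordH_single (i j : ℕ) (n : ℤ) : coordH (Finsupp.single (i, j, n) 1) =
    ((n : ℂ) + j - i) • Finsupp.single (i, j, n) (1 : ℂ) := by
  rw [coordH, Finsupp.linearCombination_single, one_smul]

theorem coordEInv_single (i j : ℕ) (n : ℤ) : coordEInv (Finsupp.single (i, j, n) 1) =
    (-((i : ℂ) + 1)⁻¹) • Finsupp.single (i + 1, j, n - 1) (1 : ℂ) := by
  rw [coordEInv, Finsupp.linearCombination_single, one_smul]

theorem coordRInv_single (i j : ℕ) (n : ℤ) : coordRInv (Finsupp.single (i, j, n) 1) =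
    ((j : ℂ) + 1)⁻¹ • Finsupp.single (i, j + 1, n - 1) (1 : ℂ) := by
  rw [coordRInv, Finsupp.linearCombination_single, one_smul]

theorem coords_hom_ext {M : Type*} [AddCommGroup M] [Module ℂ M] {f g : Coords →ₗ[ℂ] M}
    (h : ∀ i j n, f (Finsupp.single (i, j, n) 1) = g (Finsupp.single (i, j, n) 1)) (ξ : Coords) :
    f ξ = g ξ := by
  have : f = g := by
    apply Finsupp.lhom_ext'
    rintro ⟨i, j, n⟩
    exact LinearMap.ext_ring (h i j n)
  rw [this]

theorem theta_coordE (ξ : Coords) : theta (coordE ξ) = ⁅sl2E, theta ξ⁆ := by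
  refine coords_hom_ext (f := theta ∘ₗ coordE)
    (g := LieModule.toEnd ℂ sl2 _ sl2E ∘ₗ theta) (fun i j n => ?_) ξ
  rw [LinearMap.comp_apply, LinearMap.comp_apply, coordE_single, map_smul, theta_single,
    theta_single, LieModule.toEnd_apply_apply, ← lie_left_eq, ← vartheta_lie, lie_e_monomialReg,
    map_smul]

theorem theta_coordH (ξ : Coords) : theta (coordH ξ) = ⁅sl2H, theta ξ⁆ := by
  refine coords_hom_ext (f := theta ∘ₗ coordH)
    (g := LieModule.toEnd ℂ sl2 _ sl2H ∘ₗ theta) (fun i j n => ?_) ξ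
  rw [LinearMap.comp_apply, LinearMap.comp_apply, coordH_single, map_smul,
    theta_single, LieModule.toEnd_apply_apply, ← lie_left_eq, ← vartheta_lie, lie_h_monomialReg,
    map_smul]

theorem theta_coordR (ξ : Coords) :
    theta (coordR ξ) = ⁅((0, sl2E) : sl2 × sl2), theta ξ⁆ := by
  refine coords_hom_ext (f := theta ∘ₗ coordR)
    (g := LieModule.toEnd ℂ (sl2 × sl2) _ (0, sl2E) ∘ₗ theta) (fun i j n => ?_) ξ
  rw [LinearMap.comp_apply, LinearMap.comp_apply, coordR_single, map_smul, theta_single,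
    theta_single, LieModule.toEnd_apply_apply, ← vartheta_lie, lie_e_monomialReg_right,
    map_smul]

theorem coordE_coordEInv (ξ : Coords) : coordE (coordEInv ξ) = ξ := by
  refine coords_hom_ext (f := coordE ∘ₗ coordEInv) (g := LinearMap.id) (fun i j n => ?_) ξ
  have h : ((i : ℂ) + 1) ≠ 0 := by exact_mod_cast Nat.succ_ne_zero i
  rw [LinearMap.comp_apply, coordEInv_single, map_smul, coordE_single, smul_smul]
  push_cast
  rw [neg_mul_neg, inv_mul_cancel₀ h, one_smul, sub_add_cancel]
  rfl

theorem coordR_coordRInv (ξ : Coords) : coordR (coordRInv ξ) = ξ := by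
  refine coords_hom_ext (f := coordR ∘ₗ coordRInv) (g := LinearMap.id) (fun i j n => ?_) ξ
  have h : ((j : ℂ) + 1) ≠ 0 := by exact_mod_cast Nat.succ_ne_zero j
  rw [LinearMap.comp_apply, coordRInv_single, map_smul, coordR_single, smul_smul]
  push_cast
  rw [inv_mul_cancel₀ h, one_smul, sub_add_cancel]
  rfl

theorem coordE_coordRInv (ξ : Coords) : coordE (coordRInv ξ) = coordRInv (coordE ξ) := by
  refine coords_hom_ext (f := coordE ∘ₗ coordRInv) (g := coordRInv ∘ₗ coordE) (fun i j n => ?_) ξ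
  simp only [LinearMap.comp_apply, coordRInv_single, coordE_single, map_smul]
  rw [smul_comm, sub_add_cancel, add_sub_cancel_right]

theorem coordE_coordR (ξ : Coords) : coordE (coordR ξ) = coordR (coordE ξ) := by
  refine coords_hom_ext (f := coordE ∘ₗ coordR) (g := coordR ∘ₗ coordE) (fun i j n => ?_) ξ
  simp only [LinearMap.comp_apply, coordR_single, coordE_single, map_smul]
  rw [smul_comm]

theorem coordH_coordRInv (ξ : Coords) : coordH (coordRInv ξ) = coordRInv (coordH ξ) := by
  refine coords_hom_ext (f := coordH ∘ₗ coordRInv) (g := coordRInv ∘ₗ coordH) (fun i j n => ?_) ξ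
  simp only [LinearMap.comp_apply, coordRInv_single, coordH_single, map_smul]
  rw [smul_comm]
  congr 1
  push_cast; ring

theorem coordH_coordEInv (ξ : Coords) :
    coordH (coordEInv ξ) = coordEInv (coordH ξ) - (2 : ℂ) • coordEInv ξ := by
  have h := coords_hom_ext (f := coordH ∘ₗ coordEInv)
    (g := coordEInv ∘ₗ coordH - (2 : ℂ) • coordEInv) (fun i j n => ?_) ξ
  · rwa [LinearMap.sub_apply, LinearMap.smul_apply, LinearMap.comp_apply,
      LinearMap.comp_apply] at h
  rw [LinearMap.sub_apply, LinearMap.smul_apply, LinearMap.comp_apply, LinearMap.comp_apply,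
    coordEInv_single, coordH_single, map_smul, map_smul, coordH_single, coordEInv_single,
    smul_smul, smul_smul, smul_smul, ← sub_smul]
  congr 1
  push_cast
  ring

theorem exists_pow_apply_add_eq_zero {M : Type*} [AddCommGroup M] [Module ℂ M]
    {f : Module.End ℂ M} {x y : M} (hx : ∃ n, (f ^ n) x = 0) (hy : ∃ n, (f ^ n) y = 0) :
    ∃ n, (f ^ n) (x + y) = 0 := by
  obtain ⟨a, ha⟩ := hx
  obtain ⟨b, hb⟩ := hy
  refine ⟨a + b, ?_⟩
  rw [map_add, pow_add, Module.End.mul_apply, Module.End.mul_apply, hb, map_zero,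
    ← Module.End.mul_apply, ← pow_add, add_comm a b, pow_add, Module.End.mul_apply, ha, map_zero,
    add_zero]

theorem exists_coordE_pow (ξ : Coords) : ∃ n, (coordE ^ n) ξ = 0 := by
  induction ξ using Finsupp.induction_linear with
  | zero => exact ⟨0, rfl⟩
  | add f g hf hg => exact exists_pow_apply_add_eq_zero hf hg
  | single t c =>
    obtain ⟨i, j, n⟩ := t
    rw [← mul_one c, ← smul_eq_mul, ← Finsupp.smul_single]
    refine ⟨i + 1, ?_⟩
    rw [map_smul]
    suffices (coordE ^ (i + 1)) (Finsupp.single (i, j, n) 1) = 0 by rw [this, smul_zero]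
    induction i generalizing n with
    | zero => simp [coordE_single]
    | succ i ih =>
      rw [pow_succ, Module.End.mul_apply, coordE_single, map_smul, Nat.add_sub_cancel, ih,
        smul_zero]

theorem exists_coordR_pow (ξ : Coords) : ∃ n, (coordR ^ n) ξ = 0 := by
  induction ξ using Finsupp.induction_linear with
  | zero => exact ⟨0, rfl⟩
  | add f g hf hg => exact exists_pow_apply_add_eq_zero hf hg
  | single t c =>
    obtain ⟨i, j, n⟩ := t
    rw [← mul_one c, ← smul_eq_mul, ← Finsupp.smul_single]
    refine ⟨j + 1, ?_⟩
    rw [map_smul]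
    suffices (coordR ^ (j + 1)) (Finsupp.single (i, j, n) 1) = 0 by rw [this, smul_zero]
    induction j generalizing n with
    | zero => simp [coordR_single]
    | succ j ih =>
      rw [pow_succ, Module.End.mul_apply, coordR_single, map_smul, Nat.add_sub_cancel, ih,
        smul_zero]

/-- The right inverse is also a left inverse on monomials with `i > 0`. Consequently the kernel of
`coordE` is supported on `i = 0`. -/
theorem sub_coordEInv_mem (ξ : Coords) :
    ξ - coordEInv (coordE ξ) ∈ Finsupp.supported ℂ ℂ {t : ℕ × ℕ × ℤ | t.1 = 0} := by
  induction ξ using Finsupp.induction_linear with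
  | zero => simp
  | add f g hf hg =>
    rw [map_add, map_add, add_sub_add_comm]
    exact add_mem hf hg
  | single t c =>
    obtain ⟨i, j, n⟩ := t
    rw [← mul_one c, ← smul_eq_mul, ← Finsupp.smul_single, map_smul, map_smul, ← smul_sub]
    refine Submodule.smul_mem _ _ ?_
    rcases i with _ | i
    · rw [coordE_single]
      simpa using Finsupp.single_mem_supported ℂ (1 : ℂ) (show (0, j, n) ∈ {t : ℕ × ℕ × ℤ | t.1 = 0} from rfl)
    · have h : ((i : ℂ) + 1) ≠ 0 := by exact_mod_cast Nat.succ_ne_zero i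
      have h1 : coordEInv (coordE (Finsupp.single (i + 1, j, n) 1)) =
          Finsupp.single (i + 1, j, n) 1 := by
        rw [coordE_single, map_smul, Nat.add_sub_cancel, coordEInv_single, smul_smul]
        push_cast
        rw [neg_mul_neg, mul_inv_cancel₀ h, one_smul, add_sub_cancel_right]
      rw [h1, sub_self]
      exact zero_mem _

theorem sub_coordRInv_mem (ξ : Coords) :
    ξ - coordRInv (coordR ξ) ∈ Finsupp.supported ℂ ℂ {t : ℕ × ℕ × ℤ | t.2.1 = 0} := by
  induction ξ using Finsupp.induction_linear with
  | zero => simp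
  | add f g hf hg =>
    rw [map_add, map_add, add_sub_add_comm]
    exact add_mem hf hg
  | single t c =>
    obtain ⟨i, j, n⟩ := t
    rw [← mul_one c, ← smul_eq_mul, ← Finsupp.smul_single, map_smul, map_smul, ← smul_sub]
    refine Submodule.smul_mem _ _ ?_
    rcases j with _ | j
    · rw [coordR_single]
      simpa using Finsupp.single_mem_supported ℂ (1 : ℂ) (show (i, 0, n) ∈ {t : ℕ × ℕ × ℤ | t.2.1 = 0} from rfl)
    · have h : ((j : ℂ) + 1) ≠ 0 := by exact_mod_cast Nat.succ_ne_zero j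
      have h1 : coordRInv (coordR (Finsupp.single (i, j + 1, n) 1)) =
          Finsupp.single (i, j + 1, n) 1 := by
        rw [coordR_single, map_smul, Nat.add_sub_cancel, coordRInv_single, smul_smul]
        push_cast
        rw [mul_inv_cancel₀ h, one_smul, add_sub_cancel_right]
      rw [h1, sub_self]
      exact zero_mem _

theorem vartheta_monomialReg_one (n : ℤ) : vartheta (monomialReg 0 0 n) 1 = 1 := by
  rw [vartheta_apply, map_one]
  change monomialFun 0 0 n _ = 1
  simp [monomialFun, w0]

theorem vartheta_monomialReg_mem (i j : ℕ) (n : ℤ) : vartheta (monomialReg i j n) ∈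
    hWeightSpace (Module.Dual ℂ Env) (((n + j - i : ℤ)) : ℂ) := by
  change ⁅sl2H, _⁆ = _
  rw [← lie_left_eq, ← vartheta_lie, lie_h_monomialReg, map_smul]
  push_cast
  rfl

/-- The common kernel of both operators `e` is spanned by powers of `c`. Their functionals have
distinct left weights and take the value `1` at `1`, so they are linearly independent. -/
theorem theta_injective_aux {ξ : Coords} (hξ : theta ξ = 0) (hE : coordE ξ = 0)
    (hR : coordR ξ = 0) : ξ = 0 := by
  have h1 := sub_coordEInv_mem ξ
  have h2 := sub_coordRInv_mem ξ
  rw [hE, map_zero, sub_zero] at h1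
  rw [hR, map_zero, sub_zero] at h2
  let s : Set (ℕ × ℕ × ℤ) := {t | t.1 = 0} ∩ {t | t.2.1 = 0}
  have h3 : ξ ∈ Finsupp.supported ℂ ℂ s := by
    rw [Finsupp.supported_inter]
    exact ⟨h1, h2⟩
  have hs : ∀ t ∈ s, t = (0, 0, t.2.2) := fun t ht => Prod.ext ht.1 (Prod.ext ht.2 rfl)
  have hli : LinearIndepOn ℂ (fun t : ℕ × ℕ × ℤ => vartheta (monomialReg t.1 t.2.1 t.2.2)) s := by
    refine Module.End.eigenvectors_linearIndependent'
      (LieModule.toEnd ℂ sl2 (Module.Dual ℂ Env) sl2H) (fun t : s => ((t.1.2.2 : ℤ) : ℂ)) ?_ _ ?_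
    · rintro ⟨t, ht⟩ ⟨t', ht'⟩ h
      have hn : t.2.2 = t'.2.2 := Int.cast_injective h
      exact Subtype.ext ((hs t ht).trans (hn ▸ (hs t' ht').symm))
    · rintro ⟨t, ht⟩
      have h1 : vartheta (monomialReg t.1 t.2.1 t.2.2) = vartheta (monomialReg 0 0 t.2.2) := by
        rw [hs t ht]
      refine ⟨?_, fun h0 => ?_⟩
      · change vartheta (monomialReg t.1 t.2.1 t.2.2) ∈ _
        have h2 := vartheta_monomialReg_mem 0 0 t.2.2
        rw [hWeightSpace_eq_eigenspace] at h2
        rw [h1]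
        simpa using h2
      · have h2 : vartheta (monomialReg t.1 t.2.1 t.2.2) = 0 := h0
        have h3 := vartheta_monomialReg_one t.2.2
        rw [← h1, h2] at h3
        simp at h3
  exact linearIndepOn_iff.1 hli ξ h3 hξ

/-- The kernel of `theta` is stable under both locally nilpotent operators `e`. Peeling off their
powers, first on the right and then on the left, reduces to their common kernel. -/
theorem theta_injective : Function.Injective theta := by
  refine (injective_iff_map_eq_zero theta).2 fun ξ hξ => ?_
  have h1 : ∀ n, ∀ ξ : Coords, theta ξ = 0 → coordE ξ = 0 → (coordR ^ n) ξ = 0 → ξ = 0 := by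
    intro n
    induction n with
    | zero => exact fun ξ _ _ h => h
    | succ n ih =>
      intro ξ h0 hE hR
      rw [pow_succ, Module.End.mul_apply] at hR
      refine theta_injective_aux h0 hE (ih _ ?_ ?_ hR)
      · rw [theta_coordR, h0, lie_zero]
      · rw [coordE_coordR, hE, map_zero]
  have h2 : ∀ n, ∀ ξ : Coords, theta ξ = 0 → (coordE ^ n) ξ = 0 → ξ = 0 := by
    intro n
    induction n with
    | zero => exact fun ξ _ h => h
    | succ n ih =>
      intro ξ h0 hE
      rw [pow_succ, Module.End.mul_apply] at hE
      obtain ⟨k, hk⟩ := exists_coordR_pow ξ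
      exact h1 k ξ h0 (ih _ (by rw [theta_coordE, h0, lie_zero]) hE) hk
  obtain ⟨n, hn⟩ := exists_coordE_pow ξ
  exact h2 n ξ hξ hn

theorem vartheta_injective : Function.Injective vartheta := by
  refine (injective_iff_map_eq_zero vartheta).2 fun ψ hψ => ?_
  obtain ⟨ξ, rfl⟩ := ofCoords_surjective ψ
  rw [← theta_eq] at hψ
  rw [theta_injective (hψ.trans (map_zero theta).symm), map_zero]

end Coordinates

/-! ### Functionals that come from regular functions -/

section Image

/-- The `ν`-eigenspace of the right action of `y`, a submodule for the left action. -/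
def rightEigen (y : sl2) (ν : ℂ) : LieSubmodule ℂ sl2 (Module.Dual ℂ Env) where
  carrier := {φ | ⁅((0, y) : sl2 × sl2), φ⁆ = ν • φ}
  add_mem' := by
    intro φ χ hφ hχ
    simp only [Set.mem_ofPred_eq] at *
    rw [lie_add, hφ, hχ, smul_add]
  zero_mem' := by simp
  smul_mem' := by
    intro c φ hφ
    simp only [Set.mem_ofPred_eq] at *
    rw [lie_smul, hφ, smul_comm]
  lie_mem := by
    intro x φ hφ
    change ⁅((0, y) : sl2 × sl2), φ⁆ = ν • φ at hφ
    change ⁅((0, y) : sl2 × sl2), ⁅x, φ⁆⁆ = ν • ⁅x, φ⁆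
    rw [lie_right_lie_left, hφ, lie_smul]

theorem mem_rightEigen {y : sl2} {ν : ℂ} {φ : Module.Dual ℂ Env} :
    φ ∈ rightEigen y ν ↔ ⁅((0, y) : sl2 × sl2), φ⁆ = ν • φ := Iff.rfl

theorem right_e_apply (φ : Module.Dual ℂ Env) (u : Env) :
    ⁅((0, sl2E) : sl2 × sl2), φ⁆ u = φ (envι sl2F * u) := by
  rw [lie_right_apply, omega_e, map_neg, neg_mul, map_neg, neg_neg]

theorem right_e_pow_lie_left (k : ℕ) (x : sl2) (φ : Module.Dual ℂ Env) :
    ((LieModule.toEnd ℂ (sl2 × sl2) (Module.Dual ℂ Env) (0, sl2E)) ^ k) ⁅x, φ⁆ =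
      ⁅x, ((LieModule.toEnd ℂ (sl2 × sl2) (Module.Dual ℂ Env) (0, sl2E)) ^ k) φ⁆ := by
  induction k with
  | zero => rfl
  | succ k ih =>
    rw [pow_succ', Module.End.mul_apply, Module.End.mul_apply, ih, LieModule.toEnd_apply_apply,
      lie_right_lie_left, LieModule.toEnd_apply_apply]

theorem right_h_apply (φ : Module.Dual ℂ Env) (u : Env) :
    ⁅((0, sl2H) : sl2 × sl2), φ⁆ u = φ (envι sl2H * u) := by
  rw [lie_right_apply, omega_h, map_neg, neg_mul, map_neg, neg_neg]

/-- A functional that is a highest weight vector on both sides is determined by its value at `1`. -/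
theorem eq_zero_of_highestWeight {μ : ℂ} {φ : Module.Dual ℂ Env} (hφ : φ ∈ hWeightSpace _ μ)
    (he : ⁅sl2E, φ⁆ = 0) (hr : ⁅((0, sl2E) : sl2 × sl2), φ⁆ = 0) (h1 : φ 1 = 0) : φ = 0 := by
  by_contra hne
  have hcas : casimir _ φ = (μ + 1) ^ 2 • φ := by
    rw [casimir_of_mem_hWeightSpace hφ, he, lie_zero, smul_zero, zero_add]
  have hq : ∀ q : Polynomial ℂ, aeval (casimir (Module.Dual ℂ Env)) q φ =
      q.eval ((μ + 1) ^ 2) • φ := fun q =>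
    Module.End.aeval_apply_of_hasEigenvector ⟨Module.End.mem_eigenspace_iff.2 hcas, hne⟩
  -- Right multiplication by `f` evaluated at `1` equals left multiplication by `f` at `1`, and the
  -- latter is the right action of `e`. So every positive power of `f` applied to `φ` vanishes at
  -- `1`.
  have hF : ∀ χ ∈ rightEigen sl2E 0, ⁅sl2F, χ⁆ 1 = 0 := by
    intro χ hχ
    rw [lie_left_apply, one_mul, ← mul_one (envι sl2F), ← right_e_apply, mem_rightEigen.1 hχ,
      zero_smul, LinearMap.zero_apply]
  have hφr : φ ∈ rightEigen sl2E 0 := by rw [mem_rightEigen, hr, zero_smul]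
  have hle : Submodule.span ℂ {y : Module.Dual ℂ Env | ∃ (i : ℕ) (q : Polynomial ℂ),
      y = ((LieModule.toEnd ℂ sl2 (Module.Dual ℂ Env) sl2F) ^ i) (aeval (casimir _) q φ) ∨
      y = ((LieModule.toEnd ℂ sl2 (Module.Dual ℂ Env) sl2E) ^ i) (aeval (casimir _) q φ)} ≤
      LinearMap.ker (LinearMap.applyₗ (1 : Env) : Module.Dual ℂ Env →ₗ[ℂ] ℂ) := by
    refine Submodule.span_le.2 ?_
    rintro y ⟨i, q, rfl | rfl⟩
    · change (((LieModule.toEnd ℂ sl2 (Module.Dual ℂ Env) sl2F) ^ i) _) 1 = 0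
      rw [hq, map_smul, LinearMap.smul_apply]
      cases i with
      | zero => rw [pow_zero, Module.End.one_apply, h1, smul_zero]
      | succ i =>
        rw [pow_succ' _ i, Module.End.mul_apply, LieModule.toEnd_apply_apply, hF, smul_zero]
        induction i with
        | zero => exact hφr
        | succ i ih =>
          rw [pow_succ', Module.End.mul_apply]
          exact (rightEigen sl2E 0).lie_mem ih
    · change (((LieModule.toEnd ℂ sl2 (Module.Dual ℂ Env) sl2E) ^ i) _) 1 = 0
      rw [hq, map_smul, LinearMap.smul_apply]
      cases i with
      | zero => rw [pow_zero, Module.End.one_apply, h1, smul_zero]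
      | succ i => rw [e_pow_succ_apply, he, map_zero, LinearMap.zero_apply, smul_zero]
  apply hne
  ext u
  have h2 := hle (lieSpan_le_span_of_mem_hWeightSpace hφ
    (enveloping_mem _ u φ (LieSubmodule.subset_lieSpan rfl)))
  have h3 : enveloping (Module.Dual ℂ Env) u φ 1 = 0 := h2
  rwa [enveloping_dual_apply, one_mul] at h3

theorem coordH_eq_smul {ξ : Coords} {μ : ℂ} (h : theta ξ ∈ hWeightSpace _ μ) :
    coordH ξ = μ • ξ := by
  apply theta_injective
  rw [theta_coordH, map_smul]
  exact h

theorem theta_mem_hWeightSpace {ξ : Coords} {μ : ℂ} (h : coordH ξ = μ • ξ) :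
    theta ξ ∈ hWeightSpace _ μ := by
  change ⁅sl2H, theta ξ⁆ = _
  rw [← theta_coordH, h, map_smul]

/-- Induction on the right nilpotency order: `e φ` on the right comes from a function, and
`coordRInv` supplies a function with the same right `e`-image that is still killed by left `e`. The
difference is a highest weight vector on both sides, hence a multiple of the functional of `c^μ`;
integrality of `μ` is what makes `c^μ` available. -/
theorem mem_range_theta_of_highestWeight {μ : ℤ} {k : ℕ} {φ : Module.Dual ℂ Env}
    (hφ : φ ∈ hWeightSpace _ (μ : ℂ)) (he : ⁅sl2E, φ⁆ = 0)
    (hr : ((LieModule.toEnd ℂ (sl2 × sl2) (Module.Dual ℂ Env) (0, sl2E)) ^ k) φ = 0) :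
    φ ∈ LinearMap.range theta := by
  induction k generalizing φ with
  | zero =>
    have h0 : φ = 0 := hr
    rw [h0]
    exact zero_mem _
  | succ k ih =>
    rw [pow_succ, Module.End.mul_apply, LieModule.toEnd_apply_apply] at hr
    have hw : ⁅((0, sl2E) : sl2 × sl2), φ⁆ ∈ hWeightSpace _ (μ : ℂ) := by
      have hφ' : ⁅sl2H, φ⁆ = (μ : ℂ) • φ := hφ
      change ⁅sl2H, ⁅((0, sl2E) : sl2 × sl2), φ⁆⁆ = _
      rw [← lie_right_lie_left, hφ', lie_smul]
    have he' : ⁅sl2E, ⁅((0, sl2E) : sl2 × sl2), φ⁆⁆ = 0 := by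
      rw [← lie_right_lie_left, he, lie_zero]
    obtain ⟨ξ, hξ⟩ := ih hw he' hr
    have hE : coordE ξ = 0 := theta_injective (by rw [theta_coordE, hξ, he', map_zero])
    have hH : coordH ξ = (μ : ℂ) • ξ := coordH_eq_smul (by rw [hξ]; exact hw)
    set χ := φ - theta (coordRInv ξ) with hχ
    have hχw : χ ∈ hWeightSpace _ (μ : ℂ) := sub_mem hφ (theta_mem_hWeightSpace (by
      rw [coordH_coordRInv, hH, map_smul]))
    have hχe : ⁅sl2E, χ⁆ = 0 := by
      rw [hχ, lie_sub, he, ← theta_coordE, coordE_coordRInv, hE, map_zero, map_zero, sub_zero]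
    have hχr : ⁅((0, sl2E) : sl2 × sl2), χ⁆ = 0 := by
      rw [hχ, lie_sub, ← theta_coordR, coordR_coordRInv, hξ, sub_self]
    have hmono : vartheta (monomialReg 0 0 μ) ∈ LinearMap.range theta :=
      ⟨Finsupp.single (0, 0, μ) 1, theta_single _⟩
    have hmw : vartheta (monomialReg 0 0 μ) ∈ hWeightSpace _ (μ : ℂ) := by
      simpa using vartheta_monomialReg_mem 0 0 μ
    have hme : ⁅sl2E, vartheta (monomialReg 0 0 μ)⁆ = 0 := by
      rw [← lie_left_eq, ← vartheta_lie, lie_e_monomialReg]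
      simp
    have hmr : ⁅((0, sl2E) : sl2 × sl2), vartheta (monomialReg 0 0 μ)⁆ = 0 := by
      rw [← vartheta_lie, lie_e_monomialReg_right]
      simp
    have h0 : χ - χ 1 • vartheta (monomialReg 0 0 μ) = 0 := by
      refine eq_zero_of_highestWeight (sub_mem hχw (Submodule.smul_mem _ _ hmw)) ?_ ?_ ?_
      · rw [lie_sub, lie_smul, hme, hχe, smul_zero, sub_zero]
      · rw [lie_sub, lie_smul, hmr, hχr, smul_zero, sub_zero]
      · rw [LinearMap.sub_apply, LinearMap.smul_apply, vartheta_monomialReg_one, smul_eq_mul,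
          mul_one, sub_self]
    have hφeq : φ = χ 1 • vartheta (monomialReg 0 0 μ) + theta (coordRInv ξ) := by
      rw [← sub_eq_zero.1 h0, hχ, sub_add_cancel]
    rw [hφeq]
    exact add_mem (Submodule.smul_mem _ _ hmono) ⟨_, rfl⟩

/-- The functionals of integral left weight that are nilpotent under `e` on both sides come from
regular functions. -/
theorem mem_range_theta {μ : ℤ} {n k : ℕ} {φ : Module.Dual ℂ Env}
    (hφ : φ ∈ hWeightSpace _ (μ : ℂ))
    (he : ((LieModule.toEnd ℂ sl2 (Module.Dual ℂ Env) sl2E) ^ n) φ = 0)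
    (hr : ((LieModule.toEnd ℂ (sl2 × sl2) (Module.Dual ℂ Env) (0, sl2E)) ^ k) φ = 0) :
    φ ∈ LinearMap.range theta := by
  induction n generalizing φ μ with
  | zero =>
    have h0 : φ = 0 := he
    rw [h0]
    exact zero_mem _
  | succ n ih =>
    rw [e_pow_succ_apply] at he
    have hw : ⁅sl2E, φ⁆ ∈ hWeightSpace _ (((μ + 2 : ℤ)) : ℂ) := by
      have := hWeightSpace_e _ hφ
      rw [Int.cast_add, Int.cast_ofNat]
      exact this
    obtain ⟨ξ, hξ⟩ := ih hw he (by rw [right_e_pow_lie_left, hr, lie_zero])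
    have hH : coordH ξ = ((μ + 2 : ℤ) : ℂ) • ξ := coordH_eq_smul (by rw [hξ]; exact hw)
    have htw : theta (coordEInv ξ) ∈ hWeightSpace _ (μ : ℂ) := theta_mem_hWeightSpace (by
      rw [coordH_coordEInv, hH, map_smul, ← sub_smul]
      congr 1
      push_cast; ring)
    have hte : ⁅sl2E, theta (coordEInv ξ)⁆ = ⁅sl2E, φ⁆ := by
      rw [← theta_coordE, coordE_coordEInv, hξ]
    -- Subtracting the correction term must preserve right nilpotency, so the term has to be right
    -- nilpotent too.
    obtain ⟨b, hb⟩ : ∃ b, ((LieModule.toEnd ℂ (sl2 × sl2) (Module.Dual ℂ Env) (0, sl2E)) ^ b)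
        (theta (coordEInv ξ)) = 0 := by
      obtain ⟨b, hb⟩ := exists_coordR_pow (coordEInv ξ)
      refine ⟨b, ?_⟩
      have : ∀ (b : ℕ) (ζ : Coords),
          ((LieModule.toEnd ℂ (sl2 × sl2) (Module.Dual ℂ Env) (0, sl2E)) ^ b) (theta ζ) =
          theta ((coordR ^ b) ζ) := by
        intro b
        induction b with
        | zero => exact fun _ => rfl
        | succ b ihb =>
          intro ζ
          rw [pow_succ, pow_succ, Module.End.mul_apply, Module.End.mul_apply,
            LieModule.toEnd_apply_apply, ← theta_coordR, ihb]
      rw [this, hb, map_zero]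
    obtain ⟨c, hc⟩ := exists_pow_apply_add_eq_zero ⟨k, hr⟩
      (⟨b, by rw [map_neg, hb, neg_zero]⟩ : ∃ b,
        ((LieModule.toEnd ℂ (sl2 × sl2) (Module.Dual ℂ Env) (0, sl2E)) ^ b)
        (-theta (coordEInv ξ)) = 0)
    have h1 := mem_range_theta_of_highestWeight (φ := φ + -theta (coordEInv ξ))
      (add_mem hφ (neg_mem htw)) (by rw [lie_add, lie_neg, hte, add_neg_cancel]) hc
    have h2 := add_mem h1 (⟨_, rfl⟩ : theta (coordEInv ξ) ∈ LinearMap.range theta)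
    simpa using h2

end Image

/-! ### Matrix elements of projective covers -/

section MatrixElements

variable {V : Type} [AddCommGroup V] [Module ℂ V] [LieRingModule sl2 V] [LieModule ℂ sl2 V]

/-- The matrix elements of a fixed functional, as a homomorphism for the left action. -/
noncomputable def matrixHom (k : RestrictedDual V) : V →ₗ⁅ℂ,sl2⁆ Module.Dual ℂ Env where
  toFun v := matrixElement V v k
  map_add' v w := by ext u; simp [matrixElement_apply]
  map_smul' c v := by ext u; simp [matrixElement_apply]
  map_lie' := by
    intro x v
    ext u
    change matrixElement V ⁅x, v⁆ k u = ⁅x, matrixElement V v k⁆ u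
    rw [lie_left_apply, matrixElement_apply, matrixElement_apply, map_mul, Module.End.mul_apply,
      enveloping_envι]

theorem matrixHom_apply (k : RestrictedDual V) (v : V) : matrixHom k v = matrixElement V v k := rfl

theorem matrixElements_le {M : Submodule ℂ (Module.Dual ℂ Env)}
    (h : ∀ (k : RestrictedDual V) (v : V), matrixElement V v k ∈ M) : matrixElements V ≤ M := by
  refine Submodule.span_le.2 ?_
  rintro _ ⟨v, k, rfl⟩
  exact h k v

theorem matrixElement_mem (v : V) (k : RestrictedDual V) :
    matrixElement V v k ∈ matrixElements V := Submodule.subset_span ⟨v, k, rfl⟩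

theorem lie_mem_matrixElements (x : sl2) {φ : Module.Dual ℂ Env} (hφ : φ ∈ matrixElements V) :
    ⁅x, φ⁆ ∈ matrixElements V := by
  have hle : matrixElements V ≤ (matrixElements V).comap
      (LieModule.toEnd ℂ sl2 (Module.Dual ℂ Env) x) := by
    refine matrixElements_le fun k v => ?_
    change ⁅x, matrixHom k v⁆ ∈ matrixElements V
    rw [← LieModuleHom.map_lie]
    exact matrixElement_mem _ k
  exact hle hφ

/-- The generator of the isomorphic module `BigProjective m` satisfies `(Casimir - m²)² = 0`, and
blocks are submodules. -/
theorem mem_casimirBlock_of_isProjectiveCover {m : ℕ}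
    (hV : IsProjectiveCover V (-(m : ℂ) - 1)) (x : V) :
    x ∈ (casimir V).maxGenEigenspace ((m : ℂ) ^ 2) := by
  obtain ⟨g, s, hgs, -⟩ := exists_equiv_bigProjective hV
  let N : LieSubmodule ℂ sl2 (BigProjective m) :=
    { (casimir (BigProjective m)).maxGenEigenspace ((m : ℂ) ^ 2) with
      lie_mem := fun {y _} hx => lie_mem_casimirBlock y hx }
  have hN : N = ⊤ := by
    refine eq_top_iff.2 (lieSpan_bigGenerator m ▸ LieSubmodule.lieSpan_le.2 ?_)
    rintro x rfl
    exact mem_casimirBlock_of_aeval (aeval_casimir_bigGenerator m)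
  rw [← hgs x]
  exact map_mem_casimirBlock g (hN ▸ LieSubmodule.mem_top (s x) : s x ∈ N)

theorem matrixElements_le_casimirBlock {m : ℕ} (hV : IsProjectiveCover V (-(m : ℂ) - 1)) :
    matrixElements V ≤ (casimir (Module.Dual ℂ Env)).maxGenEigenspace ((m : ℂ) ^ 2) :=
  matrixElements_le fun k v =>
    map_mem_casimirBlock (matrixHom k) (mem_casimirBlock_of_isProjectiveCover hV v)

theorem right_e_pow_apply (N : ℕ) (φ : Module.Dual ℂ Env) (u : Env) :
    ((LieModule.toEnd ℂ (sl2 × sl2) (Module.Dual ℂ Env) (0, sl2E)) ^ N) φ u =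
      φ (envι sl2F ^ N * u) := by
  induction N generalizing φ with
  | zero => simp
  | succ N ih =>
    rw [pow_succ, Module.End.mul_apply, ih, LieModule.toEnd_apply_apply, right_e_apply, pow_succ',
      mul_assoc]

/-- The weights of a projective cover are integral and bounded above. -/
theorem weight_of_isProjectiveCover {m : ℕ} (hV : IsProjectiveCover V (-(m : ℂ) - 1)) {μ : ℂ}
    {x : V} (hx : x ∈ hWeightSpace V μ) (hx0 : x ≠ 0) :
    ∃ z : ℤ, μ = z ∧ z ≤ (m : ℤ) - 1 := by
  obtain ⟨n, hn⟩ := hV.1.1.locallyNilpotent x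
  obtain ⟨j, -, hj⟩ := exists_eq_sq_of_mem_casimirBlock hx0 hx hn
    (mem_casimirBlock_of_isProjectiveCover hV x)
  rcases sq_eq_sq_iff_eq_or_eq_neg.1 hj with h | h
  · refine ⟨m - 1 - 2 * j, ?_, by omega⟩
    push_cast
    linear_combination -h
  · refine ⟨-m - 1 - 2 * j, ?_, by omega⟩
    push_cast
    linear_combination h

/-- Weights of the cover are bounded above and `k` sees only finitely many of them, so enough
applications of `f` push every vector below the support of `k`. On matrix elements this is right
nilpotency of `e`. -/
theorem exists_f_pow_eq_zero {m : ℕ} (hV : IsProjectiveCover V (-(m : ℂ) - 1))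
    (k : RestrictedDual V) : ∃ N : ℕ, ∀ x : V,
      RestrictedDual.toDual V k (((LieModule.toEnd ℂ sl2 V sl2F) ^ N) x) = 0 := by
  have hfin : (hSupport V (RestrictedDual.toDual V k)).Finite := k.2
  obtain ⟨b, hb⟩ := (hfin.image Complex.re).bddBelow
  -- A weight `z ≤ m-1` becomes `z - 2N`, which is less than the lower bound `b` of the support.
  obtain ⟨N, hN⟩ := exists_nat_gt ((m : ℝ) - 1 - b)
  refine ⟨N, fun x => ?_⟩
  have hx : x ∈ ⨆ μ, hWeightSpace V μ := hV.1.1.iSup_hWeightSpace ▸ Submodule.mem_top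
  have hle : (⨆ μ, hWeightSpace V μ) ≤ LinearMap.ker
      ((RestrictedDual.toDual V k).comp ((LieModule.toEnd ℂ sl2 V sl2F) ^ N)) := by
    refine iSup_le fun μ y hy => ?_
    by_contra hne
    have hne' : RestrictedDual.toDual V k (((LieModule.toEnd ℂ sl2 V sl2F) ^ N) y) ≠ 0 := hne
    have hy0 : y ≠ 0 := by
      rintro rfl
      exact hne' (by rw [map_zero, map_zero])
    obtain ⟨z, rfl, hz⟩ := weight_of_isProjectiveCover hV hy hy0
    have h1 : (z : ℂ) - 2 * N ∈ hSupport V (RestrictedDual.toDual V k) :=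
      ⟨_, f_pow_mem_hWeightSpace hy N, hne'⟩
    have h2 := hb (Set.mem_image_of_mem Complex.re h1)
    have h3 : ((z : ℂ) - 2 * N).re = (z : ℝ) - 2 * N := by simp
    rw [h3] at h2
    have h4 : (z : ℝ) ≤ (m : ℝ) - 1 := by exact_mod_cast hz
    have h5 : (0 : ℝ) ≤ N := Nat.cast_nonneg N
    linarith
  exact hle hx

/-- Integral weights and `e`-nilpotency of `V` give the left conditions of `mem_range_theta`. The
right condition holds since the right action of `e^N` replaces `k` by `k ∘ f^N`. -/
theorem matrixElements_le_range {m : ℕ} (hV : IsProjectiveCover V (-(m : ℂ) - 1)) :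
    matrixElements V ≤ LinearMap.range vartheta := by
  rw [← range_theta]
  refine matrixElements_le fun k v => ?_
  have hv : v ∈ ⨆ μ, hWeightSpace V μ := hV.1.1.iSup_hWeightSpace ▸ Submodule.mem_top
  have hle : (⨆ μ, hWeightSpace V μ) ≤
      (LinearMap.range theta).comap (matrixHom k : V →ₗ[ℂ] Module.Dual ℂ Env) := by
    refine iSup_le fun μ y hy => ?_
    by_cases hy0 : y = 0
    · rw [hy0]; exact zero_mem _
    obtain ⟨z, rfl, -⟩ := weight_of_isProjectiveCover hV hy hy0
    obtain ⟨n, hn⟩ := hV.1.1.locallyNilpotent y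
    obtain ⟨N, hN⟩ := exists_f_pow_eq_zero hV k
    refine mem_range_theta (n := n) (k := N) (map_mem_hWeightSpace (matrixHom k) hy) ?_ ?_
    · rw [LieModuleHom.coe_toLinearMap, ← map_e_pow, hn, map_zero]
    · ext u
      rw [right_e_pow_apply, LieModuleHom.coe_toLinearMap, matrixHom_apply, matrixElement_apply,
        map_mul, Module.End.mul_apply, map_pow, enveloping_envι_eq, hN, LinearMap.zero_apply]
  exact hle hv

/-- By the universal property `φ` is the image of the generator under some `p`, so `φ(u)` is the
value at `1` of `p` on `u` times the generator. Evaluation of `p` at `1` is thus the required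
functional, once it is known to lie in the restricted dual. -/
theorem mem_matrixElements_of_antidominant {m n : ℕ} (hV : IsProjectiveCover V (-(m : ℂ) - 1))
    {ν : ℂ} {φ : Module.Dual ℂ Env} (hφ : φ ∈ hWeightSpace _ (-(m : ℂ) - 1))
    (hr : φ ∈ rightEigen sl2H ν)
    (hn : ((LieModule.toEnd ℂ sl2 (Module.Dual ℂ Env) sl2E) ^ n) φ = 0)
    (hc : φ ∈ (casimir (Module.Dual ℂ Env)).maxGenEigenspace ((m : ℂ) ^ 2)) :
    φ ∈ matrixElements V := by
  obtain ⟨g, s, -, hsg⟩ := exists_equiv_bigProjective hV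
  obtain ⟨p, hp⟩ := exists_hom_bigProjective_of_mem_casimirBlock hφ hn hc
  have hpr : ∀ y, p y ∈ rightEigen sl2H ν := by
    have hle : LieSubmodule.lieSpan ℂ sl2 {bigGenerator m} ≤ (rightEigen sl2H ν).comap p := by
      refine LieSubmodule.lieSpan_le.2 ?_
      rintro x rfl
      change p (bigGenerator m) ∈ rightEigen sl2H ν
      rwa [hp]
    exact fun y => hle (lieSpan_bigGenerator m ▸ LieSubmodule.mem_top y)
  let k₀ : Module.Dual ℂ V := (LinearMap.applyₗ (1 : Env)).comp ((p.comp s : V →ₗ⁅ℂ,sl2⁆ _) :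
    V →ₗ[ℂ] Module.Dual ℂ Env)
  have hk₀ : ∀ x, k₀ x = p (s x) 1 := fun _ => rfl
  -- The left and right actions of `h` agree after evaluation at `1`. As the image of `p` has right
  -- weight `ν`, the functional is supported on the single weight `ν`.
  have hsupp : k₀ ∈ restrictedDualSubmodule V := by
    refine (Set.finite_singleton ν).subset ?_
    rintro μ ⟨x, hx, hne⟩
    have h1 : ⁅sl2H, p (s x)⁆ = μ • p (s x) := map_mem_hWeightSpace p (map_mem_hWeightSpace s hx)
    have h2 := mem_rightEigen.1 (hpr (s x))
    have h3 : ⁅sl2H, p (s x)⁆ 1 = ⁅((0, sl2H) : sl2 × sl2), p (s x)⁆ 1 := by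
      rw [lie_left_apply, right_h_apply, one_mul, mul_one]
    rw [h1, h2, LinearMap.smul_apply, LinearMap.smul_apply] at h3
    rw [hk₀] at hne
    exact mul_right_cancel₀ hne h3
  have hφeq : φ = matrixElement V (g (bigGenerator m)) ⟨k₀, hsupp⟩ := by
    ext u
    change φ u = k₀ (enveloping V u (g (bigGenerator m)))
    rw [hk₀, map_enveloping, map_enveloping, hsg, hp, enveloping_dual_apply, one_mul]
  rw [hφeq]
  exact matrixElement_mem _ _

/-- Induction on the depth `t` below `-m-1`. There are no highest weight vectors of these lower
weights in the block, so `fe` is invertible and `φ` is `f` applied to a functional of the next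
higher weight, up to a scalar. -/
theorem mem_matrixElements {m n t : ℕ} (hV : IsProjectiveCover V (-(m : ℂ) - 1))
    {ν : ℂ} {φ : Module.Dual ℂ Env} (hφ : φ ∈ hWeightSpace _ (-(m : ℂ) - 1 - 2 * t))
    (hr : φ ∈ rightEigen sl2H ν)
    (hn : ((LieModule.toEnd ℂ sl2 (Module.Dual ℂ Env) sl2E) ^ n) φ = 0)
    (hc : φ ∈ (casimir (Module.Dual ℂ Env)).maxGenEigenspace ((m : ℂ) ^ 2)) :
    φ ∈ matrixElements V := by
  induction t generalizing φ n with
  | zero => exact mem_matrixElements_of_antidominant hV (by simpa using hφ) hr hn hc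
  | succ t ih =>
    set μ : ℂ := -(m : ℂ) - 1 - 2 * ((t + 1 : ℕ) : ℂ) with hμ
    -- Here `(μ+1)² = (m + 2(t+1))²` differs from `m²`, so `4fe = Casimir - (μ+1)²` is invertible on
    -- the block.
    have hev : (X - C ((μ + 1) ^ 2) : Polynomial ℂ).eval ((m : ℂ) ^ 2) ≠ 0 := by
      rw [Polynomial.eval_sub, Polynomial.eval_X, Polynomial.eval_C, sub_ne_zero]
      intro h
      have h1 : (m : ℂ) ^ 2 = ((m + 2 * (t + 1) : ℕ) : ℂ) ^ 2 := by
        rw [h, hμ]; push_cast; ring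
      have h2 : m ^ 2 = (m + 2 * (t + 1)) ^ 2 := by exact_mod_cast h1
      have h3 := Nat.pow_left_injective (n := 2) (by norm_num) h2
      omega
    obtain ⟨q, hq⟩ := exists_aeval_mul_apply_eq hc hev
    set χ := aeval (casimir (Module.Dual ℂ Env)) q φ with hχ
    have hχw : χ ∈ hWeightSpace _ μ :=
      aeval_mem_of_mapsTo (fun y hy => casimir_mem_hWeightSpace hy) q φ hφ
    have hχr : χ ∈ rightEigen sl2H ν := aeval_casimir_mem _ q hr
    have hχn : ((LieModule.toEnd ℂ sl2 (Module.Dual ℂ Env) sl2E) ^ n) χ = 0 := by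
      rw [hχ, aeval_casimir_e_pow, hn, map_zero]
    have hχc : χ ∈ (casimir (Module.Dual ℂ Env)).maxGenEigenspace ((m : ℂ) ^ 2) :=
      aeval_mem_of_mapsTo
        (fun y hy => (casimir _).mapsTo_maxGenEigenspace_of_comm (Commute.refl _) _ hy) q φ hc
    have hφeq : φ = (4 : ℂ) • ⁅sl2F, ⁅sl2E, χ⁆⁆ := by
      rw [map_mul, Module.End.mul_apply, ← hχ, aeval_casimir_X_sub_C,
        casimir_of_mem_hWeightSpace hχw, add_sub_cancel_right] at hq
      exact hq.symm
    rw [hφeq]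
    refine Submodule.smul_mem _ _ (lie_mem_matrixElements _ (ih (n := n) ?_
      ((rightEigen sl2H ν).lie_mem hχr) ?_ (lie_mem_casimirBlock _ hχc)))
    · have h := hWeightSpace_e _ hχw
      rwa [hμ, show -(m : ℂ) - 1 - 2 * ((t + 1 : ℕ) : ℂ) + 2 = -(m : ℂ) - 1 - 2 * t by
        push_cast; ring] at h
    · rw [← e_pow_succ_apply, e_pow_succ_apply', hχn, lie_zero]

end MatrixElements

/-! ### The image as a direct sum over antidominant weights -/

section Decomposition

/-- A functional of integral left weight that is far below the relevant highest weights is a sum of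
matrix elements of projective covers. -/
theorem mem_iSup_matrixElements {M : Submodule ℂ (Module.Dual ℂ Env)}
    (hM : ∀ (m t n : ℕ) (ν : ℂ), ∀ φ ∈ hWeightSpace (Module.Dual ℂ Env) (-(m : ℂ) - 1 - 2 * t),
      φ ∈ rightEigen sl2H ν →
      ((LieModule.toEnd ℂ sl2 (Module.Dual ℂ Env) sl2E) ^ n) φ = 0 →
      φ ∈ (casimir (Module.Dual ℂ Env)).maxGenEigenspace ((m : ℂ) ^ 2) → φ ∈ M)
    {μ : ℤ} {ν : ℂ} {n : ℕ} {φ : Module.Dual ℂ Env} (hφ : φ ∈ hWeightSpace _ (μ : ℂ))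
    (hr : φ ∈ rightEigen sl2H ν)
    (hn : ((LieModule.toEnd ℂ sl2 (Module.Dual ℂ Env) sl2E) ^ n) φ = 0) (hμ : μ + n ≤ 0) :
    φ ∈ M := by
  let Y : Submodule ℂ (Module.Dual ℂ Env) := hWeightSpace _ (μ : ℂ) ⊓
    ((rightEigen sl2H ν).toSubmodule ⊓
      LinearMap.ker ((LieModule.toEnd ℂ sl2 (Module.Dual ℂ Env) sl2E) ^ n))
  have hY : ∀ y ∈ Y, casimir _ y ∈ Y := by
    rintro y ⟨h1, h2, h3⟩
    refine ⟨casimir_mem_hWeightSpace h1, ?_, ?_⟩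
    · simpa using aeval_casimir_mem (rightEigen sl2H ν) X h2
    · have h4 : ((LieModule.toEnd ℂ sl2 (Module.Dual ℂ Env) sl2E) ^ n) y = 0 := h3
      change ((LieModule.toEnd ℂ sl2 (Module.Dual ℂ Env) sl2E) ^ n) (casimir _ y) = 0
      rw [casimir_e_pow, h4, map_zero]
  have h1 := mem_genEigenSum_casimir hφ hn hY ⟨hφ, hr, hn⟩
  refine (iSup_le fun r y hy => ?_ : genEigenSum _ Y ≤ M) h1
  by_cases hy0 : y = 0
  · rw [hy0]; exact zero_mem _
  obtain ⟨⟨hyw, hyr, hyn⟩, hyc⟩ := hy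
  obtain ⟨j, hj, rfl⟩ := exists_eq_sq_of_mem_casimirBlock hy0 hyw hyn hyc
  -- Take `m = |μ+1+2j|`. Then `t = -μ-1-j` or `t = j` according to the sign; the first is
  -- nonnegative because `j < n` and `μ + n ≤ 0`.
  obtain ⟨m, t, hm, ht⟩ : ∃ m t : ℕ, (m : ℤ) ^ 2 = (μ + 1 + 2 * j) ^ 2 ∧
      μ = -(m : ℤ) - 1 - 2 * t := by
    rcases le_total 0 (μ + 1 + 2 * j) with h | h
    · obtain ⟨m, hm⟩ := Int.eq_ofNat_of_zero_le h
      obtain ⟨t, ht⟩ := Int.eq_ofNat_of_zero_le (show 0 ≤ -μ - 1 - j by omega)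
      exact ⟨m, t, by rw [hm], by omega⟩
    · obtain ⟨m, hm⟩ := Int.eq_ofNat_of_zero_le (show 0 ≤ -(μ + 1 + 2 * j) by omega)
      refine ⟨m, j, ?_, by omega⟩
      have h2 : (m : ℤ) = -(μ + 1 + 2 * j) := by omega
      rw [h2]; ring
  have hm' : (m : ℂ) ^ 2 = ((μ : ℂ) + 1 + 2 * j) ^ 2 := by exact_mod_cast hm
  have ht' : (μ : ℂ) = -(m : ℂ) - 1 - 2 * t := by exact_mod_cast ht
  refine hM m t n ν y (ht' ▸ hyw) hyr hyn ?_
  rw [hm']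
  exact hyc

theorem e_pow_vartheta_monomialReg (i j : ℕ) (n : ℤ) :
    ((LieModule.toEnd ℂ sl2 (Module.Dual ℂ Env) sl2E) ^ (i + 1))
      (vartheta (monomialReg i j n)) = 0 := by
  induction i generalizing n with
  | zero =>
    rw [e_pow_succ_apply, ← lie_left_eq, ← vartheta_lie, lie_e_monomialReg]
    simp
  | succ i ih =>
    rw [e_pow_succ_apply, ← lie_left_eq, ← vartheta_lie, lie_e_monomialReg, map_smul, map_smul,
      Nat.add_sub_cancel, ih, smul_zero]

/-- Left `e` sends `a^(i+1) d^j c^(n-1)` to a nonzero multiple of `a^i d^j c^n`, so membership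
propagates upwards in weight from monomials of low weight. -/
theorem vartheta_monomialReg_mem_of_shift {M : Submodule ℂ (Module.Dual ℂ Env)}
    (hM : ∀ φ ∈ M, ⁅sl2E, φ⁆ ∈ M) (i j k : ℕ) (n : ℤ)
    (h : vartheta (monomialReg (i + k) j (n - k)) ∈ M) : vartheta (monomialReg i j n) ∈ M := by
  induction k generalizing i n with
  | zero => simpa using h
  | succ k ih =>
    have h1 : vartheta (monomialReg (i + 1) j (n - 1)) ∈ M := by
      refine ih (i + 1) (n - 1) ?_
      have e1 : i + 1 + k = i + (k + 1) := by omega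
      have e2 : n - 1 - (k : ℤ) = n - ((k + 1 : ℕ) : ℤ) := by push_cast; ring
      rw [e1, e2]
      exact h
    have h2 := hM _ h1
    rw [← lie_left_eq, ← vartheta_lie, lie_e_monomialReg, map_smul, Nat.add_sub_cancel,
      sub_add_cancel] at h2
    have hne : (-((i + 1 : ℕ) : ℂ)) ≠ 0 := neg_ne_zero.2 (Nat.cast_ne_zero.2 (Nat.succ_ne_zero i))
    exact (Submodule.smul_mem_iff M hne).1 h2

theorem range_vartheta_le {M : Submodule ℂ (Module.Dual ℂ Env)}
    (hMe : ∀ φ ∈ M, ⁅sl2E, φ⁆ ∈ M)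
    (hM : ∀ (m t n : ℕ) (ν : ℂ), ∀ φ ∈ hWeightSpace (Module.Dual ℂ Env) (-(m : ℂ) - 1 - 2 * t),
      φ ∈ rightEigen sl2H ν →
      ((LieModule.toEnd ℂ sl2 (Module.Dual ℂ Env) sl2E) ^ n) φ = 0 →
      φ ∈ (casimir (Module.Dual ℂ Env)).maxGenEigenspace ((m : ℂ) ^ 2) → φ ∈ M) :
    LinearMap.range vartheta ≤ M := by
  rw [← range_theta, theta, Finsupp.range_linearCombination]
  refine Submodule.span_le.2 ?_
  rintro _ ⟨⟨i, j, n⟩, rfl⟩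
  -- Shifting by `k` lowers the left weight to `n+j-i-2k` but raises the nilpotency order only to
  -- `i+k+1`. Their sum is `n+j+1-k`, nonpositive for this `k`.
  obtain ⟨k, hk⟩ : ∃ k : ℕ, n + j + 1 ≤ k := ⟨(n + j + 1).toNat, Int.self_le_toNat _⟩
  refine vartheta_monomialReg_mem_of_shift hMe i j k n
    (mem_iSup_matrixElements hM (vartheta_monomialReg_mem (i + k) j (n - k))
      (ν := ((n - k : ℤ) : ℂ) + (i + k : ℕ) - j) ?_ (e_pow_vartheta_monomialReg _ _ _) ?_)
  · rw [mem_rightEigen, ← vartheta_lie, lie_h_monomialReg_right, map_smul]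
  · push_cast
    omega

/-- It remains to exhibit a nonzero highest weight module of weight `-m-1`. The functional of
`c^(-m-1)` generates one: it is a highest weight vector, and its value `1` at `1` shows that it is
nonzero. -/
theorem exists_isProjectiveCover_bigProjective (m : ℕ) :
    IsProjectiveCover (BigProjective m) (-(m : ℂ) - 1) := by
  set φ := vartheta (monomialReg 0 0 (-(m : ℤ) - 1)) with hφ
  have hφ1 : φ 1 = 1 := vartheta_monomialReg_one _
  have hφw : φ ∈ hWeightSpace _ (-(m : ℂ) - 1) := by
    simpa using vartheta_monomialReg_mem 0 0 (-(m : ℤ) - 1)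
  have hφe : ⁅sl2E, φ⁆ = 0 := by
    simpa [pow_one] using e_pow_vartheta_monomialReg 0 0 (-(m : ℤ) - 1)
  have hmem : φ ∈ LieSubmodule.lieSpan ℂ sl2 {φ} := LieSubmodule.subset_lieSpan rfl
  let v : LieSubmodule.lieSpan ℂ sl2 {φ} := ⟨φ, hmem⟩
  refine isProjectiveCover_bigProjective (v := v) ?_ ?_ ?_ ?_
  · intro h0
    have h1 : φ = 0 := congrArg Subtype.val h0
    rw [h1] at hφ1
    simp at hφ1
  · exact Subtype.ext hφw
  · exact Subtype.ext hφe
  · refine eq_top_iff.2 fun x _ => ?_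
    have hle : LieSubmodule.lieSpan ℂ sl2 {φ} ≤
        (LieSubmodule.lieSpan ℂ sl2 {v}).map (LieSubmodule.lieSpan ℂ sl2 {φ}).incl := by
      refine LieSubmodule.lieSpan_le.2 ?_
      rintro _ rfl
      exact (LieSubmodule.mem_map _).2 ⟨v, LieSubmodule.subset_lieSpan rfl, rfl⟩
    obtain ⟨y, hy, hyx⟩ := (LieSubmodule.mem_map _).1 (hle x.2)
    have : y = x := Subtype.ext hyx
    exact this ▸ hy

theorem exists_eq_neg_sub_one (l : strictlyAntidominant) :
    ∃ m : ℕ, (((l : ℤ) : ℂ)) = -(m : ℂ) - 1 := by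
  obtain ⟨l, m, rfl⟩ := l
  exact ⟨m, by push_cast; ring⟩

variable (P : strictlyAntidominant → Type) [∀ l, AddCommGroup (P l)] [∀ l, Module ℂ (P l)]
  [∀ l, LieRingModule sl2 (P l)] [∀ l, LieModule ℂ sl2 (P l)]

variable {P} in
theorem range_vartheta_eq (hP : ∀ l, IsProjectiveCover (P l) ((l : ℤ) : ℂ)) :
    LinearMap.range vartheta = ⨆ l, matrixElements (P l) := by
  refine le_antisymm (range_vartheta_le ?_ ?_) (iSup_le fun l => ?_)
  · intro φ hφ
    have hle : (⨆ l, matrixElements (P l)) ≤ (⨆ l, matrixElements (P l)).comap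
        (LieModule.toEnd ℂ sl2 (Module.Dual ℂ Env) sl2E) :=
      iSup_le fun l χ hχ => Submodule.mem_iSup_of_mem l (lie_mem_matrixElements sl2E hχ)
    exact hle hφ
  · intro m t n ν φ hw hr hn hc
    have hP' := hP ⟨-((m : ℤ) + 1), m, rfl⟩
    rw [show (((-((m : ℤ) + 1) : ℤ)) : ℂ) = -(m : ℂ) - 1 by push_cast; ring] at hP'
    exact Submodule.mem_iSup_of_mem _ (mem_matrixElements hP' hw hr hn hc)
  · obtain ⟨m, hm⟩ := exists_eq_neg_sub_one l
    exact matrixElements_le_range (hm ▸ hP l)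

variable {P} in
-- Each summand lies in the left Casimir block `(l+1)²`, and `l ↦ (l+1)²` is injective on negative
-- integers; independence is inherited from the generalized eigenspaces.
theorem iSupIndep_matrixElements (hP : ∀ l, IsProjectiveCover (P l) ((l : ℤ) : ℂ)) :
    iSupIndep fun l => matrixElements (P l) := by
  have hinj : Function.Injective fun l : strictlyAntidominant => (((l : ℤ) : ℂ) + 1) ^ 2 := by
    rintro ⟨_, m, rfl⟩ ⟨_, m', rfl⟩ h
    have h1 : ((m : ℂ)) ^ 2 = (m' : ℂ) ^ 2 := by
      have h2 : ((-((m : ℤ) + 1) : ℤ) + 1 : ℂ) ^ 2 = ((-((m' : ℤ) + 1) : ℤ) + 1 : ℂ) ^ 2 := h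
      push_cast at h2
      linear_combination h2
    have h3 : m ^ 2 = m' ^ 2 := by exact_mod_cast h1
    have h4 := Nat.pow_left_injective (n := 2) (by norm_num) h3
    subst h4
    rfl
  refine ((casimir (Module.Dual ℂ Env)).independent_maxGenEigenspace.comp hinj).mono fun l => ?_
  obtain ⟨m, hm⟩ := exists_eq_neg_sub_one l
  have h := matrixElements_le_casimirBlock (m := m) (V := P l) (hm ▸ hP l)
  have h2 : (((l : ℤ) : ℂ) + 1) ^ 2 = (m : ℂ) ^ 2 := by rw [hm]; ring
  rw [Function.comp_apply, h2]
  exact h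

theorem range_matrixElementMap (V : Type) [AddCommGroup V] [Module ℂ V] [LieRingModule sl2 V]
    [LieModule ℂ sl2 V] :
    LinearMap.range (matrixElementMap V : OuterTensor V (RestrictedDual V) →ₗ[ℂ] _) =
      matrixElements V := by
  refine le_antisymm ?_ (Submodule.span_le.2 ?_)
  · rintro _ ⟨t, rfl⟩
    change TensorProduct.lift (matrixElementBilin V) t ∈ _
    induction t using TensorProduct.induction_on with
    | zero => rw [map_zero]; exact zero_mem _
    | tmul v k => exact matrixElement_mem v k
    | add s t hs ht => rw [map_add]; exact add_mem hs ht
  · rintro _ ⟨v, k, rfl⟩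
    exact ⟨OuterTensor.tmul v k, rfl⟩

/-- The embedding of `(V ⊗ V^⋆) / I` into the functionals on the enveloping algebra. -/
noncomputable def quotientMap (V : Type) [AddCommGroup V] [Module ℂ V] [LieRingModule sl2 V]
    [LieModule ℂ sl2 V] :
    (OuterTensor V (RestrictedDual V) ⧸ vanishing V) →ₗ[ℂ] Module.Dual ℂ Env :=
  (vanishing V).toSubmodule.liftQ
    (matrixElementMap V : OuterTensor V (RestrictedDual V) →ₗ[ℂ] Module.Dual ℂ Env) fun _ h => h

theorem quotientMap_injective (V : Type) [AddCommGroup V] [Module ℂ V] [LieRingModule sl2 V]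
    [LieModule ℂ sl2 V] : Function.Injective (quotientMap V) :=
  LinearMap.ker_eq_bot.1 (Submodule.ker_liftQ_eq_bot _ _ _ fun _ h => h)

theorem range_quotientMap (V : Type) [AddCommGroup V] [Module ℂ V] [LieRingModule sl2 V]
    [LieModule ℂ sl2 V] : LinearMap.range (quotientMap V) = matrixElements V := by
  rw [← range_matrixElementMap]
  refine le_antisymm ?_ ?_
  · rintro _ ⟨q, rfl⟩
    obtain ⟨t, rfl⟩ := LieSubmodule.Quotient.surjective_mk' (vanishing V) q
    exact ⟨t, rfl⟩
  · rintro _ ⟨t, rfl⟩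
    exact ⟨LieSubmodule.Quotient.mk t, rfl⟩

theorem quotientMap_lie (V : Type) [AddCommGroup V] [Module ℂ V] [LieRingModule sl2 V]
    [LieModule ℂ sl2 V] (a : sl2 × sl2) (q : OuterTensor V (RestrictedDual V) ⧸ vanishing V) :
    quotientMap V ⁅a, q⁆ = ⁅a, quotientMap V q⁆ := by
  obtain ⟨t, rfl⟩ := LieSubmodule.Quotient.surjective_mk' (vanishing V) q
  rw [← LieModuleHom.map_lie]
  change matrixElementMap V ⁅a, t⁆ = ⁅a, matrixElementMap V t⁆
  rw [LieModuleHom.map_lie]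

end Decomposition

/-! ### Comparing a module with an external direct sum inside a common module -/

section DirectSum

open DirectSum

variable {ι : Type} [DecidableEq ι] {L : Type} [LieRing L] {M : ι → Type}
  [∀ i, AddCommGroup (M i)] [∀ i, Module ℂ (M i)] [∀ i, LieRingModule L (M i)] {N : Type}
  [AddCommGroup N] [Module ℂ N] (f : ∀ i, M i →ₗ[ℂ] N)

theorem toModule_lieModuleOf (i : ι) (x : M i) :
    DirectSum.toModule ℂ ι N f (lieModuleOf ℂ ι L M i x) = f i x :=
  DirectSum.toModule_lof ℂ i x

variable [LieRingModule L N]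

theorem toModule_lie (hf : ∀ i (a : L) (x : M i), f i ⁅a, x⁆ = ⁅a, f i x⁆) (a : L)
    (x : ⨁ i, M i) :
    DirectSum.toModule ℂ ι N f ⁅a, x⁆ = ⁅a, DirectSum.toModule ℂ ι N f x⁆ := by
  induction x using DirectSum.induction_on with
  | zero => rw [lie_zero, map_zero, lie_zero]
  | add x y hx hy => rw [lie_add, map_add, hx, hy, map_add, lie_add]
  | of i x =>
    change DirectSum.toModule ℂ ι N f ⁅a, lieModuleOf ℂ ι L M i x⁆ =
      ⁅a, DirectSum.toModule ℂ ι N f (lieModuleOf ℂ ι L M i x)⁆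
    rw [← LieModuleHom.map_lie, toModule_lieModuleOf, toModule_lieModuleOf, hf]

theorem range_toModule :
    LinearMap.range (DirectSum.toModule ℂ ι N f) = ⨆ i, LinearMap.range (f i) := by
  refine le_antisymm ?_ (iSup_le fun i => ?_)
  · rintro _ ⟨x, rfl⟩
    induction x using DirectSum.induction_on with
    | zero => rw [map_zero]; exact zero_mem _
    | add x y hx hy => rw [map_add]; exact add_mem hx hy
    | of i x =>
      exact Submodule.mem_iSup_of_mem i ⟨x, (DirectSum.toModule_lof ℂ i x).symm⟩
  · rintro _ ⟨x, rfl⟩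
    exact ⟨DirectSum.lof ℂ ι M i x, DirectSum.toModule_lof ℂ i x⟩

/-- The map factors through the direct sum of the images: componentwise injectivity handles the
first factor and independence the second. -/
theorem toModule_injective (hf : ∀ i, Function.Injective (f i))
    (h : iSupIndep fun i => LinearMap.range (f i)) :
    Function.Injective (DirectSum.toModule ℂ ι N f) := by
  let j : ∀ i, M i →ₗ[ℂ] LinearMap.range (f i) := fun i => (f i).rangeRestrict
  have h1 : Function.Injective (DFinsupp.mapRange.linearMap j) :=
    (DFinsupp.mapRange_injective _ fun i => map_zero (j i)).2 fun i x y hxy =>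
      hf i (congrArg Subtype.val hxy)
  have h2 := h.dfinsupp_lsum_injective
  have h3 : DirectSum.toModule ℂ ι N f =
      (DFinsupp.lsum ℕ fun i => (LinearMap.range (f i)).subtype) ∘ₗ
        (DFinsupp.mapRange.linearMap j) := by
    refine DirectSum.linearMap_ext ℂ fun i => ?_
    ext x
    rw [LinearMap.comp_apply, DirectSum.toModule_lof]
    change _ = DFinsupp.lsum ℕ (fun i => (LinearMap.range (f i)).subtype)
      (DFinsupp.mapRange.linearMap j (DFinsupp.single i x))
    rw [DFinsupp.mapRange.linearMap_apply, DFinsupp.mapRange_single, DFinsupp.lsum_single]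
    rfl
  rw [h3]
  exact h2.comp h1

/-- A Lie module that embeds with the same image as a direct sum is isomorphic to it. -/
theorem exists_lieModuleEquiv {R : Type} [AddCommGroup R] [Module ℂ R] [LieRingModule L R]
    (g : R →ₗ[ℂ] N) (hg : Function.Injective g)
    (hg' : ∀ (a : L) (ψ : R), g ⁅a, ψ⁆ = ⁅a, g ψ⁆) (hf : ∀ i, Function.Injective (f i))
    (hf' : ∀ i (a : L) (x : M i), f i ⁅a, x⁆ = ⁅a, f i x⁆)
    (h : iSupIndep fun i => LinearMap.range (f i))
    (hr : LinearMap.range g = ⨆ i, LinearMap.range (f i)) :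
    ∃ Φ : R ≃ₗ⁅ℂ,L⁆ ⨁ i, M i, ∀ i (x : M i), g (Φ.symm (lieModuleOf ℂ ι L M i x)) = f i x := by
  have hinj := toModule_injective f hf h
  let e : R ≃ₗ[ℂ] ⨁ i, M i := (LinearEquiv.ofInjective g hg).trans
    ((LinearEquiv.ofEq _ _ (hr.trans (range_toModule f).symm)).trans
      (LinearEquiv.ofInjective _ hinj).symm)
  have he : ∀ ψ, DirectSum.toModule ℂ ι N f (e ψ) = g ψ := fun ψ =>
    congrArg Subtype.val ((LinearEquiv.ofInjective _ hinj).apply_symm_apply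
      (LinearEquiv.ofEq _ _ (hr.trans (range_toModule f).symm) (LinearEquiv.ofInjective g hg ψ)))
  let Φ : R ≃ₗ⁅ℂ,L⁆ ⨁ i, M i :=
    { e with
      map_lie' := fun {a ψ} => hinj (by
        change DirectSum.toModule ℂ ι N f (e ⁅a, ψ⁆) = DirectSum.toModule ℂ ι N f ⁅a, e ψ⁆
        rw [he, toModule_lie f hf', he, hg']) }
  refine ⟨Φ, fun i x => ?_⟩
  rw [← toModule_lieModuleOf (L := L) f i x, ← he]
  exact congrArg _ (e.apply_symm_apply _)

end DirectSum

end BigCell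
open BigCell DirectSum in
theorem mainTheorem1 :
    (∀ l : strictlyAntidominant, ∃ (P : Type) (_ : AddCommGroup P) (_ : Module ℂ P)
      (_ : LieRingModule sl2 P) (_ : LieModule ℂ sl2 P), IsProjectiveCover P ((l : ℤ) : ℂ)) ∧
    ∀ (P : strictlyAntidominant → Type) [∀ l, AddCommGroup (P l)] [∀ l, Module ℂ (P l)]
      [∀ l, LieRingModule sl2 (P l)] [∀ l, LieModule ℂ sl2 (P l)],
      (∀ l, IsProjectiveCover (P l) ((l : ℤ) : ℂ)) →
      (Function.Injective vartheta ∧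
        (∀ (a : sl2 × sl2) (ψ : regularFunctions), vartheta ⁅a, ψ⁆ = ⁅a, vartheta ψ⁆) ∧
        LinearMap.range vartheta = ⨆ l, matrixElements (P l) ∧
        iSupIndep fun l => matrixElements (P l)) ∧
      ∃ Φ : regularFunctions ≃ₗ⁅ℂ,sl2 × sl2⁆
          ⨁ l, OuterTensor (P l) (RestrictedDual (P l)) ⧸ vanishing (P l),
        ∀ (l : strictlyAntidominant) (v : P l) (k : RestrictedDual (P l)),
          vartheta (Φ.symm (lieModuleOf ℂ strictlyAntidominant (sl2 × sl2)
            (fun l => OuterTensor (P l) (RestrictedDual (P l)) ⧸ vanishing (P l)) l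
            (LieSubmodule.Quotient.mk (OuterTensor.tmul v k)))) = matrixElement (P l) v k := by
  refine ⟨fun l => ?_, fun P _ _ _ _ hP => ?_⟩
  · obtain ⟨m, hm⟩ := exists_eq_neg_sub_one l
    rw [hm]
    exact ⟨BigProjective m, inferInstance, inferInstance, inferInstance, inferInstance,
      exists_isProjectiveCover_bigProjective m⟩
  have hrange := range_vartheta_eq hP
  have hindep := iSupIndep_matrixElements hP
  refine ⟨⟨vartheta_injective, vartheta_lie, hrange, hindep⟩, ?_⟩
  -- Identifying the images of the quotients with the spaces of matrix elements turns the internal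
  -- decomposition into the external one.
  have hq : (fun l => LinearMap.range (quotientMap (P l))) = fun l => matrixElements (P l) :=
    funext fun l => range_quotientMap (P l)
  obtain ⟨Φ, hΦ⟩ := exists_lieModuleEquiv (fun l => quotientMap (P l)) vartheta
    vartheta_injective vartheta_lie (fun l => quotientMap_injective (P l))
    (fun l => quotientMap_lie (P l)) (hq ▸ hindep) (by rw [hrange, ← hq])
  exact ⟨Φ, fun l v k => (hΦ l _).trans (matrixElementMap_tmul (P l) v k)⟩
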